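/- **Setting.** For a finite universe $U$, $|U|=n$, a set system $\mathcal F\subseteq 2^U$ is *monotone* if $U\in\mathcal F$ and $S\subseteq T\subseteq U$, $S\in\mathcal F$ imply $T\in\mathcal F$. A set $S\subseteq U$ is an *$x$-extension* of $X\subseteq U$ if $X\cup S\in\mathcal F$ and $|S|\le x$. A *random $\alpha$-extension oracle* for $(U,\mathcal F)$ is a function $\mathcal O:2^U\times\mathbb N\times\{0,1\}^m\to 2^U$ (for some $m\in\mathbb N$) such that $X\cup\mathcal O(X,\ell,r)\in\mathcal F$ always, and, whenever $X$ has an $\ell$-extension, $\mathcal O(X,\ell,r)$ is an $\alpha\ell$-extension of $X$ for at least half of all $r\in\{0,1\}^m$; it is *deterministic* if $m=0$. A *specification list* is a non-empty finite set $\mathcal L$ of pairs $(\alpha,c)$ of real numbers $\alpha,c\ge1$. In *$\mathcal L$-SUB* an instance is a universe $U$ with a monotone set system $\mathcal F$, and one seeks $S\in\mathcal F$ of minimum size. The algorithm is given $U$ and, for each $(\alpha,c)\in\mathcal L$, access to an $\alpha$-extension oracle $\mathcal O_{\alpha,c}$ for $(U,\mathcal F)$, each query to a random oracle being made with fresh random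 bits $r$. Algorithms are programs of a random access machine with natural-number and real memory cells and with the parameters $\alpha,c$ of $\mathcal L$ and $\beta$ as real constants. Its elementary operations, each counted as one, are: reading, writing and indirect addressing of cells; addition, truncated subtraction, halving and comparison of natural numbers; conversion of a natural number to a real; arithmetic, powers of positive bases and comparison of real numbers, without rounding; coin flips; and issuing a query. The *cost* of an execution is the number of operations plus $c^\ell$ for each query $(X,\ell)$ to $\mathcal O_{\alpha,c}$. An algorithm has cost at most $f$ if, for all $n$, every execution on an input with $|U|\le n$ halts with cost at most $f(n)$. An algorithm is a *(randomized) $\beta$-approximation* for $\mathcal L$-SUB if, for all $U,\mathcal F$ and all oracles as above, it always returns some $S\in\mathcal F$, and $|S|\le\beta\min_{T\in\mathcal F}|T|$ with probability at least $\frac12$. It is a *deterministic $\beta$-approximation* if it flips no coins and, for all $U,\mathcal F$ and all deterministic oracles, it returns $S\in\mathcal F$ with $|S|\le\beta\min_{T\in\mathcal F}|T|$. Let $$\mathrm{best}(\mathcal L,\beta)=\inf\{d\ge1 : \text{there is a (randomized) }\beta\text{-approximation for }\mathcal L\text{-SUB of cost at most } d^n n^{O(1)}\}.$$ **The algorithm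 $\mathrm{DetAMLS}_{\mathcal L,\beta}$.** Let $n=|U|$ and, for $\alpha,\beta\ge1$, let $M^*_{\alpha,\beta}=0$ if $\alpha\le\beta$ and $M^*_{\alpha,\beta}=\frac{\alpha-\beta}{\alpha-1}$ otherwise. Put $x_\alpha(k,t)=(1-\frac\beta\alpha)k+\frac t\alpha$, $$p(n,k,t,x)=\sum_{\substack{0\le y\le\min\{t,k\}\\ y\ge x}}\frac{\binom ky\binom{n-k}{t-y}}{\binom nt},\qquad \kappa(n,k,t,y)=\frac{\binom nt}{\binom ky\binom{n-k}{t-y}}.$$ For $k=0,1,\dots,\lfloor n/\beta\rfloor$ the algorithm 1. chooses $(\alpha,c)\in\mathcal L$ and $t\in[M^*_{\alpha,\beta}k,\beta k]\cap\mathbb N$ minimizing $c^{(\beta k-t)/\alpha}/p(n,k,t,x_\alpha(k,t))$, and sets $x=x_\alpha(k,t)$; 2. chooses a natural number $y$ with $x\le y\le\min\{t,k\}$ minimizing $\kappa(n,k,t,y)$; 3. computes a family $\mathcal C$ of $t$-element subsets of $U$ such that every $k$-element $T\subseteq U$ satisfies $|T\cap X|\ge y$ for some $X\in\mathcal C$;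 4. for each $X\in\mathcal C$ queries $Y=\mathcal O_{\alpha,c}(X,k-\lceil x\rceil)$ and records $X\cup Y$. Finally it returns a recorded set of minimum size. A program *implements* $\mathrm{DetAMLS}_{\mathcal L,\beta}$ if it flips no coins and, on all inputs with deterministic oracles, its sequence of queries and its output are those of a run of this scheme (for some choice of minimizers and of families $\mathcal C$). **Theorem.** Let $\mathcal L$ be a specification list and $\beta\ge1$ a real number. Every implementation of $\mathrm{DetAMLS}_{\mathcal L,\beta}$ is a deterministic $\beta$-approximation for $\mathcal L$-SUB. Moreover, $\mathrm{DetAMLS}_{\mathcal L,\beta}$ has an implementation of cost at most $\mathrm{best}(\mathcal L,\beta)^n\cdot2^{o(n)}$, where $o(n)$ may depend on $\mathcal L$ and $\beta$. -/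

import Mathlib

open MeasureTheory Asymptotics Filter

namespace AMLS

noncomputable section

/-! ### Set systems and extension oracles

A universe with `n` elements is taken to be `Fin n`. -/

/-- The set system `F` is monotone: it contains the whole universe and is closed upwards. -/
def IsMonotone {n : ℕ} (F : Set (Finset (Fin n))) : Prop :=
  Finset.univ ∈ F ∧ ∀ S T : Finset (Fin n), S ⊆ T → S ∈ F → T ∈ F

/-- `S` is an `x`-extension of `X` with respect to `F`. -/
def IsExtension {n : ℕ} (F : Set (Finset (Fin n))) (X : Finset (Fin n)) (x : ℝ)
    (S : Finset (Fin n)) : Prop :=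
  X ∪ S ∈ F ∧ (S.card : ℝ) ≤ x

/-- A function `2^U × ℕ × {0,1}^m → 2^U`, where `m = bits`. -/
structure Oracle (n : ℕ) where
  bits : ℕ
  answer : Finset (Fin n) → ℕ → (Fin bits → Bool) → Finset (Fin n)

/-- `O` is a random `α`-extension oracle for the set system `F`. -/
def Oracle.IsExtensionOracle {n : ℕ} (O : Oracle n) (α : ℝ) (F : Set (Finset (Fin n))) : Prop :=
  (∀ X ℓ r, O.answer X ℓ r ∪ X ∈ F) ∧
  ∀ (X : Finset (Fin n)) (ℓ : ℕ), (∃ S, IsExtension F X (ℓ : ℝ) S) →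
    (1 / 2 : ℝ) * (2 : ℝ) ^ O.bits ≤
      (({r | IsExtension F X (α * ℓ) (O.answer X ℓ r)} : Set (Fin O.bits → Bool)).ncard : ℝ)

/-- A deterministic oracle uses no random bits. -/
def Oracle.IsDeterministic {n : ℕ} (O : Oracle n) : Prop := O.bits = 0

/-- A specification list: a nonempty finite set of pairs `(α, c)` with `α, c ≥ 1`. -/
def IsSpecList (L : Finset (ℝ × ℝ)) : Prop :=
  L.Nonempty ∧ ∀ p ∈ L, 1 ≤ p.1 ∧ 1 ≤ p.2

/-- `O` gives an `α`-extension oracle for `F`, for every `(α, c)` in `L`. -/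
def AreOraclesFor {L : Finset (ℝ × ℝ)} {n : ℕ} (O : L → Oracle n)
    (F : Set (Finset (Fin n))) : Prop :=
  ∀ j : L, (O j).IsExtensionOracle j.1.1 F

/-! ### The machine model

Structured programs for a random access machine with oracles.  The memory has a sequence of cells
holding natural numbers and a sequence of cells holding real numbers (the parameters `α`, `c`, `β`
are arbitrary reals).  Natural numbers can be added, subtracted (with cut-off at `0`), halved and
compared; real numbers can be added, subtracted, multiplied, divided, raised to powers and
compared; there is no rounding of real numbers.  The real constants available to a program are
the parameters of the problem.  Every elementary operation counts `1`. -/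

/-- Expressions for natural numbers; `load a` is the content of the cell with address `a`. -/
inductive NExp where
  | const (m : ℕ)
  | load (a : NExp)
  | add (a b : NExp)
  | sub (a b : NExp)
  | half (a : NExp)

def NExp.eval (M : ℕ → ℕ) : NExp → ℕ
  | .const m => m
  | .load a => M (a.eval M)
  | .add a b => a.eval M + b.eval M
  | .sub a b => a.eval M - b.eval M
  | .half a => a.eval M / 2

/-- Number of operations needed to evaluate an expression. -/
def NExp.ops : NExp → ℕ
  | .const _ => 1
  | .load a => a.ops + 1
  | .add a b => a.ops + b.ops + 1
  | .sub a b => a.ops + b.ops + 1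
  | .half a => a.ops + 1

/-- Expressions for real numbers. -/
inductive RExp (L : Finset (ℝ × ℝ)) where
  | alpha (j : L)
  | price (j : L)
  | beta
  | cast (a : NExp)
  | load (a : NExp)
  | add (x y : RExp L)
  | sub (x y : RExp L)
  | mul (x y : RExp L)
  | div (x y : RExp L)
  | pow (x y : RExp L)

/-- Powers are those of positive bases; the operation `pow` gives `0` for other bases. -/
def RExp.eval {L : Finset (ℝ × ℝ)} (β : ℝ) (M : ℕ → ℕ) (R : ℕ → ℝ) : RExp L → ℝ
  | .alpha j => j.1.1
  | .price j => j.1.2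
  | .beta => β
  | .cast a => (a.eval M : ℝ)
  | .load a => R (a.eval M)
  | .add x y => x.eval β M R + y.eval β M R
  | .sub x y => x.eval β M R - y.eval β M R
  | .mul x y => x.eval β M R * y.eval β M R
  | .div x y => x.eval β M R / y.eval β M R
  | .pow x y =>
      open Classical in
      if 0 < x.eval β M R then (x.eval β M R) ^ (y.eval β M R) else 0

def RExp.ops {L : Finset (ℝ × ℝ)} : RExp L → ℕ
  | .alpha _ => 1
  | .price _ => 1
  | .beta => 1
  | .cast a => a.ops + 1
  | .load a => a.ops + 1
  | .add x y => x.ops + y.ops + 1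
  | .sub x y => x.ops + y.ops + 1
  | .mul x y => x.ops + y.ops + 1
  | .div x y => x.ops + y.ops + 1
  | .pow x y => x.ops + y.ops + 1

/-- Tests. -/
inductive BExp (L : Finset (ℝ × ℝ)) where
  | natLe (a b : NExp)
  | realLe (x y : RExp L)
  | not (b : BExp L)
  | and (b d : BExp L)

def BExp.Holds {L : Finset (ℝ × ℝ)} (β : ℝ) (M : ℕ → ℕ) (R : ℕ → ℝ) : BExp L → Prop
  | .natLe a b => a.eval M ≤ b.eval M
  | .realLe x y => x.eval β M R ≤ y.eval β M R
  | .not b => ¬ b.Holds β M R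
  | .and b d => b.Holds β M R ∧ d.Holds β M R

def BExp.ops {L : Finset (ℝ × ℝ)} : BExp L → ℕ
  | .natLe a b => a.ops + b.ops + 1
  | .realLe x y => x.ops + y.ops + 1
  | .not b => b.ops + 1
  | .and b d => b.ops + d.ops + 1

/-- Programs.  `setNat a v` and `setReal a v` store a value in the cell with address `a`; `flip a`
stores a random bit; `query j X ℓ a` asks the oracle `j` the query `(X, ℓ)`, where the set `X` is
given by its bit mask, and stores the bit mask of the answer. -/
inductive Prog (L : Finset (ℝ × ℝ)) where
  | skip
  | setNat (a v : NExp)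
  | setReal (a : NExp) (v : RExp L)
  | flip (a : NExp)
  | query (j : L) (X ℓ a : NExp)
  | seq (P Q : Prog L)
  | ite (b : BExp L) (P Q : Prog L)
  | loop (b : BExp L) (P : Prog L)

/-- The program never flips a coin. -/
def Prog.Coinless {L : Finset (ℝ × ℝ)} : Prog L → Prop
  | .flip _ => False
  | .seq P Q => P.Coinless ∧ Q.Coinless
  | .ite _ P Q => P.Coinless ∧ Q.Coinless
  | .loop _ P => P.Coinless
  | _ => True

/-- The subset of `Fin n` with bit mask `m`. -/
def decode (n m : ℕ) : Finset (Fin n) := Finset.univ.filter fun i => m.testBit (i : ℕ) = true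

/-- The bit mask of a subset of `Fin n`. -/
def encode {n : ℕ} (Y : Finset (Fin n)) : ℕ := ∑ i ∈ Y, 2 ^ (i : ℕ)

/-- Contents of the memory, and the number of random bits that have been used. -/
structure State where
  nat : ℕ → ℕ
  real : ℕ → ℝ
  pos : ℕ

/-- A query `(X, ℓ)` to the oracle `j`, with its answer. -/
structure Query (L : Finset (ℝ × ℝ)) (n : ℕ) where
  j : L
  X : Finset (Fin n)
  ℓ : ℕ
  Y : Finset (Fin n)

/-- `Exec β O ω P σ σ' p tr`: with the oracles `O` and the sequence `ω` of random bits, the program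
`P` started in the state `σ` halts in the state `σ'` after `p` computational operations, and `tr`
lists its oracle queries in order.  A query to an oracle which takes `m` random bits is given the
next `m` unused bits of `ω`. -/
inductive Exec {L : Finset (ℝ × ℝ)} {n : ℕ} (β : ℝ) (O : L → Oracle n) (ω : ℕ → Bool) :
    Prog L → State → State → ℕ → List (Query L n) → Prop
  | skip (σ : State) : Exec β O ω .skip σ σ 1 []
  | setNat (a v : NExp) (σ : State) :
      Exec β O ω (.setNat a v) σ
        ⟨Function.update σ.nat (a.eval σ.nat) (v.eval σ.nat), σ.real, σ.pos⟩
        (a.ops + v.ops + 1) []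
  | setReal (a : NExp) (v : RExp L) (σ : State) :
      Exec β O ω (.setReal a v) σ
        ⟨σ.nat, Function.update σ.real (a.eval σ.nat) (v.eval β σ.nat σ.real), σ.pos⟩
        (a.ops + v.ops + 1) []
  | flip (a : NExp) (σ : State) :
      Exec β O ω (.flip a) σ
        ⟨Function.update σ.nat (a.eval σ.nat) (ω σ.pos).toNat, σ.real, σ.pos + 1⟩
        (a.ops + 1) []
  | query (j : L) (X ℓ a : NExp) (σ : State) (Y : Finset (Fin n))
      (hY : Y = (O j).answer (decode n (X.eval σ.nat)) (ℓ.eval σ.nat)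
        (fun i => ω (σ.pos + (i : ℕ)))) :
      Exec β O ω (.query j X ℓ a) σ
        ⟨Function.update σ.nat (a.eval σ.nat) (encode Y), σ.real, σ.pos + (O j).bits⟩
        (X.ops + ℓ.ops + a.ops + 1)
        [⟨j, decode n (X.eval σ.nat), ℓ.eval σ.nat, Y⟩]
  | seq {P Q : Prog L} {σ₁ σ₂ σ₃ : State} {p q : ℕ} {tr us : List (Query L n)} :
      Exec β O ω P σ₁ σ₂ p tr → Exec β O ω Q σ₂ σ₃ q us →
      Exec β O ω (.seq P Q) σ₁ σ₃ (p + q) (tr ++ us)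
  | iteTrue {b : BExp L} {P Q : Prog L} {σ₁ σ₂ : State} {p : ℕ} {tr : List (Query L n)} :
      b.Holds β σ₁.nat σ₁.real → Exec β O ω P σ₁ σ₂ p tr →
      Exec β O ω (.ite b P Q) σ₁ σ₂ (b.ops + p) tr
  | iteFalse {b : BExp L} {P Q : Prog L} {σ₁ σ₂ : State} {p : ℕ} {tr : List (Query L n)} :
      ¬ b.Holds β σ₁.nat σ₁.real → Exec β O ω Q σ₁ σ₂ p tr →
      Exec β O ω (.ite b P Q) σ₁ σ₂ (b.ops + p) tr
  | loopDone {b : BExp L} {P : Prog L} {σ : State} :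
      ¬ b.Holds β σ.nat σ.real → Exec β O ω (.loop b P) σ σ b.ops []
  | loopStep {b : BExp L} {P : Prog L} {σ₁ σ₂ σ₃ : State} {p q : ℕ} {tr us : List (Query L n)} :
      b.Holds β σ₁.nat σ₁.real → Exec β O ω P σ₁ σ₂ p tr →
      Exec β O ω (.loop b P) σ₂ σ₃ q us →
      Exec β O ω (.loop b P) σ₁ σ₃ (b.ops + p + q) (tr ++ us)

/-- At the start, cell `0` holds the size of the universe and all other cells hold `0`. -/
def initial (n : ℕ) : State := ⟨Function.update 0 0 n, 0, 0⟩

/-- `Run β O ω P S p tr`: on the universe `Fin n` the program halts and returns the set `S`, whose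
bit mask it has put into cell `1`; it has made `p` operations and the queries `tr`. -/
def Run {L : Finset (ℝ × ℝ)} {n : ℕ} (β : ℝ) (O : L → Oracle n) (ω : ℕ → Bool) (P : Prog L)
    (S : Finset (Fin n)) (p : ℕ) (tr : List (Query L n)) : Prop :=
  ∃ σ : State, Exec β O ω P (initial n) σ p tr ∧ S = decode n (σ.nat 1)

/-- The cost of an execution: a query `(X, ℓ)` to the oracle `(α, c)` costs `c ^ ℓ`. -/
def execCost {L : Finset (ℝ × ℝ)} {n : ℕ} (p : ℕ) (tr : List (Query L n)) : ℝ :=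
  (p : ℝ) + (tr.map fun q => q.j.1.2 ^ q.ℓ).sum

/-- Every execution of `P` on an input with at most `N` elements halts and has cost at most `B`. -/
def CostAtMost {L : Finset (ℝ × ℝ)} (β : ℝ) (P : Prog L) (N : ℕ) (B : ℝ) : Prop :=
  ∀ n ≤ N, ∀ F : Set (Finset (Fin n)), IsMonotone F → ∀ O : L → Oracle n, AreOraclesFor O F →
    ∀ ω : ℕ → Bool, ∃ S p tr, Run β O ω P S p tr ∧ execCost p tr ≤ B

/-! ### Approximation algorithms -/

/-- `S` is a solution whose size is at most `β` times the minimum. -/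
def IsApproxSolution {n : ℕ} (β : ℝ) (F : Set (Finset (Fin n))) (S : Finset (Fin n)) : Prop :=
  S ∈ F ∧ ∀ T ∈ F, (S.card : ℝ) ≤ β * (T.card : ℝ)

/-- The law of a sequence of independent fair coin flips. -/
def coinLaw : Measure (ℕ → Bool) :=
  Measure.infinitePi fun _ : ℕ => (PMF.uniformOfFintype Bool).toMeasure

/-- `P` is a (randomized) `β`-approximation for `L`-subset minimization. -/
def IsRandomizedApprox {L : Finset (ℝ × ℝ)} (β : ℝ) (P : Prog L) : Prop :=
  ∀ (n : ℕ) (F : Set (Finset (Fin n))), IsMonotone F →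
    ∀ O : L → Oracle n, AreOraclesFor O F →
      (∀ ω, ∃ S p tr, Run β O ω P S p tr ∧ S ∈ F) ∧
      1 / 2 ≤ coinLaw {ω | ∃ S p tr, Run β O ω P S p tr ∧ IsApproxSolution β F S}

/-- `P` is a deterministic `β`-approximation for `L`-subset minimization.  (The sequence `ω` plays
no role here, since neither the program nor the oracles use random bits.) -/
def IsDeterministicApprox {L : Finset (ℝ × ℝ)} (β : ℝ) (P : Prog L) : Prop :=
  P.Coinless ∧
  ∀ (n : ℕ) (F : Set (Finset (Fin n))), IsMonotone F →
    ∀ O : L → Oracle n, AreOraclesFor O F → (∀ j, (O j).IsDeterministic) →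
      ∀ ω, ∃ S p tr, Run β O ω P S p tr ∧ IsApproxSolution β F S

/-- The infimum of all `d ≥ 1` for which there is a `β`-approximation for `L`-subset minimization
of cost `d ^ n * n ^ O(1)`. -/
def best (L : Finset (ℝ × ℝ)) (β : ℝ) : ℝ :=
  sInf {d : ℝ | 1 ≤ d ∧ ∃ P : Prog L, IsRandomizedApprox β P ∧
    ∃ C : ℕ, ∀ n : ℕ, 2 ≤ n → CostAtMost β P n (d ^ n * (n : ℝ) ^ C)}

/-! ### Derandomized approximate monotone local search -/

/-- The probability that a uniformly random `t`-subset of `{1, …, n}` has at least `x` elements in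
`{1, …, k}`. -/
def hyper (n k t : ℕ) (x : ℝ) : ℝ :=
  ∑ y ∈ (Finset.range (min t k + 1)).filter (fun y : ℕ => x ≤ (y : ℝ)),
    ((k.choose y : ℝ) * ((n - k).choose (t - y) : ℝ)) / (n.choose t : ℝ)

def Mstar (α β : ℝ) : ℝ :=
  if α ≤ β then 0 else (α - β) / (α - 1)

/-- `(1 - β / α) k + t / α` -/
def threshold (α β : ℝ) (k t : ℕ) : ℝ := (1 - β / α) * k + t / α

/-- The (approximate) cost of repeated sampling with parameters `(α, c)` and `t`. -/
def samplingCost (n : ℕ) (β : ℝ) (k : ℕ) (p : ℝ × ℝ) (t : ℕ) : ℝ :=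
  p.2 ^ ((β * k - t) / p.1) / hyper n k t (threshold p.1 β k t)

def Admissible (α β : ℝ) (k t : ℕ) : Prop := Mstar α β * k ≤ t ∧ (t : ℝ) ≤ β * k

def kappa (n p q r : ℕ) : ℝ :=
  (n.choose q : ℝ) / ((p.choose r : ℝ) * ((n - p).choose (q - r) : ℝ))

/-- `C` is a family of `q`-subsets of the universe such that each `p`-subset meets one of them in
at least `r` elements. -/
def IsSetIntersectionFamily (n p q r : ℕ) (C : List (Finset (Fin n))) : Prop :=
  C.Nodup ∧ (∀ X ∈ C, X.card = q) ∧
  ∀ T : Finset (Fin n), T.card = p → ∃ X ∈ C, r ≤ (T ∩ X).card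

/-- `(α, c) = j` and `t` minimize the sampling cost for `k`. -/
def IsBestSampling {L : Finset (ℝ × ℝ)} (n : ℕ) (β : ℝ) (k : ℕ) (j : L) (t : ℕ) : Prop :=
  Admissible j.1.1 β k t ∧
  ∀ (i : L) (s : ℕ), Admissible i.1.1 β k s →
    samplingCost n β k j.1 t ≤ samplingCost n β k i.1 s

/-- `y` minimizes `kappa n k t` on `{⌈x⌉, …, min t k}`. -/
def IsBestIntersection (n k t : ℕ) (x : ℝ) (y : ℕ) : Prop :=
  (x ≤ y ∧ y ≤ min t k) ∧ ∀ z : ℕ, x ≤ z → z ≤ min t k → kappa n k t y ≤ kappa n k t z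

/-- The list `tr` of queries is that of one round of the algorithm: after the choice of `(α, c)`,
`t`, `y` and of a set intersection family `C`, the query `(X, k - ⌈x⌉)` is put to the oracle
`(α, c)` for each `X` in `C`. -/
def IsRound {L : Finset (ℝ × ℝ)} (n : ℕ) (β : ℝ) (k : ℕ) (tr : List (Query L n)) : Prop :=
  ∃ (j : L) (t y : ℕ) (C : List (Finset (Fin n))),
    IsBestSampling n β k j t ∧
    IsBestIntersection n k t (threshold j.1.1 β k t) y ∧
    IsSetIntersectionFamily n k t y C ∧
    tr.map (fun q => (q.j, q.X, q.ℓ)) =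
      C.map (fun X => (j, X, ((k : ℤ) - ⌈threshold j.1.1 β k t⌉).toNat))

/-- The program `P` is an implementation of derandomized approximate monotone local search: its
queries are those of the rounds `k = 0, 1, …, ⌊n / β⌋`, in this order, and it returns a set of
minimum size among the sets `X ∪ Y`, where `X` is the set of a query and `Y` is the answer. -/
def IsDetAMLS {L : Finset (ℝ × ℝ)} (β : ℝ) (P : Prog L) : Prop :=
  P.Coinless ∧
  ∀ (n : ℕ) (F : Set (Finset (Fin n))), IsMonotone F →
    ∀ O : L → Oracle n, AreOraclesFor O F → (∀ j, (O j).IsDeterministic) →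
      ∀ ω, ∃ (S : Finset (Fin n)) (p : ℕ) (round : ℕ → List (Query L n)),
        Run β O ω P S p ((List.range (⌊(n : ℝ) / β⌋₊ + 1)).flatMap round) ∧
        (∀ k ≤ ⌊(n : ℝ) / β⌋₊, IsRound n β k (round k)) ∧
        (∃ k ≤ ⌊(n : ℝ) / β⌋₊, ∃ q ∈ round k, S = q.X ∪ q.Y) ∧
        ∀ k ≤ ⌊(n : ℝ) / β⌋₊, ∀ q ∈ round k, S.card ≤ (q.X ∪ q.Y).card

end

end AMLS

/-! Correctness. Let `T` be a solution with `k ≤ n / β` elements. In round `k` some `X` of the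
family meets `T` in at least `x_α(k, t)` elements, so `T \ X` is an `ℓ`-extension of `X` for `ℓ = k
- ⌈x_α(k, t)⌉ = ⌊(β k - t) / α⌋`. The oracle adds at most `α ℓ ≤ β k - t` elements to the `t`
elements of `X`, which gives at most `β k`. If `k > n / β`, every set is small enough.

Cost. Let `V` be the largest optimal sampling cost over all `k` (`maxSampling`). It is compared with
both sides.

Lower bound (`samplingCost_le_of_isRandomizedApprox`): a randomized approximation of cost `B`
satisfies `V ≤ poly(n) * B`. An adversary hides a `k`-set `T`: the solutions are the supersets of
`T` and all sets with more than `β k` elements. Its oracles fill `X` up to a large set whenever this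
is allowed, and have to disclose `T` only if `|T \ X| ≤ ℓ` and `|X| + α ℓ < ⌊β k⌋ + 1`. Success on
the instance of `T` requires a disclosing query, so averaging over `T` and the coins gives a single
run whose queries disclose half of all `T`. A query discloses a hypergeometric fraction of them,
which by `mul_hyper_le` is at most `poly(n) * c ^ ℓ / V`.

Upper bound (`exists_cost_detAMLSProg`): the program costs at most `V * 2 ^ o(n)`. The
hypergeometric sum has at most `n + 1` terms `1 / κ`, so a family of `κ * 2 ^ o(n)` sets is
affordable (`kappa_mul_hyper_le`). Such a family is obtained from a code. The universe is cut into
blocks of size `s`, of the order of `log n`. Greedy covering yields nearly optimal families on one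
block, all of them stored in one table. By Vandermonde's identity their products are nearly optimal
on the universe, with a loss polynomial in `s` per block, hence `poly(s) ^ (n / s) = 2 ^ o(n)` in
total. The program never searches for the table: a codeword starts with the table itself, and all
codewords below a bound are decoded (`exists_decode`, `exists_codeMask`). The table has `2 ^ (6 s)`
bits, which is a power of `n` with exponent below `1`, so listing all tables costs `2 ^ o(n)` as
well.

The same program is also a randomized approximation, which makes the set in the definition of `best`
nonempty. Combining both bounds for bases `d` close to `best` gives the theorem. -/

open MeasureTheory Asymptotics Filter

namespace AMLS

noncomputable section

/-! ### Counting sets with a prescribed intersection -/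

theorem card_filter_inter_eq {n : ℕ} (A : Finset (Fin n)) {k y : ℕ} (hy : y ≤ k) :
    ((Finset.powersetCard k (Finset.univ : Finset (Fin n))).filter
      fun T => (T ∩ A).card = y).card = A.card.choose y * (n - A.card).choose (k - y) := by
  have h : (Finset.powersetCard y A ×ˢ Finset.powersetCard (k - y) Aᶜ).card =
      A.card.choose y * (n - A.card).choose (k - y) := by
    rw [Finset.card_product, Finset.card_powersetCard, Finset.card_powersetCard,
      Finset.card_compl, Fintype.card_fin]
  rw [← h]
  refine Finset.card_nbij' (fun T => (T ∩ A, T \ A)) (fun p => p.1 ∪ p.2) ?_ ?_ ?_ ?_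
  · intro T hT
    simp only [Finset.coe_filter, Finset.mem_powersetCard, Finset.subset_univ, true_and,
      Set.mem_ofPred_eq] at hT
    have h1 := Finset.card_sdiff_add_card_inter T A
    simp only [Finset.coe_product, Set.mem_prod, Finset.mem_coe, Finset.mem_powersetCard]
    refine ⟨⟨Finset.inter_subset_right, hT.2⟩, ?_, by omega⟩
    intro x hx
    simp only [Finset.mem_sdiff] at hx
    simpa using hx.2
  · rintro ⟨B, D⟩ hp
    simp only [Finset.coe_product, Set.mem_prod, Finset.mem_coe, Finset.mem_powersetCard] at hp
    obtain ⟨⟨hB, hBc⟩, hD, hDc⟩ := hp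
    have hdisj : Disjoint D A := by
      rw [Finset.disjoint_left]
      intro x hx
      simpa using hD hx
    have hBD : Disjoint B D := (hdisj.mono_right hB).symm
    simp only [Finset.coe_filter, Finset.mem_powersetCard, Finset.subset_univ, true_and,
      Set.mem_ofPred_eq]
    constructor
    · rw [Finset.card_union_of_disjoint hBD]; omega
    · rw [Finset.union_inter_distrib_right, Finset.disjoint_iff_inter_eq_empty.1 hdisj,
        Finset.union_empty, Finset.inter_eq_left.2 hB, hBc]
  · intro T _
    exact (Finset.union_comm _ _).trans (Finset.sdiff_union_inter T A)
  · rintro ⟨B, D⟩ hp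
    simp only [Finset.coe_product, Set.mem_prod, Finset.mem_coe, Finset.mem_powersetCard] at hp
    obtain ⟨⟨hB, -⟩, hD, -⟩ := hp
    have hdisj : Disjoint D A := by
      rw [Finset.disjoint_left]
      intro x hx
      simpa using hD hx
    have h1 : (B ∪ D) ∩ A = B := by
      rw [Finset.union_inter_distrib_right, Finset.disjoint_iff_inter_eq_empty.1 hdisj,
        Finset.union_empty, Finset.inter_eq_left.2 hB]
    have h2 : (B ∪ D) \ A = D := by
      rw [Finset.union_sdiff_distrib, Finset.sdiff_eq_empty_iff_subset.2 hB,
        Finset.empty_union, Finset.sdiff_eq_self_of_disjoint hdisj]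
    exact Prod.ext h1 h2

/-- Both sides count pairs of a `k`-set and a `t`-set with intersection of size `y`. -/
theorem choose_mul_choose_mul_choose_comm {n k t y : ℕ} (hk : k ≤ n) (ht : t ≤ n) (hyk : y ≤ k)
    (hyt : y ≤ t) :
    n.choose k * (k.choose y * (n - k).choose (t - y)) =
      n.choose t * (t.choose y * (n - t).choose (k - y)) := by
  -- If the union of the two sets would have more than `n` elements, both sides vanish.
  rcases lt_or_ge (n + y) (k + t) with h | h
  · rw [Nat.choose_eq_zero_of_lt (show n - k < t - y by omega),
      Nat.choose_eq_zero_of_lt (show n - t < k - y by omega)]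
    simp
  -- In terms of the four regions of sizes `y, a, b, d`, both sides equal `n! / (y! a! b! d!)`.
  · obtain ⟨a, rfl⟩ := Nat.exists_eq_add_of_le hyk
    obtain ⟨b, rfl⟩ := Nat.exists_eq_add_of_le hyt
    obtain ⟨d, rfl⟩ := Nat.exists_eq_add_of_le (show y + a + b ≤ n by omega)
    have e1 : y + a + b + d - (y + a) = b + d := by omega
    have e2 : y + a + b + d - (y + b) = a + d := by omega
    rw [e1, e2, Nat.add_sub_cancel_left, Nat.add_sub_cancel_left]
    have F : ∀ i j : ℕ, (i + j).choose i * i.factorial * j.factorial = (i + j).factorial := by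
      intro i j
      rw [Nat.choose_symm_add, Nat.add_choose_mul_factorial_mul_factorial]
    have f1 := F (y + a) (b + d)
    have g1 := F (y + b) (a + d)
    rw [show y + a + (b + d) = y + a + b + d by omega] at f1
    rw [show y + b + (a + d) = y + a + b + d by omega] at g1
    have hpos : 0 < y.factorial * a.factorial * b.factorial * d.factorial := by positivity
    refine Nat.eq_of_mul_eq_mul_right hpos ?_
    calc _ = (y + a + b + d).choose (y + a) * ((y + a).choose y * y.factorial * a.factorial) *
          ((b + d).choose b * b.factorial * d.factorial) := by ring
      _ = (y + a + b + d).choose (y + b) * ((y + b).choose y * y.factorial * b.factorial) *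
          ((a + d).choose a * a.factorial * d.factorial) := by rw [F, F, F, F, f1, g1]
      _ = _ := by ring

/-- Double counting exchanges the roles of the two sets: the probability that a random `t`-set hits
a fixed `k`-set is the fraction of `k`-sets hit by a fixed `t`-set. In this form `hyper` measures
how many hidden sets a given `X` can find. -/
theorem hyper_mul_choose {n k : ℕ} (hk : k ≤ n) (X : Finset (Fin n)) (r : ℝ) :
    hyper n k X.card r * (n.choose k : ℝ) =
      (((Finset.powersetCard k (Finset.univ : Finset (Fin n))).filter
        fun T => r ≤ ((T ∩ X).card : ℝ)).card : ℝ) := by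
  have ht : X.card ≤ n := by simpa using X.card_le_univ
  have hmaps : ∀ T ∈ (Finset.powersetCard k (Finset.univ : Finset (Fin n))).filter
      (fun T => r ≤ ((T ∩ X).card : ℝ)), (T ∩ X).card ∈
      (Finset.range (min X.card k + 1)).filter (fun y : ℕ => r ≤ (y : ℝ)) := by
    intro T hT
    simp only [Finset.mem_filter, Finset.mem_powersetCard] at hT
    have h1 := Finset.card_le_card (Finset.inter_subset_left (s₁ := T) (s₂ := X))
    have h2 := Finset.card_le_card (Finset.inter_subset_right (s₁ := T) (s₂ := X))
    simp only [Finset.mem_filter, Finset.mem_range]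
    exact ⟨by omega, hT.2⟩
  rw [Finset.card_eq_sum_card_fiberwise hmaps, hyper, Finset.sum_mul, Nat.cast_sum]
  refine Finset.sum_congr rfl fun y hy => ?_
  simp only [Finset.mem_filter, Finset.mem_range] at hy
  have hyt : y ≤ X.card := by omega
  have hyk : y ≤ k := by omega
  have hfil : ((Finset.powersetCard k (Finset.univ : Finset (Fin n))).filter
        fun T => r ≤ ((T ∩ X).card : ℝ)).filter (fun T => (T ∩ X).card = y) =
      (Finset.powersetCard k (Finset.univ : Finset (Fin n))).filter
        fun T => (T ∩ X).card = y := by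
    ext T
    simp only [Finset.mem_filter]
    constructor
    · rintro ⟨⟨h1, -⟩, h2⟩; exact ⟨h1, h2⟩
    · rintro ⟨h1, h2⟩; exact ⟨⟨h1, by rw [h2]; exact hy.2⟩, h2⟩
  rw [hfil, card_filter_inter_eq X hyk]
  have hpos : (n.choose X.card : ℝ) ≠ 0 := by
    have := Nat.choose_pos ht
    positivity
  have := choose_mul_choose_mul_choose_comm hk ht hyk hyt
  rw [div_mul_eq_mul_div, div_eq_iff hpos]
  have h2 : (n.choose k : ℝ) * ((k.choose y : ℝ) * ((n - k).choose (X.card - y) : ℝ)) =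
      (n.choose X.card : ℝ) * ((X.card.choose y : ℝ) * ((n - X.card).choose (k - y) : ℝ)) := by
    exact_mod_cast this
  push_cast
  linarith

theorem exists_card_eq {n t : ℕ} (ht : t ≤ n) : ∃ X : Finset (Fin n), X.card = t := by
  obtain ⟨X, -, hX⟩ := Finset.exists_subset_card_eq
    (s := (Finset.univ : Finset (Fin n))) (n := t) (by simpa using ht)
  exact ⟨X, hX⟩

theorem hyper_nonneg (n k t : ℕ) (x : ℝ) : 0 ≤ hyper n k t x :=
  Finset.sum_nonneg fun _ _ => by positivity

theorem hyper_anti (n k t : ℕ) {x x' : ℝ} (h : x ≤ x') : hyper n k t x' ≤ hyper n k t x := by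
  refine Finset.sum_le_sum_of_subset_of_nonneg ?_ fun _ _ _ => by positivity
  intro y hy
  simp only [Finset.mem_filter] at hy ⊢
  exact ⟨hy.1, h.trans hy.2⟩

theorem hyper_le_succ {n k t : ℕ} (hk : k ≤ n) (ht : t + 1 ≤ n) (r : ℝ) :
    hyper n k t r ≤ hyper n k (t + 1) r := by
  obtain ⟨X', hX'⟩ := exists_card_eq ht
  obtain ⟨X, hXX', hX⟩ := Finset.exists_subset_card_eq (s := X') (n := t) (by omega)
  have hc : (0 : ℝ) < n.choose k := by exact_mod_cast Nat.choose_pos hk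
  refine le_of_mul_le_mul_right ?_ hc
  rw [← hX, hyper_mul_choose hk, hX, ← hX', hyper_mul_choose hk]
  norm_cast
  refine Finset.card_le_card fun T hT => ?_
  simp only [Finset.mem_filter] at hT ⊢
  refine ⟨hT.1, hT.2.trans ?_⟩
  exact_mod_cast Finset.card_le_card (Finset.inter_subset_inter_left hXX')

/-- If `X` meets `T` in at least `r < k` elements, some single element added to `X` raises this to
`r + 1`. The factor `n` is a union bound over that element. -/
theorem hyper_le_mul_succ_succ {n k t r : ℕ} (hk : k ≤ n) (ht : t + 1 ≤ n) (hr : r + 1 ≤ k) :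
    hyper n k t (r : ℕ) ≤ n * hyper n k (t + 1) ((r + 1 : ℕ) : ℝ) := by
  obtain ⟨X, hX⟩ := exists_card_eq (show t ≤ n by omega)
  have hc : (0 : ℝ) < n.choose k := by exact_mod_cast Nat.choose_pos hk
  refine le_of_mul_le_mul_right ?_ hc
  rw [mul_assoc, ← hX, hyper_mul_choose hk]
  set N : ℝ := hyper n k (X.card + 1) ((r + 1 : ℕ) : ℝ) * (n.choose k : ℝ) with hN
  have hN' : ∀ e ∉ X, N = (((Finset.powersetCard k (Finset.univ : Finset (Fin n))).filter
        fun T => ((r + 1 : ℕ) : ℝ) ≤ ((T ∩ insert e X).card : ℝ)).card : ℝ) := by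
    intro e he
    rw [hN, ← Finset.card_insert_of_notMem he, hyper_mul_choose hk]
  have hsub : (Finset.powersetCard k (Finset.univ : Finset (Fin n))).filter
        (fun T => (r : ℝ) ≤ ((T ∩ X).card : ℝ)) ⊆
      Xᶜ.biUnion fun e => (Finset.powersetCard k (Finset.univ : Finset (Fin n))).filter
        fun T => ((r + 1 : ℕ) : ℝ) ≤ ((T ∩ insert e X).card : ℝ) := by
    intro T hT
    simp only [Finset.mem_filter, Finset.mem_powersetCard, Finset.subset_univ, true_and,
      Nat.cast_le] at hT
    simp only [Finset.mem_biUnion, Finset.mem_filter, Finset.mem_powersetCard,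
      Finset.subset_univ, true_and, Nat.cast_le, Finset.mem_compl]
    rcases lt_or_ge r (T ∩ X).card with h | h
    · have : Xᶜ.Nonempty := by
        rw [← Finset.card_pos, Finset.card_compl, Fintype.card_fin]; omega
      obtain ⟨e, he⟩ := this
      refine ⟨e, by simpa using he, hT.1, ?_⟩
      exact (Nat.succ_le_of_lt h).trans (Finset.card_le_card
        (Finset.inter_subset_inter_left (Finset.subset_insert e X)))
    · have h1 := Finset.card_sdiff_add_card_inter T X
      have : (T \ X).Nonempty := by rw [← Finset.card_pos]; omega
      obtain ⟨e, he⟩ := this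
      rw [Finset.mem_sdiff] at he
      refine ⟨e, he.2, hT.1, ?_⟩
      rw [Finset.inter_insert_of_mem he.1, Finset.card_insert_of_notMem (by simp [he.2])]
      omega
  calc _ ≤ (((Xᶜ.biUnion fun e => (Finset.powersetCard k (Finset.univ : Finset (Fin n))).filter
        fun T => ((r + 1 : ℕ) : ℝ) ≤ ((T ∩ insert e X).card : ℝ)).card : ℕ) : ℝ) := by
        exact_mod_cast Finset.card_le_card hsub
    _ ≤ ((∑ e ∈ Xᶜ, ((Finset.powersetCard k (Finset.univ : Finset (Fin n))).filter
        fun T => ((r + 1 : ℕ) : ℝ) ≤ ((T ∩ insert e X).card : ℝ)).card : ℕ) : ℝ) := by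
        exact_mod_cast Finset.card_biUnion_le
    _ = ∑ e ∈ Xᶜ, N := by
        rw [Nat.cast_sum]
        refine Finset.sum_congr rfl fun e he => ?_
        rw [hN' e (by simpa using he)]
    _ = (Xᶜ.card : ℝ) * N := by rw [Finset.sum_const, nsmul_eq_mul]
    _ ≤ n * N := by
        have hN0 : 0 ≤ N := mul_nonneg (hyper_nonneg _ _ _ _) hc.le
        refine mul_le_mul_of_nonneg_right ?_ hN0
        have := Xᶜ.card_le_univ
        rw [Fintype.card_fin] at this
        exact_mod_cast this

theorem hyper_le_of_le {n k t t' : ℕ} (hk : k ≤ n) (htt' : t ≤ t') (ht : t' ≤ n) (r : ℝ) :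
    hyper n k t r ≤ hyper n k t' r := by
  induction t', htt' using Nat.le_induction with
  | base => exact le_rfl
  | succ m hm ih => exact (ih (by omega)).trans (hyper_le_succ hk ht r)

theorem hyper_le_pow_mul {n k t r : ℕ} (b : ℕ) (hk : k ≤ n) (ht : t + b ≤ n) (hr : r + b ≤ k) :
    hyper n k t (r : ℝ) ≤ (n : ℝ) ^ b * hyper n k (t + b) ((r + b : ℕ) : ℝ) := by
  induction b with
  | zero => simp
  | succ b ih =>
    refine (ih (by omega) (by omega)).trans ?_
    rw [pow_succ, mul_assoc]
    exact mul_le_mul_of_nonneg_left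
      (hyper_le_mul_succ_succ (t := t + b) (r := r + b) hk (by omega) (by omega)) (by positivity)

/-! ### Admissible parameters -/

/-- The subtracted term is the real-valued extension size left to the oracle; this is the form in
which the threshold is used. -/
theorem threshold_eq {α : ℝ} (hα : 1 ≤ α) (β : ℝ) (k t : ℕ) :
    threshold α β k t = k - (β * k - t) / α := by
  have : α ≠ 0 := by positivity
  rw [threshold]; field_simp; ring

theorem threshold_le_left {α β : ℝ} (hα : 1 ≤ α) {k t : ℕ} (h : Admissible α β k t) :
    threshold α β k t ≤ k := by
  rw [threshold_eq hα]
  have := h.2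
  have : 0 ≤ (β * k - t) / α := div_nonneg (by linarith) (by linarith)
  linarith

/-- The claim is equivalent to `(α - β) k ≤ (α - 1) t`, and `Mstar` is exactly the bound on `t / k`
which ensures this. -/
theorem threshold_le_right {α β : ℝ} (hα : 1 ≤ α) (hβ : 1 ≤ β) {k t : ℕ}
    (h : Admissible α β k t) : threshold α β k t ≤ t := by
  have hα0 : 0 < α := by linarith
  have hkey : (α - β) * k ≤ (α - 1) * t := by
    have h1 := h.1
    rw [Mstar] at h1
    split_ifs at h1 with hαβ
    · have : (α - β) * k ≤ 0 := mul_nonpos_of_nonpos_of_nonneg (by linarith) (by positivity)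
      have : 0 ≤ (α - 1) * t := mul_nonneg (by linarith) (by positivity)
      linarith
    · have h2 : 0 < α - 1 := by linarith
      rw [div_mul_eq_mul_div, div_le_iff₀ h2] at h1
      linarith
  have : threshold α β k t * α = (α - β) * k + t := by
    rw [threshold]; field_simp
  nlinarith

theorem threshold_le_min {α β : ℝ} (hα : 1 ≤ α) (hβ : 1 ≤ β) {k t : ℕ}
    (h : Admissible α β k t) : threshold α β k t ≤ (min t k : ℕ) := by
  rw [Nat.cast_min]
  exact le_min (threshold_le_right hα hβ h) (threshold_le_left hα h)

/-- Since `α ≥ 1`, the threshold is at least `k - (β k - t) ≥ k + t - n`. This keeps the second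
binomial coefficient in `kappa` nonzero. -/
theorem add_le_add_of_threshold_le {α β : ℝ} (hα : 1 ≤ α) {n k t y : ℕ}
    (h : Admissible α β k t) (hn : β * k ≤ n) (hy : threshold α β k t ≤ y) : k + t ≤ n + y := by
  rw [threshold_eq hα] at hy
  have h1 : (β * k - t) / α ≤ β * k - t := div_le_self (by linarith [h.2]) hα
  have : (k : ℝ) + t ≤ n + y := by linarith
  exact_mod_cast this

theorem Admissible.le_card {α β : ℝ} {n k t : ℕ} (h : Admissible α β k t) (hn : β * k ≤ n) :
    t ≤ n := by
  have : (t : ℝ) ≤ n := h.2.trans hn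
  exact_mod_cast this

theorem le_of_mul_le {β : ℝ} (hβ : 1 ≤ β) {n k : ℕ} (hn : β * k ≤ n) : k ≤ n := by
  have : (k : ℝ) ≤ n := by nlinarith [(Nat.cast_nonneg k : (0 : ℝ) ≤ k)]
  exact_mod_cast this

theorem kappa_pos {n k t y : ℕ} (ht : t ≤ n) (hy : y ≤ min t k) (h : k + t ≤ n + y)
    (hk : k ≤ n) : 0 < kappa n k t y := by
  have h1 := Nat.choose_pos ht
  have h2 := Nat.choose_pos (show y ≤ k by omega)
  have h3 := Nat.choose_pos (show t - y ≤ n - k by omega)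
  rw [kappa]; positivity

theorem hyper_pos {n k t : ℕ} {x : ℝ} (hk : k ≤ n) (ht : t ≤ n) (hx : x ≤ (min t k : ℕ)) :
    0 < hyper n k t x := by
  refine Finset.sum_pos' (fun _ _ => by positivity) ⟨min t k, ?_, ?_⟩
  · simpa using hx
  · have h1 := Nat.choose_pos ht
    have h2 := Nat.choose_pos (show min t k ≤ k by omega)
    have h3 := Nat.choose_pos (show t - min t k ≤ n - k by omega)
    positivity

theorem hyper_pos_of_admissible {α β : ℝ} (hα : 1 ≤ α) (hβ : 1 ≤ β) {n k t : ℕ}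
    (h : Admissible α β k t) (hn : β * k ≤ n) : 0 < hyper n k t (threshold α β k t) :=
  hyper_pos (le_of_mul_le hβ hn) (h.le_card hn) (threshold_le_min hα hβ h)

/-- The sum consists of at most `n + 1` terms `1 / κ(z)`, none of them larger than `1 / κ(y)`.
Replacing the probability by its largest term is therefore harmless. -/
theorem kappa_mul_hyper_le {α β : ℝ} (hα : 1 ≤ α) (hβ : 1 ≤ β) {n k t y : ℕ}
    (h : Admissible α β k t) (hn : β * k ≤ n)
    (hy : IsBestIntersection n k t (threshold α β k t) y) :
    kappa n k t y * hyper n k t (threshold α β k t) ≤ n + 1 := by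
  have hk := le_of_mul_le hβ hn
  have ht := h.le_card hn
  rw [hyper, Finset.mul_sum]
  calc _ ≤ ∑ z ∈ (Finset.range (min t k + 1)).filter
        (fun z : ℕ => threshold α β k t ≤ (z : ℝ)), (1 : ℝ) := by
        refine Finset.sum_le_sum fun z hz => ?_
        simp only [Finset.mem_filter, Finset.mem_range] at hz
        have hz1 : z ≤ min t k := by omega
        have hpos := kappa_pos ht hz1 (add_le_add_of_threshold_le hα h hn hz.2) hk
        have h1 := hy.2 z hz.2 hz1
        rw [show ((k.choose z : ℝ) * ((n - k).choose (t - z) : ℝ)) / (n.choose t : ℝ) =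
          (kappa n k t z)⁻¹ by rw [kappa, inv_div]]
        rw [← div_eq_mul_inv, div_le_one hpos]
        exact h1
    _ ≤ n + 1 := by
        rw [Finset.sum_const, nsmul_eq_mul, mul_one]
        have := Finset.card_filter_le (Finset.range (min t k + 1))
          (fun z : ℕ => threshold α β k t ≤ (z : ℝ))
        rw [Finset.card_range] at this
        have h2 : min t k + 1 ≤ n + 1 := by omega
        exact_mod_cast this.trans h2

theorem toNat_sub_ceil {α β : ℝ} (hα : 1 ≤ α) (k t : ℕ) :
    ((k : ℤ) - ⌈threshold α β k t⌉).toNat = ⌊(β * k - t) / α⌋₊ := by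
  rw [threshold_eq hα]
  have : (k : ℤ) - ⌈(k : ℝ) - (β * k - t) / α⌉ = ⌊(β * k - t) / α⌋ := by
    rw [show (k : ℝ) - (β * k - t) / α = -((β * k - t) / α) + (k : ℕ) by ring,
      Int.ceil_add_natCast, Int.ceil_neg]
    ring
  rw [this, Int.floor_toNat]

theorem samplingCost_pos {p : ℝ × ℝ} {β : ℝ} (hα : 1 ≤ p.1) (hc : 1 ≤ p.2) (hβ : 1 ≤ β)
    {n k t : ℕ} (h : Admissible p.1 β k t) (hn : β * k ≤ n) : 0 < samplingCost n β k p t := by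
  have := hyper_pos_of_admissible hα hβ h hn
  have h2 : 0 < p.2 := by linarith
  rw [samplingCost]; positivity

/-- Because `Mstar ≤ 1` and `β ≥ 1`, the upper end of the interval always contains an admissible
natural number, so the minimization is never over an empty set. -/
theorem admissible_floor {α β : ℝ} (hβ : 1 ≤ β) (k : ℕ) :
    Admissible α β k ⌊β * k⌋₊ := by
  have h0 : 0 ≤ β * k := by positivity
  refine ⟨?_, Nat.floor_le h0⟩
  have hk : (k : ℝ) ≤ ⌊β * k⌋₊ := by
    have : k ≤ ⌊β * k⌋₊ := Nat.le_floor (by nlinarith [(Nat.cast_nonneg k : (0 : ℝ) ≤ k)])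
    exact_mod_cast this
  refine le_trans ?_ hk
  have : Mstar α β ≤ 1 := by
    rw [Mstar]
    split_ifs with h
    · norm_num
    · rw [div_le_one (by linarith)]; linarith
  nlinarith [(Nat.cast_nonneg k : (0 : ℝ) ≤ k)]

/-! ### Executions -/

/-- Cost bounds and approximation guarantees each assert the existence of some run; determinism
identifies these runs. -/
theorem Exec.unique {L : Finset (ℝ × ℝ)} {n : ℕ} {β : ℝ} {O : L → Oracle n} {ω : ℕ → Bool}
    {P : Prog L} {σ σ₁ σ₂ : State} {p₁ p₂ : ℕ} {tr₁ tr₂ : List (Query L n)}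
    (h₁ : Exec β O ω P σ σ₁ p₁ tr₁) (h₂ : Exec β O ω P σ σ₂ p₂ tr₂) :
    σ₁ = σ₂ ∧ p₁ = p₂ ∧ tr₁ = tr₂ := by
  induction h₁ generalizing σ₂ p₂ tr₂ with
  | skip => cases h₂; exact ⟨rfl, rfl, rfl⟩
  | setNat => cases h₂; exact ⟨rfl, rfl, rfl⟩
  | setReal => cases h₂; exact ⟨rfl, rfl, rfl⟩
  | flip => cases h₂; exact ⟨rfl, rfl, rfl⟩
  | query j X ℓ a σ Y hY =>
    cases h₂ with
    | query _ _ _ _ _ Y' hY' => rw [hY, hY']; exact ⟨rfl, rfl, rfl⟩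
  | seq _ _ ih₁ ih₂ =>
    cases h₂ with
    | seq g₁ g₂ =>
      obtain ⟨rfl, rfl, rfl⟩ := ih₁ g₁
      obtain ⟨rfl, rfl, rfl⟩ := ih₂ g₂
      exact ⟨rfl, rfl, rfl⟩
  | iteTrue hb _ ih =>
    cases h₂ with
    | iteTrue _ g => obtain ⟨rfl, rfl, rfl⟩ := ih g; exact ⟨rfl, rfl, rfl⟩
    | iteFalse hb' _ => exact absurd hb hb'
  | iteFalse hb _ ih =>
    cases h₂ with
    | iteFalse _ g => obtain ⟨rfl, rfl, rfl⟩ := ih g; exact ⟨rfl, rfl, rfl⟩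
    | iteTrue hb' _ => exact absurd hb' hb
  | loopDone hb =>
    cases h₂ with
    | loopDone _ => exact ⟨rfl, rfl, rfl⟩
    | loopStep hb' _ _ => exact absurd hb' hb
  | loopStep hb _ _ ih₁ ih₂ =>
    cases h₂ with
    | loopDone hb' => exact absurd hb hb'
    | loopStep _ g₁ g₂ =>
      obtain ⟨rfl, rfl, rfl⟩ := ih₁ g₁
      obtain ⟨rfl, rfl, rfl⟩ := ih₂ g₂
      exact ⟨rfl, rfl, rfl⟩

theorem Run.unique {L : Finset (ℝ × ℝ)} {n : ℕ} {β : ℝ} {O : L → Oracle n} {ω : ℕ → Bool}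
    {P : Prog L} {S₁ S₂ : Finset (Fin n)} {p₁ p₂ : ℕ} {tr₁ tr₂ : List (Query L n)}
    (h₁ : Run β O ω P S₁ p₁ tr₁) (h₂ : Run β O ω P S₂ p₂ tr₂) :
    S₁ = S₂ ∧ p₁ = p₂ ∧ tr₁ = tr₂ := by
  obtain ⟨σ₁, e₁, rfl⟩ := h₁
  obtain ⟨σ₂, e₂, rfl⟩ := h₂
  obtain ⟨rfl, rfl, rfl⟩ := e₁.unique e₂
  exact ⟨rfl, rfl, rfl⟩

/-- The answers in the list of queries are those of the oracles, where the random bits are those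
of `ω` from position `pos` on. -/
def Answered {L : Finset (ℝ × ℝ)} {n : ℕ} (O : L → Oracle n) (ω : ℕ → Bool) :
    ℕ → List (Query L n) → Prop
  | _, [] => True
  | pos, q :: tr => q.Y = (O q.j).answer q.X q.ℓ (fun i => ω (pos + (i : ℕ))) ∧
      Answered O ω (pos + (O q.j).bits) tr

theorem Answered.append {L : Finset (ℝ × ℝ)} {n : ℕ} {O : L → Oracle n} {ω : ℕ → Bool} {pos : ℕ}
    {tr us : List (Query L n)} (h₁ : Answered O ω pos tr)
    (h₂ : Answered O ω (pos + (tr.map fun q => (O q.j).bits).sum) us) :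
    Answered O ω pos (tr ++ us) := by
  induction tr generalizing pos with
  | nil => simpa using h₂
  | cons q tr ih =>
    refine ⟨h₁.1, ih h₁.2 ?_⟩
    rwa [List.map_cons, List.sum_cons, ← add_assoc] at h₂

theorem Answered.of_append {L : Finset (ℝ × ℝ)} {n : ℕ} {O : L → Oracle n} {ω : ℕ → Bool}
    {pos : ℕ} {tr us : List (Query L n)} (h : Answered O ω pos (tr ++ us)) :
    Answered O ω (pos + (tr.map fun q => (O q.j).bits).sum) us := by
  induction tr generalizing pos with
  | nil => simpa using h
  | cons q tr ih =>
    rw [List.map_cons, List.sum_cons, ← add_assoc]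
    exact ih h.2

theorem Answered.exists_answer {L : Finset (ℝ × ℝ)} {n : ℕ} {O : L → Oracle n} {ω : ℕ → Bool}
    {pos : ℕ} {tr : List (Query L n)} (h : Answered O ω pos tr) {q : Query L n} (hq : q ∈ tr) :
    ∃ r, q.Y = (O q.j).answer q.X q.ℓ r := by
  induction tr generalizing pos with
  | nil => simp at hq
  | cons a tr ih =>
    rcases List.mem_cons.1 hq with rfl | hq
    · exact ⟨_, h.1⟩
    · exact ih h.2 hq

/-- Without coin flips only the queries consume random bits, so the position of the bits of a query
is determined by the oracles asked before it. -/
theorem Exec.answered {L : Finset (ℝ × ℝ)} {n : ℕ} {β : ℝ} {O : L → Oracle n} {ω : ℕ → Bool}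
    {P : Prog L} {σ σ' : State} {p : ℕ} {tr : List (Query L n)} (hP : P.Coinless)
    (h : Exec β O ω P σ σ' p tr) :
    σ'.pos = σ.pos + (tr.map fun q => (O q.j).bits).sum ∧ Answered O ω σ.pos tr := by
  induction h with
  | skip => exact ⟨rfl, trivial⟩
  | setNat => exact ⟨rfl, trivial⟩
  | setReal => exact ⟨rfl, trivial⟩
  | flip => exact hP.elim
  | query j X ℓ a σ Y hY => exact ⟨by simp, hY, trivial⟩
  | seq _ _ ih₁ ih₂ =>
    obtain ⟨h1, h2⟩ := ih₁ hP.1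
    obtain ⟨h3, h4⟩ := ih₂ hP.2
    rw [h1] at h3 h4
    exact ⟨by rw [h3, List.map_append, List.sum_append, add_assoc], h2.append h4⟩
  | iteTrue _ _ ih => exact ih hP.1
  | iteFalse _ _ ih => exact ih hP.2
  | loopDone => exact ⟨rfl, trivial⟩
  | loopStep _ _ _ ih₁ ih₂ =>
    obtain ⟨h1, h2⟩ := ih₁ hP
    obtain ⟨h3, h4⟩ := ih₂ hP
    rw [h1] at h3 h4
    exact ⟨by rw [h3, List.map_append, List.sum_append, add_assoc], h2.append h4⟩

/-- The deterministic oracle with given answers. -/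
def detOracle {n : ℕ} (f : Finset (Fin n) → ℕ → Finset (Fin n)) : Oracle n :=
  ⟨0, fun X ℓ _ => f X ℓ⟩

theorem Exec.pos_le {L : Finset (ℝ × ℝ)} {n : ℕ} {β : ℝ} {O : L → Oracle n} {ω : ℕ → Bool}
    {P : Prog L} {σ σ' : State} {p : ℕ} {tr : List (Query L n)}
    (h : Exec β O ω P σ σ' p tr) : σ.pos ≤ σ'.pos := by
  induction h with
  | seq _ _ ih₁ ih₂ => exact ih₁.trans ih₂
  | loopStep _ _ _ ih₁ ih₂ => exact ih₁.trans ih₂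
  | iteTrue _ _ ih => exact ih
  | iteFalse _ _ ih => exact ih
  | _ => simp

/-- With deterministic oracles each consumed bit is a coin flip, hence an operation. A bound on the
cost thus bounds the number of bits on which a run depends. -/
theorem Exec.pos_le_add {L : Finset (ℝ × ℝ)} {n : ℕ} {β : ℝ}
    {f : L → Finset (Fin n) → ℕ → Finset (Fin n)} {ω : ℕ → Bool}
    {P : Prog L} {σ σ' : State} {p : ℕ} {tr : List (Query L n)}
    (h : Exec β (fun j => detOracle (f j)) ω P σ σ' p tr) : σ'.pos ≤ σ.pos + p := by
  induction h with
  | seq _ _ ih₁ ih₂ => omega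
  | loopStep _ _ _ ih₁ ih₂ => omega
  | iteTrue _ _ ih => omega
  | iteFalse _ _ ih => omega
  | flip => simp
  | query => simp [detOracle]
  | _ => simp

/-- An execution with deterministic oracles does not depend on random bits that it does not use. -/
theorem Exec.congr_bits {L : Finset (ℝ × ℝ)} {n : ℕ} {β : ℝ}
    {f : L → Finset (Fin n) → ℕ → Finset (Fin n)} {ω ω' : ℕ → Bool}
    {P : Prog L} {σ σ' : State} {p : ℕ} {tr : List (Query L n)}
    (h : Exec β (fun j => detOracle (f j)) ω P σ σ' p tr) (hω : ∀ i < σ'.pos, ω i = ω' i) :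
    Exec β (fun j => detOracle (f j)) ω' P σ σ' p tr := by
  induction h with
  | skip => exact .skip _
  | setNat => exact .setNat _ _ _
  | setReal => exact .setReal _ _ _
  | flip a σ =>
    rw [hω σ.pos (by simp)]
    exact .flip _ _
  | query j X ℓ a σ Y hY => exact .query _ _ _ _ _ _ hY
  | seq _ h2 ih₁ ih₂ =>
    exact .seq (ih₁ fun i hi => hω i (hi.trans_le h2.pos_le)) (ih₂ hω)
  | iteTrue hb _ ih => exact .iteTrue hb (ih hω)
  | iteFalse hb _ ih => exact .iteFalse hb (ih hω)
  | loopDone hb => exact .loopDone hb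
  | loopStep hb _ h2 ih₁ ih₂ =>
    exact .loopStep hb (ih₁ fun i hi => hω i (hi.trans_le h2.pos_le)) (ih₂ hω)

/-- An execution does not depend on the answers to queries that are not asked. -/
theorem Exec.congr_answers {L : Finset (ℝ × ℝ)} {n : ℕ} {β : ℝ}
    {f f' : L → Finset (Fin n) → ℕ → Finset (Fin n)} {ω : ℕ → Bool}
    {P : Prog L} {σ σ' : State} {p : ℕ} {tr : List (Query L n)}
    (h : Exec β (fun j => detOracle (f j)) ω P σ σ' p tr)
    (hf : ∀ q ∈ tr, f q.j q.X q.ℓ = f' q.j q.X q.ℓ) :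
    Exec β (fun j => detOracle (f' j)) ω P σ σ' p tr := by
  induction h with
  | skip => exact .skip _
  | setNat => exact .setNat _ _ _
  | setReal => exact .setReal _ _ _
  | flip => exact .flip _ _
  | query j X ℓ a σ Y hY =>
    refine Exec.query (O := fun j => detOracle (f' j)) j X ℓ a σ Y ?_
    rw [hY]
    exact hf _ (List.mem_singleton.2 rfl)
  | seq _ _ ih₁ ih₂ =>
    exact .seq (ih₁ fun q hq => hf q (List.mem_append_left _ hq))
      (ih₂ fun q hq => hf q (List.mem_append_right _ hq))
  | iteTrue hb _ ih => exact .iteTrue hb (ih hf)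
  | iteFalse hb _ ih => exact .iteFalse hb (ih hf)
  | loopDone hb => exact .loopDone hb
  | loopStep hb _ _ ih₁ ih₂ =>
    exact .loopStep hb (ih₁ fun q hq => hf q (List.mem_append_left _ hq))
      (ih₂ fun q hq => hf q (List.mem_append_right _ hq))

/-! ### Correctness of derandomized approximate monotone local search -/

/-- If `X` meets the solution `T` in at least `x_α(k, t)` elements, then every `α ℓ`-extension of
`X` with `ℓ = k - ⌈x_α(k, t)⌉` gives a solution with at most `β k` elements. -/
theorem isExtension_sdiff {α β : ℝ} {n k t y : ℕ}
    {F : Set (Finset (Fin n))} (hF : IsMonotone F) {X T : Finset (Fin n)} (hT : T ∈ F)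
    (hTk : T.card = k) (hy : threshold α β k t ≤ y) (hTX : y ≤ (T ∩ X).card) :
    IsExtension F X (((k : ℤ) - ⌈threshold α β k t⌉).toNat : ℕ) (T \ X) := by
  refine ⟨hF.2 T _ (fun x hx => by by_cases h : x ∈ X <;> simp [h, hx]) hT, ?_⟩
  have h1 := Finset.card_sdiff_add_card_inter T X
  have h2 : ⌈threshold α β k t⌉ ≤ (y : ℤ) := Int.ceil_le.2 (by exact_mod_cast hy)
  norm_cast
  omega

/-- The extension has at most `α ⌊(β k - t) / α⌋ ≤ β k - t` elements, and `X` contributes the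
remaining `t`. -/
theorem card_union_le_of_isExtension {α β : ℝ} (hα : 1 ≤ α) {n k t : ℕ}
    {F : Set (Finset (Fin n))} {X Y : Finset (Fin n)} (ht : Admissible α β k t)
    (hX : X.card = t)
    (hY : IsExtension F X (α * (((k : ℤ) - ⌈threshold α β k t⌉).toNat : ℕ)) Y) :
    ((X ∪ Y).card : ℝ) ≤ β * k := by
  have h1 := hY.2
  rw [toNat_sub_ceil hα] at h1
  have h0 : 0 ≤ (β * k - t) / α := div_nonneg (by linarith [ht.2]) (by linarith)
  have h2 : α * (⌊(β * k - t) / α⌋₊ : ℝ) ≤ β * k - t := by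
    have := Nat.floor_le h0
    rw [le_div_iff₀ (by linarith)] at this
    linarith
  have h3 : ((X ∪ Y).card : ℝ) ≤ X.card + Y.card := by exact_mod_cast Finset.card_union_le X Y
  rw [hX] at h3
  linarith

theorem Oracle.IsExtensionOracle.of_isDeterministic {n : ℕ} {O : Oracle n} {α : ℝ}
    {F : Set (Finset (Fin n))} (h : O.IsExtensionOracle α F) (hO : O.IsDeterministic)
    {X : Finset (Fin n)} {ℓ : ℕ} (hX : ∃ S, IsExtension F X ℓ S) (r : Fin O.bits → Bool) :
    IsExtension F X (α * ℓ) (O.answer X ℓ r) := by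
  have h1 := h.2 X ℓ hX
  have h2 : (0 : ℝ) < (({r | IsExtension F X (α * ℓ) (O.answer X ℓ r)} :
      Set (Fin O.bits → Bool)).ncard : ℝ) := lt_of_lt_of_le (by positivity) h1
  have h3 : 0 < ({r | IsExtension F X (α * ℓ) (O.answer X ℓ r)} :
      Set (Fin O.bits → Bool)).ncard := by exact_mod_cast h2
  obtain ⟨r', hr'⟩ := Set.nonempty_of_ncard_ne_zero h3.ne'
  have : r = r' := by
    funext i
    have h4 : O.bits = 0 := hO
    exact absurd i.2 (by omega)
  rw [this]
  exact hr'

theorem IsDetAMLS.isDeterministicApprox {L : Finset (ℝ × ℝ)} (hL : IsSpecList L) {β : ℝ}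
    (hβ : 1 ≤ β) {P : Prog L} (hP : IsDetAMLS β P) : IsDeterministicApprox β P := by
  refine ⟨hP.1, fun n F hF O hO hdet ω => ?_⟩
  obtain ⟨S, p, round, hrun, hround, ⟨k₀, hk₀, q₀, hq₀, rfl⟩, hmin⟩ := hP.2 n F hF O hO hdet ω
  obtain ⟨σ, hexec, hσ⟩ := id hrun
  have hans := (hexec.answered hP.1).2
  have hmem : ∀ k ≤ ⌊(n : ℝ) / β⌋₊, ∀ q ∈ round k,
      q ∈ (List.range (⌊(n : ℝ) / β⌋₊ + 1)).flatMap round := fun k hk q hq =>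
    List.mem_flatMap.2 ⟨k, List.mem_range.2 (by omega), hq⟩
  refine ⟨_, p, _, hrun, ?_, fun T hT => ?_⟩
  · obtain ⟨r, hr⟩ := hans.exists_answer (hmem k₀ hk₀ q₀ hq₀)
    rw [hr, Finset.union_comm]
    exact (hO q₀.j).1 _ _ _
  · have hβ0 : 0 < β := by linarith
    -- Every solution `T` has its own round `k = |T|`, so no minimum solution has to be singled out.
    -- Without such a round, `β |T| > n` bounds every set.
    rcases le_or_gt T.card ⌊(n : ℝ) / β⌋₊ with hk | hk
    · obtain ⟨j, t, y, C, ⟨hadm, -⟩, ⟨⟨hxy, -⟩, -⟩, hC, htr⟩ := hround T.card hk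
      obtain ⟨X, hX, hTX⟩ := hC.2.2 T rfl
      have hXmem : (j, X, ((T.card : ℤ) - ⌈threshold j.1.1 β T.card t⌉).toNat) ∈
          (round T.card).map (fun q => (q.j, q.X, q.ℓ)) := by
        rw [htr]
        exact List.mem_map.2 ⟨X, hX, rfl⟩
      obtain ⟨q, hq, hqe⟩ := List.mem_map.1 hXmem
      simp only [Prod.mk.injEq] at hqe
      obtain ⟨hqj, hqX, hqℓ⟩ := hqe
      obtain ⟨r, hr⟩ := hans.exists_answer (hmem _ hk q hq)
      have hα := (hL.2 _ q.j.2).1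
      rw [← hqj] at hadm hxy hqℓ
      rw [← hqX] at hTX
      have hext : IsExtension F q.X (q.j.1.1 * q.ℓ) q.Y := by
        rw [hr]
        refine (hO q.j).of_isDeterministic (hdet _) ⟨T \ q.X, ?_⟩ r
        rw [hqℓ]
        exact isExtension_sdiff hF hT rfl hxy hTX
      rw [hqℓ] at hext
      have hcard := card_union_le_of_isExtension hα hadm (by rw [hqX]; exact hC.2.1 X hX) hext
      refine le_trans ?_ hcard
      exact_mod_cast hmin _ hk q hq
    · have h1 : (n : ℝ) < β * T.card := by
        have := Nat.lt_of_floor_lt hk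
        rw [div_lt_iff₀ hβ0] at this
        linarith
      have h2 : ((q₀.X ∪ q₀.Y).card : ℝ) ≤ n := by
        have := (q₀.X ∪ q₀.Y).card_le_univ
        rw [Fintype.card_fin] at this
        exact_mod_cast this
      linarith

/-! ### The lower bound for randomized approximation algorithms -/

theorem le_of_hyper_ne_zero {n k t r : ℕ} (h : hyper n k t (r : ℕ) ≠ 0) : r ≤ t := by
  by_contra hlt
  apply h
  rw [hyper, Finset.filter_false_of_mem, Finset.sum_empty]
  intro y hy
  rw [Finset.mem_range] at hy
  rw [Nat.cast_le]
  omega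

/-- A query is at most as efficient in finding a hidden set as sampling with the best
parameters, up to a polynomial factor. -/
theorem mul_hyper_le {p : ℝ × ℝ} {β V : ℝ} (hα : 1 ≤ p.1) (hc : 1 ≤ p.2) (hβ : 1 ≤ β)
    {n k t ℓ b : ℕ} (hn : β * k ≤ n) (hV : 0 ≤ V)
    (hmin : ∀ s : ℕ, Admissible p.1 β k s → V ≤ samplingCost n β k p s)
    (hb : p.1 = 1 ∨ 1 ≤ (p.1 - 1) * b) (hℓ : t + p.1 * ℓ < (⌊β * k⌋₊ + 1 : ℕ)) (hℓk : ℓ ≤ k) :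
    V * hyper n k t ((k - ℓ : ℕ) : ℝ) ≤ p.2 * (n + 1) ^ b * p.2 ^ ℓ := by
  obtain ⟨α, c⟩ := p
  simp only at *
  have hα0 : 0 < α := by linarith
  have hc0 : 0 < c := by linarith
  by_cases h0 : hyper n k t ((k - ℓ : ℕ) : ℝ) = 0
  · rw [h0, mul_zero]; positivity
  have hrt : k - ℓ ≤ t := le_of_hyper_ne_zero h0
  have hk := le_of_mul_le hβ hn
  have hβk : 0 ≤ β * k := by positivity
  have hfl := Nat.floor_le hβk
  have hint : t + ℓ ≤ ⌊β * k⌋₊ := by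
    have h1 : (t : ℝ) + ℓ ≤ t + α * ℓ := by nlinarith [(Nat.cast_nonneg ℓ : (0 : ℝ) ≤ ℓ)]
    have h2 : ((t + ℓ : ℕ) : ℝ) < ((⌊β * k⌋₊ + 1 : ℕ) : ℝ) := by
      push_cast at hℓ ⊢; linarith
    have h3 : t + ℓ < ⌊β * k⌋₊ + 1 := by exact_mod_cast h2
    omega
  have hint' : (t : ℝ) + ℓ ≤ β * k := by
    have : ((t + ℓ : ℕ) : ℝ) ≤ (⌊β * k⌋₊ : ℝ) := by exact_mod_cast hint
    push_cast at this; linarith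
  -- The query may exceed the budget `β k` by a fraction of `1`. Moving `b'` units from `ℓ` to `t`
  -- saves `(α - 1) b'`, and `b` units save at least `1`. If `α = 1` or `ℓ ≤ b`, integrality of `t +
  -- ℓ` suffices.
  obtain ⟨b', ℓ', hbℓ, hbb, hreal⟩ : ∃ b' ℓ' : ℕ, ℓ = ℓ' + b' ∧ b' ≤ b ∧
      ((t + b' : ℕ) : ℝ) ≤ β * k - α * ℓ' := by
    rcases le_total b ℓ with h | h
    · refine ⟨b, ℓ - b, by omega, le_rfl, ?_⟩
      rw [Nat.cast_sub h]
      push_cast at hℓ ⊢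
      rcases hb with rfl | hb
      · linarith
      · linarith
    · refine ⟨ℓ, 0, by omega, h, ?_⟩
      push_cast
      linarith
  -- The largest sample size that still leaves room for an extension of size `ℓ'`, so that the
  -- threshold of `t'` is at most `k - ℓ'`.
  set t' := ⌊β * k - α * ℓ'⌋₊ with ht'
  have htt' : t + b' ≤ t' := Nat.le_floor hreal
  have hX0 : 0 ≤ β * k - α * ℓ' := le_trans (by positivity) hreal
  have ht'1 : (t' : ℝ) ≤ β * k - α * ℓ' := Nat.floor_le hX0
  have ht'2 : β * k - α * ℓ' < t' + 1 := Nat.lt_floor_add_one _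
  have hℓ'0 : (0 : ℝ) ≤ α * ℓ' := by positivity
  have ht'n : t' ≤ n := by
    have : (t' : ℝ) ≤ n := by linarith
    exact_mod_cast this
  have hkt' : (k : ℝ) - ℓ' ≤ t' := by
    have : k ≤ t' + ℓ' := by omega
    have : (k : ℝ) ≤ t' + ℓ' := by exact_mod_cast this
    linarith
  -- If `α > β`, add `α (k - ℓ') ≤ α t'` and `t' ≤ β k - α ℓ'`.
  have hadm : Admissible α β k t' := by
    refine ⟨?_, by linarith⟩
    rw [Mstar]
    split_ifs with hαβ
    · rw [zero_mul]; positivity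
    · rw [div_mul_eq_mul_div, div_le_iff₀ (by linarith)]
      nlinarith
  have hthr : threshold α β k t' ≤ ((k - ℓ + b' : ℕ) : ℝ) := by
    rw [threshold_eq hα, show k - ℓ + b' = k - ℓ' by omega, Nat.cast_sub (by omega)]
    have : (ℓ' : ℝ) ≤ (β * k - t') / α := by
      rw [le_div_iff₀ hα0]; linarith
    linarith
  have hh : hyper n k t ((k - ℓ : ℕ) : ℝ) ≤
      (n : ℝ) ^ b' * hyper n k t' (threshold α β k t') :=
    calc _ ≤ (n : ℝ) ^ b' * hyper n k (t + b') ((k - ℓ + b' : ℕ) : ℝ) :=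
          hyper_le_pow_mul b' hk (by omega) (by omega)
      _ ≤ (n : ℝ) ^ b' * hyper n k t' ((k - ℓ + b' : ℕ) : ℝ) :=
          mul_le_mul_of_nonneg_left (hyper_le_of_le hk htt' ht'n _) (by positivity)
      _ ≤ _ := mul_le_mul_of_nonneg_left (hyper_anti _ _ _ hthr) (by positivity)
  have hpos := hyper_pos_of_admissible hα hβ hadm hn
  -- Rounding `t'` down raises the exponent by less than `1 / α ≤ 1`; this is the origin of the
  -- factor `p.2` in the conclusion.
  have hs : c ^ ((β * k - t') / α) ≤ c * c ^ ℓ := by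
    calc c ^ ((β * k - t') / α) ≤ c ^ ((ℓ + 1 : ℕ) : ℝ) := by
          refine Real.rpow_le_rpow_of_exponent_le hc ?_
          rw [div_le_iff₀ hα0]
          have : (ℓ' : ℝ) ≤ ℓ := by exact_mod_cast (by omega : ℓ' ≤ ℓ)
          push_cast
          nlinarith
      _ = c * c ^ ℓ := by rw [Real.rpow_natCast, pow_succ, mul_comm]
  have hVle := hmin t' hadm
  rw [samplingCost, le_div_iff₀ hpos] at hVle
  simp only at hVle
  calc V * hyper n k t ((k - ℓ : ℕ) : ℝ)
      ≤ V * ((n : ℝ) ^ b' * hyper n k t' (threshold α β k t')) :=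
        mul_le_mul_of_nonneg_left hh hV
    _ = (n : ℝ) ^ b' * (V * hyper n k t' (threshold α β k t')) := by ring
    _ ≤ (n + 1 : ℝ) ^ b * (c * c ^ ℓ) := by
        refine mul_le_mul ?_ (hVle.trans hs) (by positivity) (by positivity)
        calc (n : ℝ) ^ b' ≤ (n + 1 : ℝ) ^ b' := by gcongr; linarith
          _ ≤ (n + 1 : ℝ) ^ b := pow_le_pow_right₀ (by linarith [(Nat.cast_nonneg n : (0:ℝ) ≤ n)]) hbb
    _ = _ := by ring

/-- A superset of `X` with at least `K` elements, as small as possible. -/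
def fillUp {n : ℕ} (K : ℕ) (X : Finset (Fin n)) : Finset (Fin n) :=
  open Classical in
  if h : ∃ Z : Finset (Fin n), X ⊆ Z ∧ Z.card = max X.card K then h.choose else Finset.univ

theorem fillUp_spec {n K : ℕ} (hK : K ≤ n) (X : Finset (Fin n)) :
    X ⊆ fillUp K X ∧ (fillUp K X).card = max X.card K := by
  have h : ∃ Z : Finset (Fin n), X ⊆ Z ∧ Z.card = max X.card K := by
    have hX : X.card ≤ n := by simpa using X.card_le_univ
    obtain ⟨Z, h1, -, h2⟩ := Finset.exists_subsuperset_card_eq (Finset.subset_univ X)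
      (le_max_left X.card K) (by simpa using ⟨hX, hK⟩)
    exact ⟨Z, h1, h2⟩
  rw [fillUp, dif_pos h]
  exact h.choose_spec

/-- Answers that reveal nothing: fill up to size `K` if this is allowed. -/
def blindAnswer {n : ℕ} (K : ℕ) (α : ℝ) (X : Finset (Fin n)) (ℓ : ℕ) : Finset (Fin n) :=
  open Classical in
  if (K : ℝ) ≤ X.card + α * ℓ then fillUp K X \ X else Finset.univ

/-- The query `(X, ℓ)` forces an `α`-extension oracle to reveal `T`. -/
def Reveals {n : ℕ} (K : ℕ) (α : ℝ) (T X : Finset (Fin n)) (ℓ : ℕ) : Prop :=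
  (T \ X).card ≤ ℓ ∧ X.card + α * ℓ < K

def revealingAnswer {n : ℕ} (K : ℕ) (α : ℝ) (T X : Finset (Fin n)) (ℓ : ℕ) : Finset (Fin n) :=
  open Classical in if Reveals K α T X ℓ then T \ X else blindAnswer K α X ℓ

theorem detOracle_isExtensionOracle {n : ℕ} {f : Finset (Fin n) → ℕ → Finset (Fin n)} {α : ℝ}
    {F : Set (Finset (Fin n))} (h1 : ∀ X ℓ, f X ℓ ∪ X ∈ F)
    (h2 : ∀ X (ℓ : ℕ), (∃ S, IsExtension F X ℓ S) → IsExtension F X (α * ℓ) (f X ℓ)) :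
    (detOracle f).IsExtensionOracle α F := by
  refine ⟨fun X ℓ _ => h1 X ℓ, fun X ℓ hX => ?_⟩
  have : ({r | IsExtension F X (α * ℓ) ((detOracle f).answer X ℓ r)} :
      Set (Fin (detOracle f).bits → Bool)) = Set.univ :=
    Set.eq_univ_of_forall fun _ => h2 X ℓ hX
  rw [this, Set.ncard_univ]
  norm_num [detOracle]

theorem card_blindAnswer_union {n K : ℕ} (hK : K ≤ n) (α : ℝ) (X : Finset (Fin n)) (ℓ : ℕ) :
    K ≤ (blindAnswer K α X ℓ ∪ X).card := by
  rw [blindAnswer]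
  split_ifs
  · obtain ⟨h1, h2⟩ := fillUp_spec hK X
    rw [Finset.sdiff_union_of_subset h1, h2]
    exact le_max_right _ _
  · rw [Finset.union_eq_left.2 (Finset.subset_univ X)]
    simpa using hK

theorem card_blindAnswer_le {n K : ℕ} (hK : K ≤ n) {α : ℝ} (hα : 1 ≤ α) {X : Finset (Fin n)}
    {ℓ : ℕ} (h : (K : ℝ) ≤ X.card + α * ℓ) : ((blindAnswer K α X ℓ).card : ℝ) ≤ α * ℓ := by
  rw [blindAnswer, if_pos h]
  obtain ⟨h1, h2⟩ := fillUp_spec hK X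
  have h3 := Finset.card_sdiff_add_card_eq_card h1
  rw [h2] at h3
  have h4 : ((fillUp K X \ X).card : ℝ) + X.card = max (X.card : ℝ) K := by exact_mod_cast h3
  have h5 : max (X.card : ℝ) K ≤ X.card + α * ℓ := max_le (by
    have : 0 ≤ α * ℓ := by positivity
    linarith) h
  linarith

/-- The proposition `p` switches the hidden solution on or off, so that one proof serves both
instances of the adversary. -/
theorem isMonotone_large {n K : ℕ} (hK : K ≤ n) (T : Finset (Fin n)) (p : Prop) :
    IsMonotone {S : Finset (Fin n) | K ≤ S.card ∨ (p ∧ T ⊆ S)} := by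
  refine ⟨Or.inl (by simpa using hK), ?_⟩
  rintro S S' hS (h | h)
  · exact Or.inl (h.trans (Finset.card_le_card hS))
  · exact Or.inr ⟨h.1, h.2.trans hS⟩

/-- If `X` has an `ℓ`-extension, then `K ≤ |X| + ℓ ≤ |X| + α ℓ`, and filling up to size `K` is
allowed. -/
theorem blindAnswer_isExtensionOracle {n K : ℕ} (hK : K ≤ n) {α : ℝ} (hα : 1 ≤ α) :
    (detOracle (n := n) (blindAnswer K α)).IsExtensionOracle α {S | K ≤ S.card} := by
  refine detOracle_isExtensionOracle (fun X ℓ => card_blindAnswer_union hK α X ℓ) ?_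
  rintro X ℓ ⟨S, hS, hSℓ⟩
  refine ⟨by rw [Finset.union_comm]; exact card_blindAnswer_union hK α X ℓ,
    card_blindAnswer_le hK hα ?_⟩
  have h1 : (K : ℝ) ≤ X.card + S.card := by
    exact_mod_cast (show K ≤ (X ∪ S).card from hS).trans (Finset.card_union_le X S)
  nlinarith [(Nat.cast_nonneg ℓ : (0 : ℝ) ≤ ℓ)]

/-- Filling up fails only if `|X| + α ℓ < K`. In this case an `ℓ`-extension cannot reach size `K`,
so it contains `T \ X`, and the query is one that reveals `T`. -/
theorem revealingAnswer_isExtensionOracle {n K : ℕ} (hK : K ≤ n) {α : ℝ} (hα : 1 ≤ α)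
    (T : Finset (Fin n)) :
    (detOracle (revealingAnswer K α T)).IsExtensionOracle α {S | K ≤ S.card ∨ T ⊆ S} := by
  have hmem : ∀ X ℓ, revealingAnswer K α T X ℓ ∪ X ∈ {S | K ≤ S.card ∨ T ⊆ S} := by
    intro X ℓ
    rw [revealingAnswer]
    split_ifs
    · exact Or.inr fun x hx => by by_cases h : x ∈ X <;> simp [h, hx]
    · exact Or.inl (card_blindAnswer_union hK α X ℓ)
  refine detOracle_isExtensionOracle hmem ?_
  rintro X ℓ ⟨S, hS, hSℓ⟩
  refine ⟨by rw [Finset.union_comm]; exact hmem X ℓ, ?_⟩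
  have hℓ : (ℓ : ℝ) ≤ α * ℓ := by nlinarith [(Nat.cast_nonneg ℓ : (0 : ℝ) ≤ ℓ)]
  rcases le_or_gt (K : ℝ) (X.card + α * ℓ) with h | h
  · rw [revealingAnswer, if_neg fun hr => absurd hr.2 (not_lt.2 h)]
    exact card_blindAnswer_le hK hα h
  · have hr : Reveals K α T X ℓ := by
      refine ⟨?_, h⟩
      rcases hS with hS | hS
      · exfalso
        have h1 : (K : ℝ) ≤ X.card + S.card := by
          exact_mod_cast hS.trans (Finset.card_union_le X S)
        linarith
      · have h1 : T \ X ⊆ S := by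
          intro x hx
          rw [Finset.mem_sdiff] at hx
          exact (Finset.mem_union.1 (hS hx.1)).resolve_left hx.2
        have h2 := Finset.card_le_card h1
        have h3 : S.card ≤ ℓ := by exact_mod_cast hSℓ
        omega
    rw [revealingAnswer, if_pos hr]
    have : ((T \ X).card : ℝ) ≤ ℓ := by exact_mod_cast hr.1
    linarith

open Classical in
theorem card_filter_exists_mem_le {ι κ : Type*} (A : Finset ι) (R : κ → ι → Prop)
    (tr : List κ) :
    (A.filter fun T => ∃ q ∈ tr, R q T).card ≤ (tr.map fun q => (A.filter (R q)).card).sum := by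
  induction tr with
  | nil => simp
  | cons q tr ih =>
    rw [List.map_cons, List.sum_cons]
    have : (A.filter fun T => ∃ q' ∈ q :: tr, R q' T) ⊆
        A.filter (R q) ∪ A.filter fun T => ∃ q ∈ tr, R q T := by
      intro T
      simp only [Finset.mem_filter, Finset.mem_union, List.mem_cons, exists_eq_or_imp]
      tauto
    refine (Finset.card_le_card this).trans ((Finset.card_union_le _ _).trans ?_)
    exact Nat.add_le_add_left ih _

instance : IsProbabilityMeasure coinLaw := by
  unfold coinLaw; infer_instance

/-- The event is the preimage of a subset of the finite set of bit strings of length `N`. -/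
theorem measurableSet_of_prefix {A : Set (ℕ → Bool)} (N : ℕ)
    (h : ∀ ω ω' : ℕ → Bool, (∀ i < N, ω i = ω' i) → ω ∈ A → ω' ∈ A) : MeasurableSet A := by
  have hA : A = (fun (ω : ℕ → Bool) (i : Fin N) => ω i) ⁻¹'
      ((fun (ω : ℕ → Bool) (i : Fin N) => ω i) '' A) := by
    refine Set.Subset.antisymm (Set.subset_preimage_image _ _) ?_
    rintro ω ⟨ω', hω', he⟩
    exact h ω' ω (fun i hi => congrFun he ⟨i, hi⟩) hω'
  rw [hA]
  exact (measurable_pi_lambda _ fun i => measurable_pi_apply _) (Set.toFinite _).measurableSet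

-- Averaging: the expected number of events that occur is the sum of their probabilities, at least
-- half their number, while it never exceeds `M`.
open Classical in
theorem card_le_two_mul_of_measure {ι : Type*} (A : Finset ι) (E : ι → Set (ℕ → Bool))
    (hE : ∀ T ∈ A, MeasurableSet (E T)) (hE' : ∀ T ∈ A, 1 / 2 ≤ coinLaw (E T)) (M : ℕ)
    (hM : ∀ ω, (A.filter fun T => ω ∈ E T).card ≤ M) : A.card ≤ 2 * M := by
  have h1 : ∑ T ∈ A, coinLaw (E T) ≤ M := by
    calc ∑ T ∈ A, coinLaw (E T) = ∑ T ∈ A, ∫⁻ ω, (E T).indicator 1 ω ∂coinLaw :=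
          Finset.sum_congr rfl fun T hT => (lintegral_indicator_one (hE T hT)).symm
      _ = ∫⁻ ω, ∑ T ∈ A, (E T).indicator 1 ω ∂coinLaw :=
          (lintegral_finsetSum' _ fun T hT =>
            (measurable_one.indicator (hE T hT)).aemeasurable).symm
      _ ≤ ∫⁻ _, (M : ENNReal) ∂coinLaw := by
          refine lintegral_mono fun ω => ?_
          have : ∑ T ∈ A, (E T).indicator (1 : (ℕ → Bool) → ENNReal) ω =
              ((A.filter fun T => ω ∈ E T).card : ENNReal) := by
            rw [Finset.card_filter]
            push_cast
            exact Finset.sum_congr rfl fun T _ => by simp [Set.indicator_apply]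
          rw [this]
          exact Nat.cast_le.2 (hM ω)
      _ = M := by simp
  have h2 : (A.card : ENNReal) * (1 / 2) ≤ M := by
    refine le_trans ?_ h1
    rw [← nsmul_eq_mul, ← Finset.sum_const]
    exact Finset.sum_le_sum hE'
  rw [one_div, ← div_eq_mul_inv, ENNReal.div_le_iff (by norm_num) (by norm_num)] at h2
  have h3 : A.card ≤ M * 2 := by exact_mod_cast h2
  omega

/-- The constants `D` and `b` pay for rounding exponents and rounding `β k`. They depend on `L`
only, so the losses they cause are polynomial in `n`. -/
theorem IsSpecList.exists_bounds {L : Finset (ℝ × ℝ)} (hL : IsSpecList L) :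
    ∃ (D : ℝ) (b : ℕ), 1 ≤ D ∧ (∀ j : L, j.1.2 ≤ D) ∧
      ∀ j : L, j.1.1 = 1 ∨ 1 ≤ (j.1.1 - 1) * b := by
  obtain ⟨D, hD⟩ := (Set.finite_range fun j : L => j.1.2).bddAbove
  obtain ⟨b, hb⟩ := (Set.finite_range fun j : L => ⌈(j.1.1 - 1)⁻¹⌉₊).bddAbove
  refine ⟨max 1 D, b, le_max_left _ _, fun j => (hD ⟨j, rfl⟩).trans (le_max_right _ _),
    fun j => ?_⟩
  rcases (hL.2 _ j.2).1.eq_or_lt with h | h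
  · exact Or.inl h.symm
  · right
    have h0 : 0 < j.1.1 - 1 := by linarith
    have h1 : (j.1.1 - 1)⁻¹ ≤ b :=
      (Nat.le_ceil _).trans (by exact_mod_cast hb ⟨j, rfl⟩)
    rwa [inv_le_iff_one_le_mul₀' h0] at h1

/-- Monotone local search with the best parameters is, up to a polynomial factor, not more
expensive than any approximation algorithm. -/
theorem samplingCost_le_of_isRandomizedApprox {L : Finset (ℝ × ℝ)} (hL : IsSpecList L) {β : ℝ}
    (hβ : 1 ≤ β) {D : ℝ} {b : ℕ} (hD1 : 1 ≤ D) (hD : ∀ j : L, j.1.2 ≤ D)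
    (hb : ∀ j : L, j.1.1 = 1 ∨ 1 ≤ (j.1.1 - 1) * b) {P : Prog L} (hP : IsRandomizedApprox β P)
    {n : ℕ} {B : ℝ} (hB1 : 1 ≤ B) (hB : CostAtMost β P n B) {k : ℕ} (hk : β * k ≤ n) {j : L}
    {t : ℕ} (hjt : IsBestSampling n β k j t) :
    samplingCost n β k j.1 t ≤ 2 * D * (n + 1) ^ b * B := by
  classical
  set V := samplingCost n β k j.1 t with hV
  -- The least cardinality that is too large for a `β`-approximation of a `k`-element solution.
  set K := ⌊β * k⌋₊ + 1 with hKdef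
  have hβk : 0 ≤ β * k := by positivity
  have hn1 : (1 : ℝ) ≤ (n + 1 : ℝ) ^ b := one_le_pow₀ (by linarith [(Nat.cast_nonneg n : (0:ℝ) ≤ n)])
  have hkn : k ≤ n := le_of_mul_le hβ hk
  have hVpos : 0 < V := samplingCost_pos (hL.2 _ j.2).1 (hL.2 _ j.2).2 hβ hjt.1 hk
  -- If `K > n`, the adversary has no large sets to offer. But then `β k = n`, and sampling the
  -- whole universe has cost `1`.
  rcases Nat.lt_or_ge n K with hKn | hKn
  · have hfl : ⌊β * k⌋₊ = n := by
      refine le_antisymm ?_ (by omega)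
      exact Nat.floor_le_of_le hk
    have hβkn : β * k = n := by
      have := Nat.floor_le hβk
      rw [hfl] at this
      linarith
    have hα := (hL.2 _ j.2).1
    have h1 := hjt.2 j n (by rw [← hfl]; exact admissible_floor hβ k)
    have h2 : samplingCost n β k j.1 n = 1 := by
      have hh : hyper n k n (threshold j.1.1 β k n) = 1 := by
        rw [threshold_eq hα, hβkn, sub_self, zero_div, sub_zero, hyper, min_eq_right hkn]
        have : (Finset.range (k + 1)).filter (fun y : ℕ => (k : ℝ) ≤ (y : ℝ)) = {k} := by
          ext y
          simp only [Finset.mem_filter, Finset.mem_range, Nat.cast_le, Finset.mem_singleton]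
          omega
        rw [this, Finset.sum_singleton]
        simp
      rw [samplingCost, hh, hβkn, sub_self, zero_div, Real.rpow_zero, div_one]
    rw [h2] at h1
    have : 1 ≤ 2 * D * (n + 1 : ℝ) ^ b * B := by
      have h3 : 1 ≤ 2 * D := by linarith
      exact one_le_mul_of_one_le_of_one_le (one_le_mul_of_one_le_of_one_le h3 hn1) hB1
    exact h1.trans this
  set f₀ : L → Finset (Fin n) → ℕ → Finset (Fin n) := fun j => blindAnswer K j.1.1 with hf₀
  set f : Finset (Fin n) → L → Finset (Fin n) → ℕ → Finset (Fin n) :=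
    fun T j => revealingAnswer K j.1.1 T with hf
  have hF₀ : IsMonotone {S : Finset (Fin n) | K ≤ S.card} := by
    simpa using isMonotone_large hKn ∅ False
  have hO₀ : AreOraclesFor (fun j => detOracle (f₀ j)) {S : Finset (Fin n) | K ≤ S.card} :=
    fun j => blindAnswer_isExtensionOracle hKn (hL.2 _ j.2).1
  choose S₀ p₀ tr₀ hrun₀ hcost₀ using hB n le_rfl _ hF₀ _ hO₀
  have hS₀ : ∀ ω, K ≤ (S₀ ω).card := by
    intro ω
    obtain ⟨S, p, tr, hrun, hS⟩ := (hP n _ hF₀ _ hO₀).1 ω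
    rw [((hrun₀ ω).unique hrun).1]
    exact hS
  -- The event that the run against the blind oracles contains a query which would have disclosed
  -- `T`.
  set E : Finset (Fin n) → Set (ℕ → Bool) :=
    fun T => {ω | ∃ q ∈ tr₀ ω, Reveals K q.j.1.1 T q.X q.ℓ} with hE
  have hprice : ∀ ω, 0 ≤ ((tr₀ ω).map fun q => q.j.1.2 ^ q.ℓ).sum := fun ω =>
    List.sum_nonneg fun x hx => by
      obtain ⟨q, -, rfl⟩ := List.mem_map.1 hx
      have := (hL.2 _ q.j.2).2
      positivity
  have hmeas : ∀ T, MeasurableSet (E T) := by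
    intro T
    refine measurableSet_of_prefix ⌈B⌉₊ fun ω ω' hω hmem => ?_
    obtain ⟨σ, hex, -⟩ := hrun₀ ω
    obtain ⟨σ', hex', -⟩ := hrun₀ ω'
    have hp : p₀ ω ≤ ⌈B⌉₊ := by
      have h1 := hcost₀ ω
      have h2 := hprice ω
      rw [execCost] at h1
      have : (p₀ ω : ℝ) ≤ ⌈B⌉₊ := by linarith [Nat.le_ceil B]
      exact_mod_cast this
    have hpos := hex.pos_le_add
    have hpos0 : (initial n).pos = 0 := rfl
    have hex2 := hex.congr_bits (ω' := ω') fun i hi => hω i (by omega)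
    obtain ⟨-, -, htr⟩ := hex2.unique hex'
    change ∃ q ∈ tr₀ ω', _
    rw [← htr]
    exact hmem
  -- If no query of the blind run discloses `T`, the run on the instance of `T` is the same one. Its
  -- output has at least `K > β k` elements, so it is not a success.
  have hhalf : ∀ T ∈ Finset.powersetCard k (Finset.univ : Finset (Fin n)),
      1 / 2 ≤ coinLaw (E T) := by
    intro T hT
    rw [Finset.mem_powersetCard] at hT
    have hFT : IsMonotone {S : Finset (Fin n) | K ≤ S.card ∨ T ⊆ S} := by
      simpa using isMonotone_large hKn T True
    have hOT : AreOraclesFor (fun j => detOracle (f T j))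
        {S : Finset (Fin n) | K ≤ S.card ∨ T ⊆ S} :=
      fun j => revealingAnswer_isExtensionOracle hKn (hL.2 _ j.2).1 T
    refine (hP n _ hFT _ hOT).2.trans (measure_mono ?_)
    rintro ω ⟨S, p, tr, hrun, hS⟩
    by_contra hno
    have hno' : ∀ q ∈ tr₀ ω, ¬ Reveals K q.j.1.1 T q.X q.ℓ := fun q hq hr => hno ⟨q, hq, hr⟩
    obtain ⟨σ, hex, hσ⟩ := hrun₀ ω
    have hex2 := hex.congr_answers (f' := f T) fun q hq => by
      simp only [hf₀, hf, revealingAnswer]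
      rw [if_neg (hno' q hq)]
    obtain ⟨hSS, -, -⟩ := hrun.unique ⟨σ, hex2, hσ⟩
    have h1 := hS.2 T (Or.inr subset_rfl)
    rw [hSS, hT.2] at h1
    have h2 : (S₀ ω).card ≤ ⌊β * k⌋₊ := Nat.le_floor h1
    have h3 := hS₀ ω
    omega
  set c := (n.choose k : ℝ) with hc
  have hcpos : 0 < c := by
    have := Nat.choose_pos hkn
    rw [hc]; exact_mod_cast this
  have hquery : ∀ q : Query L n,
      (((Finset.powersetCard k (Finset.univ : Finset (Fin n))).filter
        fun T => Reveals K q.j.1.1 T q.X q.ℓ).card : ℝ) * V ≤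
      c * (D * (n + 1) ^ b) * q.j.1.2 ^ q.ℓ := by
    intro q
    have hq1 := (hL.2 _ q.j.2).1
    have hq2 := (hL.2 _ q.j.2).2
    have hq2' : 0 < q.j.1.2 := by linarith
    by_cases hcond : (q.X.card : ℝ) + q.j.1.1 * q.ℓ < K
    -- A disclosed `T` has at most `ℓ` of its `k` elements outside `X`. Capping `ℓ` at `k` changes
    -- nothing for `k`-sets and is required by `mul_hyper_le`.
    · have hsub : (Finset.powersetCard k (Finset.univ : Finset (Fin n))).filter
          (fun T => Reveals K q.j.1.1 T q.X q.ℓ) ⊆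
          (Finset.powersetCard k (Finset.univ : Finset (Fin n))).filter
            (fun T => ((k - min q.ℓ k : ℕ) : ℝ) ≤ ((T ∩ q.X).card : ℝ)) := by
        intro T hT
        simp only [Finset.mem_filter, Finset.mem_powersetCard, Nat.cast_le] at hT ⊢
        refine ⟨hT.1, ?_⟩
        have h1 := Finset.card_sdiff_add_card_inter T q.X
        have h2 := hT.2.1
        omega
      have h1 : (((Finset.powersetCard k (Finset.univ : Finset (Fin n))).filter
          fun T => Reveals K q.j.1.1 T q.X q.ℓ).card : ℝ) ≤
          hyper n k q.X.card ((k - min q.ℓ k : ℕ) : ℝ) * c := by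
        rw [hc, hyper_mul_choose hkn]
        exact_mod_cast Finset.card_le_card hsub
      have hmin : (min q.ℓ k : ℕ) ≤ (q.ℓ : ℝ) := by exact_mod_cast min_le_left _ _
      have h2 := mul_hyper_le (p := q.j.1) (V := V) hq1 hq2 hβ (t := q.X.card)
        (ℓ := min q.ℓ k) (b := b) hk hVpos.le (fun s hs => hjt.2 q.j s hs) (hb q.j)
        (by nlinarith) (min_le_right _ _)
      calc _ ≤ hyper n k q.X.card ((k - min q.ℓ k : ℕ) : ℝ) * c * V := by gcongr
        _ = c * (V * hyper n k q.X.card ((k - min q.ℓ k : ℕ) : ℝ)) := by ring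
        _ ≤ c * (q.j.1.2 * (n + 1) ^ b * q.j.1.2 ^ (min q.ℓ k)) := by gcongr
        _ ≤ c * (D * (n + 1) ^ b * q.j.1.2 ^ q.ℓ) := by
            have h3 := hD q.j
            have h4 : q.j.1.2 ^ (min q.ℓ k) ≤ q.j.1.2 ^ q.ℓ :=
              pow_le_pow_right₀ hq2 (min_le_left _ _)
            gcongr
        _ = _ := by ring
    · have : (Finset.powersetCard k (Finset.univ : Finset (Fin n))).filter
          (fun T => Reveals K q.j.1.1 T q.X q.ℓ) = ∅ :=
        Finset.filter_false_of_mem fun T _ hr => hcond hr.2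
      rw [this]
      simp only [Finset.card_empty, Nat.cast_zero, zero_mul]
      positivity
  have hM : ∀ ω, ((Finset.powersetCard k (Finset.univ : Finset (Fin n))).filter
      fun T => ω ∈ E T).card ≤ ⌊c * (D * (n + 1) ^ b) * B / V⌋₊ := by
    intro ω
    refine Nat.le_floor ?_
    rw [le_div_iff₀ hVpos]
    have h1 := card_filter_exists_mem_le (Finset.powersetCard k (Finset.univ : Finset (Fin n)))
      (fun (q : Query L n) T => Reveals K q.j.1.1 T q.X q.ℓ) (tr₀ ω)
    have h2 : (((tr₀ ω).map fun q : Query L n =>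
        ((Finset.powersetCard k (Finset.univ : Finset (Fin n))).filter
          fun T => Reveals K q.j.1.1 T q.X q.ℓ).card).sum : ℝ) * V ≤
        c * (D * (n + 1) ^ b) * ((tr₀ ω).map fun q => q.j.1.2 ^ q.ℓ).sum := by
      generalize tr₀ ω = tr
      induction tr with
      | nil => simp
      | cons q tr ih =>
        simp only [List.map_cons, List.sum_cons, Nat.cast_add]
        have := hquery q
        linarith
    have h3 := hcost₀ ω
    rw [execCost] at h3
    have h4 : ((tr₀ ω).map fun q => q.j.1.2 ^ q.ℓ).sum ≤ B := by
      have : (0 : ℝ) ≤ p₀ ω := by positivity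
      linarith
    calc _ ≤ (((tr₀ ω).map fun q : Query L n =>
        ((Finset.powersetCard k (Finset.univ : Finset (Fin n))).filter
          fun T => Reveals K q.j.1.1 T q.X q.ℓ).card).sum : ℝ) * V := by
          refine mul_le_mul_of_nonneg_right ?_ hVpos.le
          exact Nat.cast_le.2 h1
      _ ≤ _ := h2
      _ ≤ _ := by gcongr
  have hfin := card_le_two_mul_of_measure _ E (fun T _ => hmeas T) hhalf
    ⌊c * (D * (n + 1) ^ b) * B / V⌋₊ fun ω => by convert hM ω
  rw [Finset.card_powersetCard, Finset.card_univ, Fintype.card_fin] at hfin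
  have h5 : c ≤ 2 * (c * (D * (n + 1) ^ b) * B / V) := by
    have h6 : c ≤ 2 * (⌊c * (D * (n + 1) ^ b) * B / V⌋₊ : ℝ) := by
      rw [hc]; exact_mod_cast hfin
    have := Nat.floor_le (show 0 ≤ c * (D * (n + 1) ^ b) * B / V by positivity)
    linarith
  rw [← mul_div_assoc, le_div_iff₀ hVpos] at h5
  have h7 : c * V ≤ c * (2 * D * (n + 1) ^ b * B) := by linarith
  exact le_of_mul_le_mul_left h7 hcpos

/-! ### Covering by greedy choice -/

-- By double counting, some `b` covers at least the fraction `N / |B|` of the uncovered elements.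
-- Each greedy choice thus multiplies their number by at most `1 - N / |B|`; the inequality is
-- stated with denominators cleared.
open Classical in
theorem exists_list_uncovered_le {ι κ : Type*} (A : Finset ι) (B : Finset κ) (hB : B.Nonempty)
    (R : ι → κ → Prop) (N : ℕ) (hN : ∀ a ∈ A, N ≤ (B.filter fun b => R a b).card) (r : ℕ) :
    ∃ l : List κ, l.length = r ∧ (∀ b ∈ l, b ∈ B) ∧
      ((A.filter fun a => ∀ b ∈ l, ¬ R a b).card : ℝ) * (B.card : ℝ) ^ r ≤
        A.card * ((B.card : ℝ) - N) ^ r := by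
  induction r with
  | zero => exact ⟨[], rfl, by simp, by simp⟩
  | succ r ih =>
    obtain ⟨l, hl, hlB, hle⟩ := ih
    set U := A.filter fun a => ∀ b ∈ l, ¬ R a b with hU
    have hcount : N * U.card ≤ ∑ b ∈ B, (U.filter fun a => R a b).card := by
      calc N * U.card = ∑ a ∈ U, N := by rw [Finset.sum_const, smul_eq_mul, mul_comm]
        _ ≤ ∑ a ∈ U, (B.filter fun b => R a b).card :=
            Finset.sum_le_sum fun a ha => hN a (Finset.mem_of_mem_filter a ha)
        _ = ∑ b ∈ B, (U.filter fun a => R a b).card :=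
            Finset.sum_card_bipartiteAbove_eq_sum_card_bipartiteBelow R
    obtain ⟨b, hb, hbc⟩ : ∃ b ∈ B, N * U.card ≤ B.card * (U.filter fun a => R a b).card := by
      by_contra! hcon
      have h1 : ∑ b ∈ B, B.card * (U.filter fun a => R a b).card < ∑ b ∈ B, N * U.card :=
        Finset.sum_lt_sum_of_nonempty hB hcon
      rw [← Finset.mul_sum, Finset.sum_const, smul_eq_mul] at h1
      exact absurd (Nat.mul_le_mul_left B.card hcount) (not_le.2 h1)
    refine ⟨b :: l, by simp [hl], by simpa using ⟨hb, hlB⟩, ?_⟩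
    have hsplit : (A.filter fun a => ∀ b' ∈ b :: l, ¬ R a b').card +
        (U.filter fun a => R a b).card = U.card := by
      have : (A.filter fun a => ∀ b' ∈ b :: l, ¬ R a b') = U.filter fun a => ¬ R a b := by
        ext a
        simp only [hU, Finset.mem_filter, List.mem_cons, forall_eq_or_imp]
        tauto
      rw [this, add_comm]
      exact Finset.card_filter_add_card_filter_not _
    -- The sign of `|B| - N` is known only if some element is there to witness `N ≤ |B|`.
    have hNB : (N : ℝ) ≤ B.card ∨ U.card = 0 := by
      rcases Finset.eq_empty_or_nonempty U with h | ⟨a, ha⟩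
      · exact Or.inr (by rw [h]; rfl)
      · left
        have := (hN a (Finset.mem_of_mem_filter a ha)).trans (Finset.card_filter_le _ _)
        exact_mod_cast this
    set u := (U.card : ℝ)
    set v := ((U.filter fun a => R a b).card : ℝ)
    set u' := ((A.filter fun a => ∀ b' ∈ b :: l, ¬ R a b').card : ℝ)
    have hs : u' + v = u := by rw [← Nat.cast_add, hsplit]
    have hv : N * u ≤ B.card * v := by
      rw [← Nat.cast_mul, ← Nat.cast_mul]; exact Nat.cast_le.2 hbc
    have hB0 : (0 : ℝ) ≤ (B.card : ℝ) ^ r := by positivity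
    have hu' : 0 ≤ u' := by positivity
    rcases hNB with hNB | hU0
    · calc u' * (B.card : ℝ) ^ (r + 1) = (u' * B.card) * (B.card : ℝ) ^ r := by ring
        _ ≤ (u * ((B.card : ℝ) - N)) * (B.card : ℝ) ^ r := by
            refine mul_le_mul_of_nonneg_right ?_ hB0
            have : u' = u - v := by linarith
            rw [this]
            linarith
        _ = u * (B.card : ℝ) ^ r * ((B.card : ℝ) - N) := by ring
        _ ≤ A.card * ((B.card : ℝ) - N) ^ r * ((B.card : ℝ) - N) :=
            mul_le_mul_of_nonneg_right hle (by linarith)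
        _ = _ := by ring
    · have hu0 : u = 0 := by simp only [u, hU0, Nat.cast_zero]
      have hv0 : 0 ≤ v := by positivity
      have : u' = 0 := by linarith
      rw [this, zero_mul]
      rcases Finset.eq_empty_or_nonempty A with h | ⟨a, ha⟩
      · simp [h]
      · have : (N : ℝ) ≤ B.card := by
          exact_mod_cast (hN a ha).trans (Finset.card_filter_le _ _)
        have : 0 ≤ (B.card : ℝ) - N := by linarith
        positivity

-- After `⌈s |B| / N⌉` greedy choices at most `2 ^ s * exp (-s) < 1` elements remain uncovered.
-- Rounding up costs one extra `N ≤ |B|`, whence `s + 1` in place of `s`.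
open Classical in
theorem exists_list_covering {ι κ : Type*} (A : Finset ι) (B : Finset κ)
    (R : ι → κ → Prop) {N s : ℕ} (hs : 1 ≤ s) (hN0 : 0 < N) (hNB : N ≤ B.card)
    (hN : ∀ a ∈ A, N ≤ (B.filter fun b => R a b).card) (hA : A.card ≤ 2 ^ s) :
    ∃ l : List κ, l.length * N ≤ (s + 1) * B.card ∧ (∀ b ∈ l, b ∈ B) ∧
      ∀ a ∈ A, ∃ b ∈ l, R a b := by
  have hB0 : 0 < B.card := by omega
  have hBr : (0 : ℝ) < B.card := by exact_mod_cast hB0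
  have hNr : (0 : ℝ) < N := by exact_mod_cast hN0
  have hNBr : (N : ℝ) ≤ B.card := by exact_mod_cast hNB
  set r := ⌈(s : ℝ) * B.card / N⌉₊ with hr
  obtain ⟨l, hl, hlB, hle⟩ := exists_list_uncovered_le A B (Finset.card_pos.1 hB0) R N hN r
  refine ⟨l, ?_, hlB, ?_⟩
  · have h1 : (r : ℝ) < s * B.card / N + 1 := Nat.ceil_lt_add_one (by positivity)
    have h2 : (r : ℝ) * N ≤ (s + 1) * B.card := by
      calc (r : ℝ) * N ≤ (s * B.card / N + 1) * N := by gcongr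
        _ = s * B.card + N := by field_simp
        _ ≤ _ := by linarith
    rw [hl]
    exact_mod_cast h2
  · have hlt : ((A.filter fun a => ∀ b ∈ l, ¬ R a b).card : ℝ) < 1 := by
      have h1 : (1 - (N : ℝ) / B.card) ^ r ≤ Real.exp (-(s : ℝ)) := by
        calc (1 - (N : ℝ) / B.card) ^ r ≤ (Real.exp (-((N : ℝ) / B.card))) ^ r := by
              refine pow_le_pow_left₀ ?_ (Real.one_sub_le_exp_neg _) r
              rw [sub_nonneg, div_le_one hBr]
              exact hNBr
          _ = Real.exp (r * (-((N : ℝ) / B.card))) := by rw [Real.exp_nat_mul]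
          _ ≤ _ := by
              refine Real.exp_le_exp.2 ?_
              have h2 : (s : ℝ) * B.card / N ≤ r := Nat.le_ceil _
              rw [div_le_iff₀ hNr] at h2
              have h3 : (s : ℝ) ≤ r * ((N : ℝ) / B.card) := by
                rw [← mul_div_assoc, le_div_iff₀ hBr]; exact h2
              linarith
      have h2 : ((A.filter fun a => ∀ b ∈ l, ¬ R a b).card : ℝ) ≤
          A.card * (1 - (N : ℝ) / B.card) ^ r := by
        have : (1 - (N : ℝ) / B.card) ^ r = ((B.card : ℝ) - N) ^ r / (B.card : ℝ) ^ r := by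
          rw [← div_pow]; congr 1; field_simp
        rw [this, ← mul_div_assoc, le_div_iff₀ (by positivity)]
        exact hle
      have h3 : (A.card : ℝ) ≤ 2 ^ s := by exact_mod_cast hA
      calc _ ≤ _ := h2
        _ ≤ 2 ^ s * Real.exp (-(s : ℝ)) := by
            refine mul_le_mul h3 h1 ?_ (by positivity)
            have : 0 ≤ 1 - (N : ℝ) / B.card := by
              rw [sub_nonneg, div_le_one hBr]; exact hNBr
            positivity
        _ < Real.exp s * Real.exp (-(s : ℝ)) := by
            refine mul_lt_mul_of_pos_right ?_ (Real.exp_pos _)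
            rw [show (s : ℝ) = s * 1 by ring, Real.exp_nat_mul]
            have : (2 : ℝ) < Real.exp 1 := by linarith [Real.exp_one_gt_d9]
            exact pow_lt_pow_left₀ this (by norm_num) (by omega)
        _ = 1 := by rw [← Real.exp_add]; simp
    have h0 : (A.filter fun a => ∀ b ∈ l, ¬ R a b).card = 0 := by
      have : (A.filter fun a => ∀ b ∈ l, ¬ R a b).card < 1 := by exact_mod_cast hlt
      omega
    intro a ha
    by_contra! hcon
    rw [Finset.card_eq_zero, Finset.filter_eq_empty_iff] at h0
    exact h0 ha hcon

/-! ### Bit masks -/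

/-- The number of common elements of the sets with bit masks `a` and `b` below `r`. -/
def common (r a b : ℕ) : ℕ :=
  ((Finset.range r).filter fun i => a.testBit i = true ∧ b.testBit i = true).card

theorem card_decode_inter (r a b : ℕ) : (decode r a ∩ decode r b).card = common r a b := by
  rw [common, ← Finset.card_map Fin.valEmbedding]
  congr 1
  ext i
  simp only [decode, Finset.mem_map, Finset.mem_inter, Finset.mem_filter, Finset.mem_univ,
    true_and, Fin.valEmbedding_apply, Finset.mem_range]
  constructor
  · rintro ⟨j, h, rfl⟩; exact ⟨j.2, h⟩
  · rintro ⟨hi, h⟩; exact ⟨⟨i, hi⟩, h, rfl⟩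

theorem card_decode (r a : ℕ) : (decode r a).card = common r a a := by
  rw [← card_decode_inter, Finset.inter_self]

theorem common_self_le (r a : ℕ) : common r a a ≤ r := by
  rw [← card_decode]
  simpa using (decode r a).card_le_univ

theorem common_add {r s h h' l l' : ℕ} (hl : l < 2 ^ r) (hl' : l' < 2 ^ r) :
    common (r + s) (h * 2 ^ r + l) (h' * 2 ^ r + l') = common s h h' + common r l l' := by
  have key : ∀ a b r, common r a b =
      ∑ i ∈ Finset.range r, if a.testBit i = true ∧ b.testBit i = true then 1 else 0 := by
    intro a b r
    rw [common, Finset.card_filter]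
  rw [key, key, key, Finset.sum_range_add, add_comm]
  congr 1
  · refine Finset.sum_congr rfl fun i _ => ?_
    rw [mul_comm h, mul_comm h', Nat.testBit_two_pow_mul_add _ hl, Nat.testBit_two_pow_mul_add _ hl']
    simp
  · refine Finset.sum_congr rfl fun i hi => ?_
    rw [Finset.mem_range] at hi
    rw [mul_comm h, mul_comm h', Nat.testBit_two_pow_mul_add _ hl, Nat.testBit_two_pow_mul_add _ hl']
    simp [hi]

theorem encode_lt {n : ℕ} (Y : Finset (Fin n)) : encode Y < 2 ^ n := by
  have h1 : encode Y = ∑ i ∈ Y.map Fin.valEmbedding, 2 ^ i := by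
    rw [encode, Finset.sum_map]; rfl
  rw [h1]
  refine Nat.geomSum_lt le_rfl ?_
  intro i hi
  obtain ⟨j, -, rfl⟩ := Finset.mem_map.1 hi
  exact j.2

theorem decode_encode {n : ℕ} (Y : Finset (Fin n)) : decode n (encode Y) = Y := by
  have h1 : encode Y = ∑ i ∈ Y.map Fin.valEmbedding, 2 ^ i := by
    rw [encode, Finset.sum_map]; rfl
  ext i
  rw [decode, Finset.mem_filter, h1]
  have h2 := Finset.toFinset_bitIndices_sum_two_pow (Y.map Fin.valEmbedding)
  rw [← Nat.mem_bitIndices, ← List.mem_toFinset, h2]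
  simp [Fin.val_inj]

theorem decode_injOn {n a b : ℕ} (ha : a < 2 ^ n) (hb : b < 2 ^ n)
    (h : decode n a = decode n b) : a = b := by
  refine Nat.eq_of_testBit_eq fun i => ?_
  rcases lt_or_ge i n with hi | hi
  · have := Finset.ext_iff.1 h ⟨i, hi⟩
    simp only [decode, Finset.mem_filter, Finset.mem_univ, true_and] at this
    exact Bool.eq_iff_iff.2 this
  · rw [Nat.testBit_lt_two_pow (ha.trans_le (Nat.pow_le_pow_right (by norm_num) hi)),
      Nat.testBit_lt_two_pow (hb.trans_le (Nat.pow_le_pow_right (by norm_num) hi))]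

/-! ### Tables of covering families on a block -/

/-- Greedy covering of the `k`-sets by the `(y + u)`-sets: each `k`-set meets exactly `C(k, y) C(s -
k, u)` of these in `y` elements. For meaningless parameters the list is empty, so that it is defined
for all of them. -/
theorem exists_block_family {s : ℕ} (hs : 1 ≤ s) (k y u : ℕ) :
    ∃ l : List ℕ, (∀ v ∈ l, v < 2 ^ s ∧ common s v v = y + u) ∧
      (k ≤ s → y ≤ k → u ≤ s - k →
        l.length * (k.choose y * (s - k).choose u) ≤ (s + 1) * s.choose (y + u) ∧
        ∀ T < 2 ^ s, common s T T = k → ∃ v ∈ l, y ≤ common s T v) := by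
  by_cases h : k ≤ s ∧ y ≤ k ∧ u ≤ s - k
  swap
  · exact ⟨[], by simp, fun h1 h2 h3 => absurd ⟨h1, h2, h3⟩ h⟩
  obtain ⟨hks, hyk, hus⟩ := h
  have hdec : ∀ T : Finset (Fin s), (Finset.powersetCard (y + u) (Finset.univ : Finset (Fin s))).card
      = s.choose (y + u) := fun _ => by simp
  have hN0 : 0 < k.choose y * (s - k).choose u :=
    Nat.mul_pos (Nat.choose_pos hyk) (Nat.choose_pos hus)
  have hcnt : ∀ T ∈ Finset.powersetCard k (Finset.univ : Finset (Fin s)),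
      k.choose y * (s - k).choose u ≤
        ((Finset.powersetCard (y + u) (Finset.univ : Finset (Fin s))).filter
          fun X => (X ∩ T).card = y).card := by
    intro T hT
    rw [Finset.mem_powersetCard] at hT
    rw [card_filter_inter_eq T (Nat.le_add_right y u), hT.2, Nat.add_sub_cancel_left]
  obtain ⟨T₀, hT₀⟩ := exists_card_eq hks
  obtain ⟨l, hl1, hl2, hl3⟩ := exists_list_covering
    (Finset.powersetCard k (Finset.univ : Finset (Fin s)))
    (Finset.powersetCard (y + u) (Finset.univ : Finset (Fin s)))
    (fun T X => (X ∩ T).card = y) hs hN0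
    ((hcnt T₀ (by simp [Finset.mem_powersetCard, hT₀])).trans (Finset.card_filter_le _ _))
    (fun T hT => by convert hcnt T hT)
    (by
      rw [Finset.card_powersetCard, Finset.card_univ, Fintype.card_fin]
      exact Nat.choose_le_two_pow _ _)
  refine ⟨l.map encode, ?_, fun _ _ _ => ⟨?_, ?_⟩⟩
  · intro v hv
    obtain ⟨X, hX, rfl⟩ := List.mem_map.1 hv
    refine ⟨encode_lt X, ?_⟩
    rw [← card_decode, decode_encode]
    exact (Finset.mem_powersetCard.1 (hl2 X hX)).2
  · simpa using hl1
  · intro T hT hTk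
    obtain ⟨X, hX, hXT⟩ := hl3 (decode s T) (by
      rw [Finset.mem_powersetCard]
      exact ⟨Finset.subset_univ _, by rw [card_decode, hTk]⟩)
    refine ⟨encode X, List.mem_map.2 ⟨X, hX, rfl⟩, ?_⟩
    rw [← card_decode_inter, decode_encode, Finset.inter_comm, hXT]

/-- One table serves all parameters, so it can be fixed before they are known. Interleaving the
families for all `(k, y, u)` costs a factor `(s + 1) ^ 3` in the index, and greedy covering one more
factor `s + 1`. -/
theorem exists_block_table {s : ℕ} (hs : 1 ≤ s) :
    ∃ τ : ℕ → ℕ, (∀ q, τ q < 2 ^ s) ∧ ∀ k y u T, T < 2 ^ s → common s T T = k → y ≤ k →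
      u ≤ s - k → ∃ q, (q + 1) * (k.choose y * (s - k).choose u) ≤
        (s + 1) ^ 4 * s.choose (y + u) ∧ common s (τ q) (τ q) = y + u ∧ y ≤ common s T (τ q) := by
  choose F hF1 hF2 using fun k y u => exists_block_family hs k y u
  refine ⟨fun q => (F (q % (s + 1) ^ 3 % (s + 1)) (q % (s + 1) ^ 3 / (s + 1) % (s + 1))
    (q % (s + 1) ^ 3 / (s + 1) / (s + 1))).getD (q / (s + 1) ^ 3) 0, ?_, ?_⟩
  · intro q
    beta_reduce
    rw [List.getD_eq_getElem?_getD]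
    rcases h : (F (q % (s + 1) ^ 3 % (s + 1)) (q % (s + 1) ^ 3 / (s + 1) % (s + 1))
      (q % (s + 1) ^ 3 / (s + 1) / (s + 1)))[q / (s + 1) ^ 3]? with _ | v
    · simp
    · exact (hF1 _ _ _ v (List.mem_of_getElem? h)).1
  · intro k y u T hT hTk hy hu
    have hks : k ≤ s := hTk ▸ common_self_le s T
    obtain ⟨hlen, hcov⟩ := hF2 k y u hks hy hu
    obtain ⟨v, hv, hyv⟩ := hcov T hT hTk
    obtain ⟨i, hi, rfl⟩ := List.mem_iff_getElem.1 hv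
    -- The residue of the index modulo `(s + 1) ^ 3` stores `u, y, k` as digits in base `s + 1`; the
    -- quotient is the position in the family.
    set c := u * (s + 1) * (s + 1) + y * (s + 1) + k with hc
    have hcs : c < (s + 1) ^ 3 := by
      have : u * (s + 1) * (s + 1) ≤ s * (s + 1) * (s + 1) := by
        gcongr; omega
      have h2 : y * (s + 1) ≤ s * (s + 1) := by gcongr; omega
      calc c ≤ s * (s + 1) * (s + 1) + s * (s + 1) + s := by omega
        _ < (s + 1) ^ 3 := by ring_nf; omega
    have h1 : (i * (s + 1) ^ 3 + c) % (s + 1) ^ 3 = c := by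
      rw [Nat.mul_add_mod_self_right, Nat.mod_eq_of_lt hcs]
    have h2 : (i * (s + 1) ^ 3 + c) / (s + 1) ^ 3 = i := by
      rw [mul_comm, Nat.mul_add_div (by positivity), Nat.div_eq_of_lt hcs, add_zero]
    have h3 : c / (s + 1) = u * (s + 1) + y := by
      rw [hc, show u * (s + 1) * (s + 1) + y * (s + 1) + k = (s + 1) * (u * (s + 1) + y) + k by ring,
        Nat.mul_add_div (by positivity), Nat.div_eq_of_lt (by omega), add_zero]
    have h4 : c % (s + 1) = k := by
      rw [hc, show u * (s + 1) * (s + 1) + y * (s + 1) + k = (u * (s + 1) + y) * (s + 1) + k by ring,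
        Nat.mul_add_mod_self_right, Nat.mod_eq_of_lt (by omega)]
    have h5 : (u * (s + 1) + y) % (s + 1) = y := by
      rw [Nat.mul_add_mod_self_right, Nat.mod_eq_of_lt (by omega)]
    have h6 : (u * (s + 1) + y) / (s + 1) = u := by
      rw [mul_comm, Nat.mul_add_div (by positivity), Nat.div_eq_of_lt (by omega), add_zero]
    refine ⟨i * (s + 1) ^ 3 + c, ?_, ?_⟩
    · calc (i * (s + 1) ^ 3 + c + 1) * (k.choose y * (s - k).choose u)
          ≤ ((F k y u).length * (s + 1) ^ 3) * (k.choose y * (s - k).choose u) := by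
            gcongr
            calc i * (s + 1) ^ 3 + c + 1 ≤ (i + 1) * (s + 1) ^ 3 := by
                  rw [add_one_mul]; omega
              _ ≤ _ := by gcongr; omega
        _ = (s + 1) ^ 3 * ((F k y u).length * (k.choose y * (s - k).choose u)) := by ring
        _ ≤ (s + 1) ^ 3 * ((s + 1) * s.choose (y + u)) := by gcongr
        _ = _ := by ring
    · simp only [h1, h2, h3, h4, h5, h6]
      rw [List.getD_eq_getElem _ _ hi]
      exact ⟨(hF1 k y u _ (List.getElem_mem hi)).2, hyv⟩

/-! ### The code -/

/-- The number obtained by appending the last `c` binary digits of `a`, in the order from the last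
one on, to the digits of `b`. -/
def pushBits : ℕ → ℕ → ℕ → ℕ
  | 0, _, b => b
  | c + 1, a, b => pushBits c (a / 2) (b + b + (a - (a / 2 + a / 2)))

/-- The recursion at the other end, as needed for the invariant of a loop that moves one bit per
pass. -/
theorem pushBits_succ (c a b : ℕ) :
    pushBits (c + 1) a b = pushBits c a b + pushBits c a b + a / 2 ^ c % 2 := by
  induction c generalizing a b with
  | zero => simp only [pushBits, pow_zero, Nat.div_one]; omega
  | succ c ih =>
    rw [pushBits, ih, pushBits, Nat.div_div_eq_div_mul, pow_succ, mul_comm 2]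

theorem pushBits_lt (c a b : ℕ) : pushBits c a b < (b + 1) * 2 ^ c := by
  induction c with
  | zero => simp [pushBits]
  | succ c ih => 
    rw [pushBits_succ, pow_succ, ← mul_assoc]
    have := Nat.mod_lt (a / 2 ^ c) two_pos
    omega

/-- The low digits of `a` are those of `v` in reverse order, and `rest` lies above them. Bounding `a
+ 1` by a multiple of `rest + 1` lets the bounds for concatenated pieces multiply. -/
theorem exists_pushBits_eq (c v rest : ℕ) (hv : v < 2 ^ c) :
    ∃ a, a + 1 ≤ 2 ^ c * (rest + 1) ∧ a / 2 ^ c = rest ∧ ∀ b, pushBits c a b = b * 2 ^ c + v := by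
  induction c generalizing v with
  | zero =>
    exact ⟨rest, by simp, by simp, fun b => by simp only [pushBits]; simp at hv; omega⟩
  | succ c ih =>
    obtain ⟨a, ha1, ha2, ha3⟩ := ih (v % 2 ^ c) (Nat.mod_lt _ (by positivity))
    have hh : v / 2 ^ c < 2 := by
      rw [Nat.div_lt_iff_lt_mul (by positivity)]; rw [pow_succ] at hv; omega
    have hv' := Nat.div_add_mod v (2 ^ c)
    have h1 : (2 * a + v / 2 ^ c) / 2 = a := by
      generalize v / 2 ^ c = h at *; omega
    refine ⟨2 * a + v / 2 ^ c, ?_, ?_, ?_⟩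
    · rw [pow_succ]; nlinarith
    · rw [pow_succ, mul_comm (2 ^ c), ← Nat.div_div_eq_div_mul, h1, ha2]
    · intro b
      rw [pushBits, h1, ha3, pow_succ]
      have : b + b + (2 * a + v / 2 ^ c - (a + a)) = 2 * b + v / 2 ^ c := by omega
      rw [this]
      nlinarith

/-- Read a codeword for a block from the first component, and append the corresponding entry of
the table `A` to the second component. -/
def blockStep (w s A : ℕ) (x : ℕ × ℕ) : ℕ × ℕ :=
  (x.1 / 2 ^ (w + 3) / 2 ^ pushBits (w + 3) x.1 0,
    pushBits s (A / 2 ^ (s * pushBits (pushBits (w + 3) x.1 0) (x.1 / 2 ^ (w + 3)) 0)) x.2)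

/-- The bit mask encoded by `z`, where `A` is the table. -/
def decodeMask (w s n A z : ℕ) : ℕ :=
  pushBits (n % s) ((blockStep w s A)^[n / s] (z, 0)).1 ((blockStep w s A)^[n / s] (z, 0)).2

/-- The bit mask encoded by `z`, which begins with the table. -/
def codeMask (w s tb n z : ℕ) : ℕ := decodeMask w s n (pushBits tb z 0) (z / 2 ^ tb)

/-- Every number decodes to some mask of `n` bits, so malformed codewords need no treatment. -/
theorem codeMask_lt (w s tb n z : ℕ) : codeMask w s tb n z < 2 ^ n := by
  have h : ∀ (A z m : ℕ), ((blockStep w s A)^[m] (z, 0)).2 < 2 ^ (m * s) := by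
    intro A z m
    induction m with
    | zero => simp
    | succ m ih =>
      rw [Function.iterate_succ_apply', blockStep]
      refine (pushBits_lt _ _ _).trans_le ?_
      rw [add_one_mul m, pow_add]
      exact Nat.mul_le_mul_right _ ih
  refine (pushBits_lt _ _ _).trans_le ?_
  calc _ ≤ 2 ^ (n / s * s) * 2 ^ (n % s) := Nat.mul_le_mul_right _ (h _ _ _)
    _ = 2 ^ n := by rw [← pow_add, Nat.div_add_mod']

theorem exists_table_code (s : ℕ) (Q : ℕ) (τ : ℕ → ℕ) (hτ : ∀ q, τ q < 2 ^ s) :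
    ∃ A < 2 ^ (s * Q), ∀ q < Q, ∀ b, pushBits s (A / 2 ^ (s * q)) b = b * 2 ^ s + τ q := by
  induction Q generalizing τ with
  | zero => exact ⟨0, by simp, by simp⟩
  | succ Q ih =>
    obtain ⟨A', hA', h'⟩ := ih (fun q => τ (q + 1)) fun q => hτ _
    obtain ⟨A, hA1, hA2, hA3⟩ := exists_pushBits_eq s (τ 0) A' (hτ 0)
    refine ⟨A, ?_, ?_⟩
    · rw [Nat.mul_succ, pow_add]
      have : 2 ^ s * (A' + 1) ≤ 2 ^ s * 2 ^ (s * Q) := Nat.mul_le_mul_left _ hA'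
      rw [mul_comm (2 ^ (s * Q))]
      omega
    · rintro (_ | q) hq b
      · simpa using hA3 b
      · rw [Nat.mul_succ, add_comm (s * q), pow_add, ← Nat.div_div_eq_div_mul, hA2]
        exact h' q (by omega) b

/-- Some term of Vandermonde's sum is at least the average of the nonzero ones. -/
theorem exists_choose_mul_choose_ge {s a b c : ℕ} (ha : a ≤ s) (hc : c ≤ a + b) :
    ∃ i j, i + j = c ∧ i ≤ a ∧ j ≤ b ∧
      (a + b).choose c ≤ (s + 1) * (a.choose i * b.choose j) := by
  by_contra! hcon
  have h1 : (a + b).choose c = ∑ ij ∈ Finset.HasAntidiagonal.antidiagonal c, a.choose ij.1 * b.choose ij.2 :=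
    Nat.add_choose_eq a b c
  have hpos : 0 < (a + b).choose c := Nat.choose_pos hc
  set A := (Finset.HasAntidiagonal.antidiagonal c).filter fun ij => ij.1 ≤ a ∧ ij.2 ≤ b with hA
  have h2 : (a + b).choose c = ∑ ij ∈ A, a.choose ij.1 * b.choose ij.2 := by
    rw [h1, hA]
    refine (Finset.sum_filter_of_ne fun ij _ hne => ?_).symm
    constructor
    · by_contra! h
      exact hne (by rw [Nat.choose_eq_zero_of_lt h, zero_mul])
    · by_contra! h
      exact hne (by rw [Nat.choose_eq_zero_of_lt h, mul_zero])
  have hcard : A.card ≤ s + 1 := by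
    have : A.card ≤ (Finset.range (s + 1)).card := by
      refine Finset.card_le_card_of_injOn (fun ij => ij.1) ?_ ?_
      · intro ij hij
        simp only [hA, Finset.coe_filter, Finset.HasAntidiagonal.mem_antidiagonal, Set.mem_ofPred_eq] at hij
        simp only [Finset.coe_range, Set.mem_Iio]
        omega
      · rintro ⟨i, j⟩ hij ⟨i', j'⟩ hij' he
        simp only [hA, Finset.coe_filter, Finset.HasAntidiagonal.mem_antidiagonal, Set.mem_ofPred_eq] at hij hij' he
        rw [Prod.mk.injEq]
        omega
    simpa using this
  have hne : A.Nonempty := by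
    by_contra h
    rw [Finset.not_nonempty_iff_eq_empty] at h
    rw [h, Finset.sum_empty] at h2
    omega
  have h3 : (s + 1) * (a + b).choose c < (s + 1) * (a + b).choose c := by
    calc (s + 1) * (a + b).choose c = ∑ ij ∈ A, (s + 1) * (a.choose ij.1 * b.choose ij.2) := by
          rw [← Finset.mul_sum, ← h2]
      _ < ∑ _ij ∈ A, (a + b).choose c := by
          refine Finset.sum_lt_sum_of_nonempty hne fun ij hij => ?_
          simp only [hA, Finset.mem_filter, Finset.HasAntidiagonal.mem_antidiagonal] at hij
          exact hcon ij.1 ij.2 hij.1 hij.2.1 hij.2.2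
      _ = A.card * (a + b).choose c := by rw [Finset.sum_const, smul_eq_mul]
      _ ≤ _ := Nat.mul_le_mul_right _ hcard
  exact lt_irrefl _ h3

theorem choose_mul_choose_le_add (a b i j : ℕ) :
    a.choose i * b.choose j ≤ (a + b).choose (i + j) := by
  rw [Nat.add_choose_eq]
  exact Finset.single_le_sum (f := fun ij : ℕ × ℕ => a.choose ij.1 * b.choose ij.2)
    (fun _ _ => Nat.zero_le _) (Finset.HasAntidiagonal.mem_antidiagonal.2 (rfl : (i, j).1 + (i, j).2 = i + j))

/-- Induction on the number of blocks, splitting off the top block, which is decoded first.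
Distributing `y` and `u` over the block and the rest loses `(s + 1) ^ 2` by Vandermonde, the table
loses `(s + 1) ^ 4`, and the self-delimiting index loses `16 s`; together at most `16 (s + 1) ^ 7`
per block. The fewer than `s` elements left at the end are written out, for a factor `2 ^ s`. -/
theorem exists_decode {w s A : ℕ} (hs : s = 2 ^ w) {τ : ℕ → ℕ} (hτ : ∀ q, τ q < 2 ^ s)
    (hA : ∀ q < 2 ^ (5 * s), ∀ b, pushBits s (A / 2 ^ (s * q)) b = b * 2 ^ s + τ q)
    (htab : ∀ k y u T, T < 2 ^ s → common s T T = k → y ≤ k →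
      u ≤ s - k → ∃ q, (q + 1) * (k.choose y * (s - k).choose u) ≤
        (s + 1) ^ 4 * s.choose (y + u) ∧ common s (τ q) (τ q) = y + u ∧ y ≤ common s T (τ q))
    {r₀ : ℕ} (hr₀ : r₀ < s) (m : ℕ) (k y u T : ℕ) (hT : T < 2 ^ (m * s + r₀))
    (hk : common (m * s + r₀) T T = k) (hy : y ≤ k) (hu : u ≤ m * s + r₀ - k) :
    ∃ z X, (z + 1) * (k.choose y * (m * s + r₀ - k).choose u) ≤
        (m * s + r₀).choose (y + u) * ((16 * (s + 1) ^ 7) ^ m * 2 ^ s) ∧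
      X < 2 ^ (m * s + r₀) ∧ common (m * s + r₀) X X = y + u ∧ y ≤ common (m * s + r₀) T X ∧
      ∀ X₀, pushBits r₀ ((blockStep w s A)^[m] (z, X₀)).1 ((blockStep w s A)^[m] (z, X₀)).2 =
        X₀ * 2 ^ (m * s + r₀) + X := by
  have hs1 : 1 ≤ s := hs ▸ Nat.one_le_two_pow
  induction m generalizing k y u T with
  | zero =>
    rw [zero_mul, zero_add] at *
    have hkr : k ≤ r₀ := hk ▸ common_self_le r₀ T
    have hle : k.choose y * (r₀ - k).choose u ≤ r₀.choose (y + u) := by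
      have := choose_mul_choose_le_add k (r₀ - k) y u
      rwa [Nat.add_sub_cancel' hkr] at this
    obtain ⟨Y, hYT, hY⟩ := Finset.exists_subset_card_eq (s := decode r₀ T) (n := y)
      (by rw [card_decode, hk]; exact hy)
    obtain ⟨Z, hZT, hZ⟩ := Finset.exists_subset_card_eq (s := (decode r₀ T)ᶜ) (n := u)
      (by rw [Finset.card_compl, card_decode, hk, Fintype.card_fin]; exact hu)
    have hdisj : Disjoint Y Z :=
      (Finset.disjoint_left.2 fun x hx hx' => (Finset.mem_compl.1 (hZT hx')) (hYT hx))
    obtain ⟨z, hz1, hz2, hz3⟩ := exists_pushBits_eq r₀ (encode (Y ∪ Z)) 0 (encode_lt _)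
    refine ⟨z, encode (Y ∪ Z), ?_, encode_lt _, ?_, ?_, fun X₀ => hz3 X₀⟩
    · rw [pow_zero, one_mul]
      calc _ ≤ 2 ^ s * r₀.choose (y + u) := by
            refine Nat.mul_le_mul ?_ hle
            rw [zero_add, mul_one] at hz1
            exact hz1.trans (Nat.pow_le_pow_right (by norm_num) hr₀.le)
        _ = _ := mul_comm _ _
    · rw [← card_decode, decode_encode, Finset.card_union_of_disjoint hdisj, hY, hZ]
    · rw [← card_decode_inter, decode_encode, ← hY]
      exact Finset.card_le_card (Finset.subset_inter hYT Finset.subset_union_left)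
  | succ m ih =>
    set R := m * s + r₀ with hR
    have hRs : (m + 1) * s + r₀ = R + s := by rw [hR]; ring
    rw [hRs] at hT hk hu ⊢
    set h := T / 2 ^ R with hh
    set l := T % 2 ^ R with hl
    have hTe : T = h * 2 ^ R + l := (Nat.div_add_mod' T (2 ^ R)).symm
    have hlR : l < 2 ^ R := Nat.mod_lt _ (by positivity)
    have hhs : h < 2 ^ s := by
      rw [hh, Nat.div_lt_iff_lt_mul (by positivity), ← pow_add, add_comm s]; exact hT
    set k1 := common s h h with hk1
    set k2 := common R l l with hk2
    have hk12 : k1 + k2 = k := by rw [← hk, hTe, common_add hlR hlR]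
    have hk1s : k1 ≤ s := common_self_le s h
    have hk2R : k2 ≤ R := common_self_le R l
    obtain ⟨y1, y2, hy12, hy1, hy2, hyle⟩ := exists_choose_mul_choose_ge (b := k2) hk1s
      (show y ≤ k1 + k2 by omega)
    obtain ⟨u1, u2, hu12, hu1, hu2, hule⟩ := exists_choose_mul_choose_ge (s := s) (a := s - k1)
      (b := R - k2) (by omega) (show u ≤ (s - k1) + (R - k2) by omega)
    obtain ⟨q, hq1, hq2, hq3⟩ := htab k1 y1 u1 h hhs rfl hy1 hu1
    obtain ⟨z', X', hz', hX', hXX', hTX', hpush⟩ := ih k2 y2 u2 l hlR rfl hy2 hu2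
    have hN1 : 0 < k1.choose y1 * (s - k1).choose u1 :=
      Nat.mul_pos (Nat.choose_pos hy1) (Nat.choose_pos hu1)
    have hs2 : s + 1 ≤ 2 ^ s := Nat.lt_two_pow_self
    -- The index lies within the part of the table that `A` encodes.
    have hq5 : q + 1 ≤ 2 ^ (5 * s) := by
      calc q + 1 ≤ (q + 1) * (k1.choose y1 * (s - k1).choose u1) := Nat.le_mul_of_pos_right _ hN1
        _ ≤ (s + 1) ^ 4 * s.choose (y1 + u1) := hq1
        _ ≤ (2 ^ s) ^ 4 * 2 ^ s := Nat.mul_le_mul (Nat.pow_le_pow_left hs2 4) (Nat.choose_le_two_pow _ _)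
        _ = 2 ^ (5 * s) := by rw [← pow_mul, ← pow_add]; congr 1; ring
    have hsize1 : Nat.size q ≤ 5 * s := Nat.size_le.2 (by omega)
    -- The length field has `w + 3` bits, enough for the length `5 s < 8 s = 2 ^ (w + 3)`.
    have hsize2 : Nat.size q < 2 ^ (w + 3) := by rw [pow_add, ← hs]; omega
    -- The index is written with variable length: the size of the codeword has to be proportional to
    -- `q + 1`, whereas a fixed length would cost `2 ^ (5 s)` in every block.
    have hsize3 : 2 ^ Nat.size q ≤ 2 * (q + 1) := by
      rcases Nat.eq_zero_or_pos (Nat.size q) with h0 | h0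
      · rw [h0]; omega
      · have := Nat.lt_size.1 (show Nat.size q - 1 < Nat.size q by omega)
        obtain ⟨d, hd⟩ := Nat.exists_eq_add_of_le' h0
        rw [hd] at this ⊢
        rw [pow_succ]
        simp only [Nat.add_sub_cancel] at this
        omega
    obtain ⟨z1, hz11, hz12, hz13⟩ := exists_pushBits_eq (Nat.size q) q z' (Nat.lt_size_self q)
    obtain ⟨z, hz1, hz2, hz3⟩ := exists_pushBits_eq (w + 3) (Nat.size q) z1 hsize2
    have hstep : ∀ X₀, blockStep w s A (z, X₀) = (z', X₀ * 2 ^ s + τ q) := by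
      intro X₀
      simp only [blockStep, hz3, hz2, zero_mul, zero_add, hz12, hz13]
      rw [hA q (by omega)]
    refine ⟨z, τ q * 2 ^ R + X', ?_, ?_, ?_, ?_, ?_⟩
    · have hkey : k.choose y * (R + s - k).choose u ≤
          (s + 1) ^ 2 * ((k1.choose y1 * (s - k1).choose u1) * (k2.choose y2 * (R - k2).choose u2)) := by
        have e1 : R + s - k = (s - k1) + (R - k2) := by omega
        rw [e1, ← hk12]
        calc _ ≤ ((s + 1) * (k1.choose y1 * k2.choose y2)) *
              ((s + 1) * ((s - k1).choose u1 * (R - k2).choose u2)) := Nat.mul_le_mul hyle hule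
          _ = _ := by ring
      have hzz : z + 1 ≤ (16 * s) * (q + 1) * (z' + 1) := by
        calc z + 1 ≤ 2 ^ (w + 3) * (z1 + 1) := hz1
          _ ≤ 2 ^ (w + 3) * (2 ^ Nat.size q * (z' + 1)) := Nat.mul_le_mul_left _ hz11
          _ ≤ 2 ^ (w + 3) * (2 * (q + 1) * (z' + 1)) := by gcongr
          _ = _ := by rw [pow_add, ← hs]; ring
      calc (z + 1) * (k.choose y * (R + s - k).choose u)
          ≤ ((16 * s) * (q + 1) * (z' + 1)) * ((s + 1) ^ 2 *
            ((k1.choose y1 * (s - k1).choose u1) * (k2.choose y2 * (R - k2).choose u2))) :=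
            Nat.mul_le_mul hzz hkey
        _ = 16 * (s * (s + 1) ^ 2) * ((q + 1) * (k1.choose y1 * (s - k1).choose u1)) *
            ((z' + 1) * (k2.choose y2 * (R - k2).choose u2)) := by ring
        _ ≤ 16 * ((s + 1) * (s + 1) ^ 2) * ((s + 1) ^ 4 * s.choose (y1 + u1)) *
            (R.choose (y2 + u2) * ((16 * (s + 1) ^ 7) ^ m * 2 ^ s)) := by gcongr; omega
        _ = (s.choose (y1 + u1) * R.choose (y2 + u2)) * ((16 * (s + 1) ^ 7) ^ (m + 1) * 2 ^ s) := by
            ring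
        _ ≤ (R + s).choose (y + u) * ((16 * (s + 1) ^ 7) ^ (m + 1) * 2 ^ s) := by
            refine Nat.mul_le_mul_right _ ?_
            have := choose_mul_choose_le_add s R (y1 + u1) (y2 + u2)
            rwa [add_comm s R, show y1 + u1 + (y2 + u2) = y + u by omega] at this
    · have h1 : τ q + 1 ≤ 2 ^ s := hτ q
      calc τ q * 2 ^ R + X' < (τ q + 1) * 2 ^ R := by rw [add_one_mul]; omega
        _ ≤ 2 ^ s * 2 ^ R := Nat.mul_le_mul_right _ h1
        _ = 2 ^ (R + s) := by rw [← pow_add, add_comm]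
    · rw [common_add hX' hX', hq2, hXX']; omega
    · rw [hTe, common_add hlR hX']; omega
    · intro X₀
      rw [Function.iterate_succ_apply, hstep, hpush, pow_add]
      ring

/-- The codewords up to the given bound yield a set intersection family. -/
theorem exists_codeMask {w s tb n k t y : ℕ} (hs : s = 2 ^ w) (htb : tb = 2 ^ (6 * s))
    (hyt : y ≤ t) (hyk : y ≤ k) (hkt : k + t ≤ n + y) (T : Finset (Fin n)) (hT : T.card = k) :
    ∃ z : ℕ, (z : ℝ) < kappa n k t y * (2 ^ (tb + s) * (16 * (s + 1) ^ 7) ^ (n / s)) ∧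
      (decode n (codeMask w s tb n z)).card = t ∧
      y ≤ (T ∩ decode n (codeMask w s tb n z)).card := by
  have hs1 : 1 ≤ s := hs ▸ Nat.one_le_two_pow
  have hkn : k ≤ n := by rw [← hT]; simpa using T.card_le_univ
  obtain ⟨τ, hτ, htab⟩ := exists_block_table hs1
  obtain ⟨A, hA1, hA2⟩ := exists_table_code s (2 ^ (5 * s)) τ hτ
  have hn : n / s * s + n % s = n := Nat.div_add_mod' n s
  have hTe : decode n (encode T) = T := decode_encode T
  obtain ⟨z', X, hz', -, hXX, hTX, hpush⟩ := exists_decode hs hτ hA2 htab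
    (Nat.mod_lt n (by omega : 0 < s)) (n / s) k y (t - y) (encode T) (by rw [hn]; exact encode_lt T)
    (by rw [hn, ← card_decode, hTe, hT]) hyk (by rw [hn]; omega)
  rw [hn] at hz' hXX hTX hpush
  -- The table has `s * 2 ^ (5 s)` bits, at most `2 ^ (6 s) = tb`.
  have hAtb : A < 2 ^ tb := by
    refine hA1.trans_le (Nat.pow_le_pow_right (by norm_num) ?_)
    rw [htb, show 6 * s = s + 5 * s by ring, pow_add]
    exact Nat.mul_le_mul_right _ Nat.lt_two_pow_self.le
  obtain ⟨z, hz1, hz2, hz3⟩ := exists_pushBits_eq tb A z' hAtb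
  have hmask : codeMask w s tb n z = X := by
    have := hpush 0
    rw [zero_mul, zero_add] at this
    rw [codeMask, hz3, hz2, zero_mul, zero_add, decodeMask, this]
  refine ⟨z, ?_, ?_, ?_⟩
  · have hN : 0 < k.choose y * (n - k).choose (t - y) :=
      Nat.mul_pos (Nat.choose_pos hyk) (Nat.choose_pos (by omega))
    have hNr : (0 : ℝ) < (k.choose y : ℝ) * ((n - k).choose (t - y) : ℝ) := by exact_mod_cast hN
    rw [kappa, div_mul_eq_mul_div, lt_div_iff₀ hNr]
    have h1 : (z + 1) * (k.choose y * (n - k).choose (t - y)) ≤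
        n.choose t * (2 ^ (tb + s) * (16 * (s + 1) ^ 7) ^ (n / s)) := by
      calc _ ≤ (2 ^ tb * (z' + 1)) * (k.choose y * (n - k).choose (t - y)) :=
            Nat.mul_le_mul_right _ hz1
        _ = 2 ^ tb * ((z' + 1) * (k.choose y * (n - k).choose (t - y))) := by ring
        _ ≤ 2 ^ tb * (n.choose (y + (t - y)) * ((16 * (s + 1) ^ 7) ^ (n / s) * 2 ^ s)) :=
            Nat.mul_le_mul_left _ hz'
        _ = _ := by rw [Nat.add_sub_cancel' hyt, pow_add]; ring
    have h2 : ((z : ℝ) + 1) * ((k.choose y : ℝ) * ((n - k).choose (t - y) : ℝ)) ≤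
        (n.choose t : ℝ) * (2 ^ (tb + s) * (16 * (s + 1) ^ 7) ^ (n / s)) := by exact_mod_cast h1
    linarith
  · rw [hmask, card_decode, hXX]; omega
  · rw [hmask]
    have := card_decode_inter n (encode T) X
    rw [hTe] at this
    rw [this]; exact hTX

/-! ### A program logic for programs without queries and coin flips -/

/-- Started in `σ`, the program `P` halts without queries and coin flips in a state `σ'` after `p`
operations such that `Q σ' p`. -/
def Does {L : Finset (ℝ × ℝ)} (β : ℝ) (P : Prog L) (σ : State) (Q : State → ℕ → Prop) : Prop :=
  ∃ σ' p, (∀ (n : ℕ) (O : L → Oracle n) (ω : ℕ → Bool), Exec β O ω P σ σ' p []) ∧ Q σ' p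

section

variable {L : Finset (ℝ × ℝ)} {β : ℝ} {P P₁ P₂ : Prog L} {σ : State} {Q R : State → ℕ → Prop}

theorem Does.mono (h : Does β P σ Q) (hQR : ∀ σ' p, Q σ' p → R σ' p) : Does β P σ R := by
  obtain ⟨σ', p, he, hq⟩ := h
  exact ⟨σ', p, he, hQR _ _ hq⟩

theorem Does.skip (h : Q σ 1) : Does β (.skip : Prog L) σ Q := ⟨σ, 1, fun _ _ _ => .skip σ, h⟩

theorem Does.setNat {a v : NExp}
    (h : Q ⟨Function.update σ.nat (a.eval σ.nat) (v.eval σ.nat), σ.real, σ.pos⟩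
      (a.ops + v.ops + 1)) : Does β (.setNat a v : Prog L) σ Q :=
  ⟨_, _, fun _ _ _ => .setNat a v σ, h⟩

theorem Does.setReal {a : NExp} {v : RExp L}
    (h : Q ⟨σ.nat, Function.update σ.real (a.eval σ.nat) (v.eval β σ.nat σ.real), σ.pos⟩
      (a.ops + v.ops + 1)) : Does β (.setReal a v : Prog L) σ Q :=
  ⟨_, _, fun _ _ _ => .setReal a v σ, h⟩

theorem Does.seq (h : Does β P₁ σ fun σ₁ p => Does β P₂ σ₁ fun σ₂ q => Q σ₂ (p + q)) :
    Does β (.seq P₁ P₂) σ Q := by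
  obtain ⟨σ₁, p, h₁, σ₂, q, h₂, hq⟩ := h
  exact ⟨σ₂, p + q, fun n O ω => .seq (h₁ n O ω) (h₂ n O ω), hq⟩

theorem Does.ite {b : BExp L} (h₁ : b.Holds β σ.nat σ.real → Does β P₁ σ fun σ' p => Q σ' (b.ops + p))
    (h₂ : ¬ b.Holds β σ.nat σ.real → Does β P₂ σ fun σ' p => Q σ' (b.ops + p)) :
    Does β (.ite b P₁ P₂) σ Q := by
  by_cases hb : b.Holds β σ.nat σ.real
  · obtain ⟨σ', p, he, hq⟩ := h₁ hb
    exact ⟨σ', _, fun n O ω => .iteTrue hb (he n O ω), hq⟩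
  · obtain ⟨σ', p, he, hq⟩ := h₂ hb
    exact ⟨σ', _, fun n O ω => .iteFalse hb (he n O ω), hq⟩

/-- The invariant is indexed by the number of completed passes, which yields termination and the
bound on the operations at the same time. -/
theorem Does.loop {b : BExp L} (I : ℕ → State → Prop) (N c : ℕ) (h0 : I 0 σ)
    (hstep : ∀ i < N, ∀ τ, I i τ → b.Holds β τ.nat τ.real ∧
      Does β P τ fun τ' p => p ≤ c ∧ I (i + 1) τ')
    (hend : ∀ τ, I N τ → ¬ b.Holds β τ.nat τ.real)
    (hQ : ∀ τ p, I N τ → p ≤ N * (b.ops + c) + b.ops → Q τ p) : Does β (.loop b P) σ Q := by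
  suffices h : ∀ m i τ, i + m = N → I i τ →
      Does β (.loop b P) τ fun τ' p => I N τ' ∧ p ≤ m * (b.ops + c) + b.ops from
    (h N 0 σ (by omega) h0).mono fun τ p hp => hQ τ p hp.1 hp.2
  intro m
  induction m with
  | zero =>
    intro i τ hi hI
    obtain rfl : i = N := by omega
    exact ⟨τ, _, fun _ _ _ => .loopDone (hend τ hI), hI, by omega⟩
  | succ m ih =>
    intro i τ hi hI
    obtain ⟨hb, τ₁, p, he, hpc, hI'⟩ := hstep i (by omega) τ hI
    obtain ⟨τ₂, q, he', hI'', hq⟩ := ih (i + 1) τ₁ (by omega) hI'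
    refine ⟨τ₂, b.ops + p + q, fun n O ω => .loopStep hb (he n O ω) (he' n O ω), hI'', ?_⟩
    rw [add_one_mul]
    omega

end

/-- The states differ at most in the cells `S` for natural numbers and `R` for real numbers. -/
structure Frame (S R : List ℕ) (σ σ' : State) : Prop where
  nat : ∀ x, x ∉ S → σ'.nat x = σ.nat x
  real : ∀ x, x ∉ R → σ'.real x = σ.real x

theorem Frame.refl (S R : List ℕ) (σ : State) : Frame S R σ σ := ⟨fun _ _ => rfl, fun _ _ => rfl⟩

theorem Frame.trans {S R S' R' : List ℕ} {σ σ' σ'' : State} (h : Frame S R σ σ')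
    (h' : Frame S' R' σ' σ'') (hS : S' ⊆ S := by decide) (hR : R' ⊆ R := by decide) :
    Frame S R σ σ'' :=
  ⟨fun x hx => (h'.nat x fun h => hx (hS h)).trans (h.nat x hx),
    fun x hx => (h'.real x fun h => hx (hR h)).trans (h.real x hx)⟩

theorem Frame.mono {S R S' R' : List ℕ} {σ σ' : State} (h : Frame S' R' σ σ')
    (hS : S' ⊆ S := by decide) (hR : R' ⊆ R := by decide) : Frame S R σ σ' :=
  (Frame.refl S R σ).trans h hS hR

theorem Frame.setNat {S R : List ℕ} {σ σ' : State} (h : Frame S R σ σ') {a : ℕ} (v : ℕ)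
    (ha : a ∈ S := by decide) : Frame S R σ ⟨Function.update σ'.nat a v, σ'.real, σ'.pos⟩ :=
  ⟨fun x hx => by
    rw [← h.nat x hx]; exact Function.update_of_ne (by rintro rfl; exact hx ha) _ _, h.real⟩

theorem Frame.setReal {S R : List ℕ} {σ σ' : State} (h : Frame S R σ σ') {a : ℕ} (v : ℝ)
    (ha : a ∈ R := by decide) : Frame S R σ ⟨σ'.nat, Function.update σ'.real a v, σ'.pos⟩ :=
  ⟨h.nat, fun x hx => by
    rw [← h.real x hx]; exact Function.update_of_ne (by rintro rfl; exact hx ha) _ _⟩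

/-- The content of the cell `i`. -/
abbrev NExp.var (i : ℕ) : NExp := .load (.const i)

abbrev RExp.var {L : Finset (ℝ × ℝ)} (i : ℕ) : RExp L := .load (.const i)

/-- Assignment to the cell `i`. -/
abbrev Prog.assign {L : Finset (ℝ × ℝ)} (i : ℕ) (v : NExp) : Prog L := .setNat (.const i) v

abbrev Prog.assignReal {L : Finset (ℝ × ℝ)} (i : ℕ) (v : RExp L) : Prog L := .setReal (.const i) v

theorem Does.assign {L : Finset (ℝ × ℝ)} {β : ℝ} {σ : State} {Q : State → ℕ → Prop} {i : ℕ}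
    {v : NExp} (h : Q ⟨Function.update σ.nat i (v.eval σ.nat), σ.real, σ.pos⟩ (1 + v.ops + 1)) :
    Does β (.assign i v : Prog L) σ Q := Does.setNat h

theorem Does.assignReal {L : Finset (ℝ × ℝ)} {β : ℝ} {σ : State} {Q : State → ℕ → Prop} {i : ℕ}
    {v : RExp L}
    (h : Q ⟨σ.nat, Function.update σ.real i (v.eval β σ.nat σ.real), σ.pos⟩ (1 + v.ops + 1)) :
    Does β (.assignReal i v : Prog L) σ Q := Does.setReal h

attribute [simp] NExp.eval NExp.ops RExp.eval RExp.ops BExp.Holds BExp.ops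

/-- `i` is positive -/
abbrev BExp.pos {L : Finset (ℝ × ℝ)} (i : ℕ) : BExp L := .natLe (.const 1) (.var i)

/-! ### Moving bits -/

/-- Move as many bits as cell `i` says from cell `a` to cell `b`. -/
def moveBits (L : Finset (ℝ × ℝ)) (a b i : ℕ) : Prog L :=
  .loop (.pos i)
    (.seq (.assign b (.add (.add (.var b) (.var b))
      (.sub (.var a) (.add (.half (.var a)) (.half (.var a))))))
    (.seq (.assign a (.half (.var a)))
    (.assign i (.sub (.var i) (.const 1)))))

theorem does_moveBits {L : Finset (ℝ × ℝ)} {β : ℝ} {a b i : ℕ} (σ : State) (hab : a ≠ b) (hai : a ≠ i)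
    (hbi : b ≠ i) : Does β (moveBits L a b i) σ fun σ' p =>
      p ≤ 40 * σ.nat i + 10 ∧ σ'.nat a = σ.nat a / 2 ^ σ.nat i ∧
      σ'.nat b = pushBits (σ.nat i) (σ.nat a) (σ.nat b) ∧ Frame [a, b, i] [] σ σ' := by
  refine Does.loop (fun m τ => τ.nat a = σ.nat a / 2 ^ m ∧
    τ.nat b = pushBits m (σ.nat a) (σ.nat b) ∧ τ.nat i + m = σ.nat i ∧ Frame [a, b, i] [] σ τ)
    (σ.nat i) 30 ⟨by simp, rfl, by simp, Frame.refl _ _ _⟩ ?_ ?_ ?_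
  · rintro m hm τ ⟨h1, h2, h3, h4⟩
    refine ⟨by simp [BExp.Holds, NExp.eval]; omega, ?_⟩
    refine Does.seq (Does.assign (Does.seq (Does.assign (Does.assign ?_))))
    refine ⟨by simp, ?_, ?_, ?_, ?_⟩
    · simp [Function.update_apply, hab, hai, h1, Nat.div_div_eq_div_mul, pow_succ]
    · simp [Function.update_apply, hab.symm, hbi, pushBits_succ, h1, h2]; omega
    · simp [Function.update_apply, hbi.symm, hai.symm]; omega
    · exact ((h4.setNat _ (by simp)).setNat _ (by simp)).setNat _ (by simp)
  · rintro τ ⟨h1, h2, h3, h4⟩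
    simp [BExp.Holds, NExp.eval]; omega
  · rintro τ p ⟨h1, h2, h3, h4⟩ hp
    refine ⟨hp.trans ?_, h1, h2, h4⟩
    simp [BExp.ops, NExp.ops]; omega

/-! ### Decoding -/

/-- Drop `s * idx` bits of cell `21`, where `s` and `idx` are the contents of cells `3` and
`20`. -/
def dropBits (L : Finset (ℝ × ℝ)) : Prog L :=
  .loop (.pos 20)
    (.seq (.assign 23 (.var 3))
    (.seq (moveBits L 21 22 23)
    (.assign 20 (.sub (.var 20) (.const 1)))))

theorem does_dropBits {L : Finset (ℝ × ℝ)} {β : ℝ} (σ : State) :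
    Does β (dropBits L) σ fun σ' p => p ≤ σ.nat 20 * (40 * σ.nat 3 + 50) + 10 ∧
      σ'.nat 21 = σ.nat 21 / 2 ^ (σ.nat 3 * σ.nat 20) ∧ Frame [20, 21, 22, 23] [] σ σ' := by
  refine Does.loop (fun m τ => τ.nat 21 = σ.nat 21 / 2 ^ (σ.nat 3 * m) ∧
    τ.nat 20 + m = σ.nat 20 ∧ Frame [20, 21, 22, 23] [] σ τ) (σ.nat 20) (40 * σ.nat 3 + 40)
    ⟨by simp, by simp, Frame.refl _ _ _⟩ ?_ ?_ ?_
  · rintro m hm τ ⟨h1, h2, h3⟩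
    refine ⟨by simp [BExp.Holds, NExp.eval]; omega, ?_⟩
    refine Does.seq (Does.assign (Does.seq
      ((does_moveBits _ (by decide) (by decide) (by decide)).mono ?_)))
    rintro τ₁ p ⟨hp, ha, -, hf⟩
    refine Does.assign ?_
    have h20 := hf.nat 20 (by decide)
    have h3' := h3.nat 3 (by decide)
    simp at ha h20 hp
    refine ⟨?_, ?_, ?_, ?_⟩
    · simp only [NExp.ops]; omega
    · simp only [NExp.eval]
      rw [Function.update_of_ne (by decide), ha, h1, h3', Nat.div_div_eq_div_mul, ← pow_add,
        Nat.mul_succ]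
    · simp only [NExp.eval, Function.update_self]
      omega
    · exact ((h3.setNat _).trans hf).setNat _
  · rintro τ ⟨h1, h2, h3⟩
    simp [BExp.Holds, NExp.eval]; omega
  · rintro τ p ⟨h1, h2, h3⟩ hp
    have : τ.nat 20 = 0 := by omega
    refine ⟨hp.trans ?_, h1, h3⟩
    simp only [BExp.ops, NExp.ops]
    have : 1 + (1 + 1) + 1 + (40 * σ.nat 3 + 40) ≤ 40 * σ.nat 3 + 50 := by omega
    have := Nat.mul_le_mul_left (σ.nat 20) this
    omega

/-- Cells `2` and `3` hold `w` and `s`, cell `15` the unread part of the codeword, cell `16` the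
table, cell `17` the mask built so far, cell `18` the number of elements still missing. The length
and the index of the entry go to cells `19` and `20`. -/
def decodeBlock (L : Finset (ℝ × ℝ)) : Prog L :=
  .seq (.assign 19 (.const 0))
  (.seq (.assign 23 (.add (.var 2) (.const 3)))
  (.seq (moveBits L 15 19 23)
  (.seq (.assign 20 (.const 0))
  (.seq (.assign 23 (.var 19))
  (.seq (moveBits L 15 20 23)
  (.seq (.assign 21 (.var 16))
  (.seq (dropBits L)
  (.seq (.assign 23 (.var 3))
  (.seq (moveBits L 21 17 23)
  (.assign 18 (.sub (.var 18) (.var 3))))))))))))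

theorem does_decodeBlock {L : Finset (ℝ × ℝ)} {β : ℝ} (σ : State)
    (hs : σ.nat 3 = 2 ^ σ.nat 2) :
    Does β (decodeBlock L) σ fun σ' p => p ≤ 1000 * 2 ^ (16 * σ.nat 3) ∧
      (σ'.nat 15, σ'.nat 17) =
        blockStep (σ.nat 2) (σ.nat 3) (σ.nat 16) (σ.nat 15, σ.nat 17) ∧
      σ'.nat 18 = σ.nat 18 - σ.nat 3 ∧ Frame [15, 17, 18, 19, 20, 21, 22, 23] [] σ σ' := by
  refine Does.seq (Does.assign (Does.seq (Does.assign (Does.seq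
    ((does_moveBits _ (by decide) (by decide) (by decide)).mono ?_)))))
  rintro τ₁ p₁ ⟨hp₁, ha₁, hb₁, hf₁⟩
  simp at hp₁ ha₁ hb₁ hf₁
  refine Does.seq (Does.assign (Does.seq (Does.assign (Does.seq
    ((does_moveBits _ (by decide) (by decide) (by decide)).mono ?_)))))
  rintro τ₂ p₂ ⟨hp₂, ha₂, hb₂, hf₂⟩
  simp at hp₂ ha₂ hb₂ hf₂
  refine Does.seq (Does.assign (Does.seq ((does_dropBits _).mono ?_)))
  rintro τ₃ p₃ ⟨hp₃, ha₃, hf₃⟩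
  simp at hp₃ ha₃ hf₃
  refine Does.seq (Does.assign (Does.seq
    ((does_moveBits _ (by decide) (by decide) (by decide)).mono ?_)))
  rintro τ₄ p₄ ⟨hp₄, ha₄, hb₄, hf₄⟩
  simp at hp₄ ha₄ hb₄ hf₄
  refine Does.assign ?_
  have F₁ : Frame [15, 17, 18, 19, 20, 21, 22, 23] [] σ τ₁ :=
    (((Frame.refl _ _ σ).setNat _).setNat _).trans hf₁
  have F₂ : Frame [15, 17, 18, 19, 20, 21, 22, 23] [] σ τ₂ :=
    ((F₁.setNat _).setNat _).trans hf₂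
  have F₃ : Frame [15, 17, 18, 19, 20, 21, 22, 23] [] σ τ₃ := (F₂.setNat _).trans hf₃
  have F₄ : Frame [15, 17, 18, 19, 20, 21, 22, 23] [] σ τ₄ := (F₃.setNat _).trans hf₄
  have e₁ := F₁.nat 3 (by decide)
  have e₂ := F₂.nat 3 (by decide)
  have e₃ := F₃.nat 3 (by decide)
  have e₄ := F₄.nat 3 (by decide)
  have e₅ := F₂.nat 16 (by decide)
  have g₁ := hf₂.nat 19 (by decide)
  have g₃ := hf₃.nat 17 (by decide)
  have g₂ := hf₂.nat 17 (by decide)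
  have g₁' := hf₁.nat 17 (by decide)
  have g₄ := hf₃.nat 15 (by decide)
  have g₅ := hf₄.nat 15 (by decide)
  have g₆ := F₄.nat 18
  have k₁ := hf₁.nat 18 (by decide)
  have k₂ := hf₂.nat 18 (by decide)
  have k₃ := hf₃.nat 18 (by decide)
  have k₄ := hf₄.nat 18 (by decide)
  simp only [ne_eq, not_false_eq_true, Function.update_of_ne, Nat.reduceEqDiff] at g₁ g₂ g₃ g₄ g₅ k₁ k₂ k₃ k₄ g₁'
  set e := pushBits (σ.nat 2 + 3) (σ.nat 15) 0 with he
  set q := pushBits e (σ.nat 15 / 2 ^ (σ.nat 2 + 3)) 0 with hq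
  have hτe : τ₁.nat 19 = e := hb₁
  have hτq : τ₂.nat 20 = q := by rw [hb₂, hτe, ha₁]
  refine ⟨?_, ?_, ?_, ?_⟩
  · have h1 : e < 2 ^ (σ.nat 2 + 3) := by simpa using pushBits_lt (σ.nat 2 + 3) (σ.nat 15) 0
    have h2 : q < 2 ^ e := by simpa using pushBits_lt e (σ.nat 15 / 2 ^ (σ.nat 2 + 3)) 0
    have h3 : σ.nat 2 < σ.nat 3 := hs ▸ Nat.lt_two_pow_self
    rw [pow_add, ← hs] at h1
    -- The index has fewer than `8 s` bits, so skipping the entries before it takes at most `2 ^ (8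
    -- s)` passes of `O(s)` operations. This is polynomial in `n` by the choice of `s`.
    set G := 2 ^ (8 * σ.nat 3) with hG
    have h4 : 8 * σ.nat 3 < G := Nat.lt_two_pow_self
    have h5 : q ≤ G := h2.le.trans (Nat.pow_le_pow_right (by norm_num) (by omega))
    have h6 : q * (40 * σ.nat 3 + 50) ≤ G * (90 * G) := Nat.mul_le_mul h5 (by omega)
    have h7 : 2 ^ (16 * σ.nat 3) = G * G := by rw [hG, ← pow_add]; congr 1; ring
    have h8 : G ≤ G * G := Nat.le_mul_of_pos_left _ (by omega)
    rw [hτe] at hp₂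
    rw [hτq, e₂] at hp₃
    rw [e₃] at hp₄
    rw [h7]
    have h9 : G * (90 * G) = 90 * (G * G) := by ring
    simp
    omega
  · rw [blockStep]
    simp only [NExp.eval, ne_eq, Nat.reduceEqDiff, not_false_eq_true, Function.update_of_ne,
      Prod.mk.injEq]
    constructor
    · rw [g₅, g₄, ha₂, hτe, ha₁]
    · rw [hb₄, ha₃, hτq, g₃, g₂, g₁', e₃, e₂, F₂.nat 16 (by decide)]
  · simp only [NExp.eval, Function.update_self]
    rw [k₄, k₃, k₂, k₁, e₄]
  · exact F₄.setNat _

/-- Decode the codeword in cell `15` to the bit mask in cell `17`. -/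
def decodeProg (L : Finset (ℝ × ℝ)) : Prog L :=
  .seq (.assign 16 (.const 0))
  (.seq (.assign 23 (.var 4))
  (.seq (moveBits L 15 16 23)
  (.seq (.assign 17 (.const 0))
  (.seq (.assign 18 (.var 0))
  (.seq (.loop (.natLe (.var 3) (.var 18)) (decodeBlock L))
  (.seq (.assign 23 (.var 18))
  (moveBits L 15 17 23)))))))

theorem does_decodeProg {L : Finset (ℝ × ℝ)} {β : ℝ} (σ : State) (hs : σ.nat 3 = 2 ^ σ.nat 2) :
    Does β (decodeProg L) σ fun σ' p =>
      p ≤ 2000 * (σ.nat 4 + (σ.nat 0 + 1) * 2 ^ (16 * σ.nat 3)) ∧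
      σ'.nat 17 = codeMask (σ.nat 2) (σ.nat 3) (σ.nat 4) (σ.nat 0) (σ.nat 15) ∧
      Frame [15, 16, 17, 18, 19, 20, 21, 22, 23] [] σ σ' := by
  have hs0 : 0 < σ.nat 3 := by rw [hs]; positivity
  refine Does.seq (Does.assign (Does.seq (Does.assign (Does.seq
    ((does_moveBits _ (by decide) (by decide) (by decide)).mono ?_)))))
  rintro τ₁ p₁ ⟨hp₁, ha₁, hb₁, hf₁⟩
  simp at hp₁ ha₁ hb₁ hf₁
  refine Does.seq (Does.assign (Does.seq (Does.assign (Does.seq ?_))))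
  have F₁ : Frame [15, 16, 17, 18, 19, 20, 21, 22, 23] [] σ τ₁ :=
    (((Frame.refl _ _ σ).setNat _).setNat _).trans hf₁
  refine Does.loop (fun m τ => (τ.nat 15, τ.nat 17) =
      (blockStep (σ.nat 2) (σ.nat 3) (τ₁.nat 16))^[m] (τ₁.nat 15, 0) ∧
      τ.nat 18 = σ.nat 0 - m * σ.nat 3 ∧ τ.nat 16 = τ₁.nat 16 ∧
      Frame [15, 16, 17, 18, 19, 20, 21, 22, 23] [] σ τ) (σ.nat 0 / σ.nat 3)
    (1000 * 2 ^ (16 * σ.nat 3)) ?_ ?_ ?_ ?_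
  · refine ⟨by simp, ?_, by simp, (F₁.setNat _).setNat _⟩
    have := F₁.nat 0 (by decide)
    simpa using this
  · rintro m hm τ ⟨h1, h2, h3, h4⟩
    have hle : (m + 1) * σ.nat 3 ≤ σ.nat 0 :=
      (Nat.mul_le_mul_right _ hm).trans (Nat.div_mul_le_self _ _)
    rw [add_one_mul] at hle
    have e2 := h4.nat 2 (by decide)
    have e3 := h4.nat 3 (by decide)
    refine ⟨by simp; omega, (does_decodeBlock τ (by rw [e2, e3, hs])).mono ?_⟩
    rintro τ' p ⟨hp, hpair, h18, hf⟩
    rw [e2, e3, h3, h1] at hpair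
    refine ⟨by rwa [e3] at hp, ?_, ?_, ?_, h4.trans hf⟩
    · rw [hpair, Function.iterate_succ_apply']
    · rw [h18, h2, e3, add_one_mul]; omega
    · rw [hf.nat 16 (by decide), h3]
  · rintro τ ⟨h1, h2, h3, h4⟩
    have e3 := h4.nat 3 (by decide)
    have := Nat.mod_lt (σ.nat 0) hs0
    have := Nat.div_add_mod' (σ.nat 0) (σ.nat 3)
    simp; omega
  · rintro τ p ⟨h1, h2, h3, h4⟩ hp
    refine Does.seq (Does.assign ((does_moveBits _ (by decide) (by decide) (by decide)).mono ?_))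
    rintro τ₂ p₂ ⟨hp₂, ha₂, hb₂, hf₂⟩
    simp at hp₂ ha₂ hb₂ hf₂
    have hmod : σ.nat 0 - σ.nat 0 / σ.nat 3 * σ.nat 3 = σ.nat 0 % σ.nat 3 := by
      have := Nat.div_add_mod' (σ.nat 0) (σ.nat 3); omega
    rw [hmod] at h2
    refine ⟨?_, ?_, (h4.setNat _).trans hf₂⟩
    · have h5 : σ.nat 0 / σ.nat 3 ≤ σ.nat 0 := Nat.div_le_self _ _
      have h6 : σ.nat 0 % σ.nat 3 ≤ σ.nat 0 := Nat.mod_le _ _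
      have h7 : 0 < 2 ^ (16 * σ.nat 3) := by positivity
      simp at hp ⊢
      set G := 2 ^ (16 * σ.nat 3)
      have h8 : σ.nat 0 / σ.nat 3 * (5 + 1000 * G) ≤ σ.nat 0 * (1005 * G) :=
        Nat.mul_le_mul h5 (by omega)
      have h9 : σ.nat 0 * (1005 * G) = 1005 * (σ.nat 0 * G) := by ring
      have h10 : σ.nat 0 ≤ σ.nat 0 * G := Nat.le_mul_of_pos_right _ h7
      rw [add_one_mul]
      omega
    · rw [hb₂, h2, codeMask, decodeMask]
      have e1 := congrArg Prod.fst h1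
      have e2 := congrArg Prod.snd h1
      simp only at e1 e2
      rw [e1, e2, hb₁, ha₁]

/-! ### Unions -/

/-- Compute the union of the sets in cells `28` and `29`, and its size, in cells `26` and `25`. -/
def unionProg (L : Finset (ℝ × ℝ)) : Prog L :=
  .seq (.assign 26 (.const 0))
  (.seq (.assign 27 (.const 1))
  (.seq (.assign 25 (.const 0))
  (.seq (.assign 36 (.var 0))
  (.loop (.pos 36)
    (.seq (.ite (.natLe (.const 1) (.add (.sub (.var 28) (.add (.half (.var 28)) (.half (.var 28))))
        (.sub (.var 29) (.add (.half (.var 29)) (.half (.var 29))))))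
      (.seq (.assign 26 (.add (.var 26) (.var 27))) (.assign 25 (.add (.var 25) (.const 1))))
      .skip)
    (.seq (.assign 27 (.add (.var 27) (.var 27)))
    (.seq (.assign 28 (.half (.var 28)))
    (.seq (.assign 29 (.half (.var 29)))
    (.assign 36 (.sub (.var 36) (.const 1)))))))))))

theorem does_unionProg {L : Finset (ℝ × ℝ)} {β : ℝ} (σ : State) :
    Does β (unionProg L) σ fun σ' p => p ≤ 100 * (σ.nat 0 + 1) ∧
      decode (σ.nat 0) (σ'.nat 26) =
        decode (σ.nat 0) (σ.nat 28) ∪ decode (σ.nat 0) (σ.nat 29) ∧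
      σ'.nat 25 = (decode (σ.nat 0) (σ.nat 28) ∪ decode (σ.nat 0) (σ.nat 29)).card ∧
      Frame [25, 26, 27, 28, 29, 36] [] σ σ' := by
  set A : ℕ → Finset ℕ := fun m => (Finset.range m).filter fun i =>
    (σ.nat 28).testBit i = true ∨ (σ.nat 29).testBit i = true with hA
  refine Does.seq (Does.assign (Does.seq (Does.assign (Does.seq (Does.assign
    (Does.seq (Does.assign ?_)))))))
  refine Does.loop (fun m τ => τ.nat 26 = ∑ i ∈ A m, 2 ^ i ∧ τ.nat 25 = (A m).card ∧
    τ.nat 27 = 2 ^ m ∧ τ.nat 28 = σ.nat 28 / 2 ^ m ∧ τ.nat 29 = σ.nat 29 / 2 ^ m ∧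
    τ.nat 36 + m = σ.nat 0 ∧ Frame [25, 26, 27, 28, 29, 36] [] σ τ) (σ.nat 0) 80 ?_ ?_ ?_ ?_
  · refine ⟨by simp [hA], by simp [hA], by simp, by simp, by simp, by simp, ?_⟩
    exact ((((Frame.refl _ _ σ).setNat _).setNat _).setNat _).setNat _
  · rintro m hm τ ⟨h1, h2, h3, h4, h5, h6, h7⟩
    refine ⟨by simp; omega, Does.seq ?_⟩
    have key : (1 ≤ τ.nat 28 - (τ.nat 28 / 2 + τ.nat 28 / 2) +
        (τ.nat 29 - (τ.nat 29 / 2 + τ.nat 29 / 2))) ↔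
        ((σ.nat 28).testBit m = true ∨ (σ.nat 29).testBit m = true) := by
      rw [Nat.testBit_eq_decide_div_mod_eq, Nat.testBit_eq_decide_div_mod_eq, ← h4, ← h5]
      simp only [decide_eq_true_eq]
      omega
    refine Does.ite ?_ ?_
    · intro hb
      simp at hb
      have hAm : A (m + 1) = insert m (A m) := by
        simp only [hA, Finset.range_add_one]
        rw [Finset.filter_insert, if_pos (key.1 (by omega))]
      have hmA : m ∉ A m := by simp [hA]
      refine Does.seq (Does.assign (Does.assign (Does.seq (Does.assign (Does.seq (Does.assign
        (Does.seq (Does.assign (Does.assign ?_)))))))))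
      refine ⟨by simp, ?_, ?_, ?_, ?_, ?_, ?_, ?_⟩
      · rw [hAm, Finset.sum_insert hmA]; simp [h1, h3]; omega
      · rw [hAm, Finset.card_insert_of_notMem hmA]; simp [h2]
      · simp [h3, pow_succ]; omega
      · simp [h4, Nat.div_div_eq_div_mul, pow_succ]
      · simp [h5, Nat.div_div_eq_div_mul, pow_succ]
      · simp; omega
      · exact (((((h7.setNat _).setNat _).setNat _).setNat _).setNat _).setNat _
    · intro hb
      simp at hb
      have hAm : A (m + 1) = A m := by
        simp only [hA, Finset.range_add_one]
        rw [Finset.filter_insert, if_neg fun h => by have := key.2 h; omega]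
      refine Does.skip (Does.seq (Does.assign (Does.seq (Does.assign
        (Does.seq (Does.assign (Does.assign ?_)))))))
      refine ⟨by simp, ?_, ?_, ?_, ?_, ?_, ?_, ?_⟩
      · rw [hAm]; simp [h1]
      · rw [hAm]; simp [h2]
      · simp [h3, pow_succ]; omega
      · simp [h4, Nat.div_div_eq_div_mul, pow_succ]
      · simp [h5, Nat.div_div_eq_div_mul, pow_succ]
      · simp; omega
      · exact (((h7.setNat _).setNat _).setNat _).setNat _
  · rintro τ ⟨h1, h2, h3, h4, h5, h6, h7⟩
    simp; omega
  · rintro τ p ⟨h1, h2, h3, h4, h5, h6, h7⟩ hp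
    have hmem : ∀ i : Fin (σ.nat 0), i ∈ decode (σ.nat 0) (τ.nat 26) ↔ (i : ℕ) ∈ A (σ.nat 0) := by
      intro i
      simp only [decode, Finset.mem_filter, Finset.mem_univ, true_and]
      rw [h1, ← Nat.mem_bitIndices, ← List.mem_toFinset, Finset.toFinset_bitIndices_sum_two_pow]
    have hun : decode (σ.nat 0) (τ.nat 26) =
        decode (σ.nat 0) (σ.nat 28) ∪ decode (σ.nat 0) (σ.nat 29) := by
      ext i
      rw [hmem]
      simp [hA, decode]
    refine ⟨?_, hun, ?_, h7⟩
    · simp at hp ⊢; omega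
    · rw [h2, ← hun, ← Finset.card_map Fin.valEmbedding]
      congr 1
      ext i
      simp only [Finset.mem_map, Fin.valEmbedding_apply]
      constructor
      · intro hi
        have : i < σ.nat 0 := by
          have := (Finset.mem_filter.1 hi).1
          simpa using this
        exact ⟨⟨i, this⟩, (hmem ⟨i, this⟩).2 hi, rfl⟩
      · rintro ⟨j, hj, rfl⟩
        exact (hmem j).1 hj

/-! ### Binomial coefficients and hypergeometric sums -/

/-- Compute the binomial coefficient of cells `30` and `31` in the real cell `d`. -/
def chooseProg (L : Finset (ℝ × ℝ)) (d : ℕ) : Prog L :=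
  .seq (.assignReal d (.cast (.const 1)))
  (.seq (.assign 32 (.const 0))
  (.loop (.natLe (.add (.var 32) (.const 1)) (.var 31))
    (.seq (.assignReal d (.mul (.var d) (.div (.sub (.cast (.var 30)) (.cast (.var 32)))
      (.cast (.add (.var 32) (.const 1))))))
    (.assign 32 (.add (.var 32) (.const 1))))))

theorem does_chooseProg {L : Finset (ℝ × ℝ)} {β : ℝ} (d : ℕ) (σ : State) :
    Does β (chooseProg L d) σ fun σ' p => p ≤ 50 * (σ.nat 31 + 1) ∧
      σ'.real d = (σ.nat 30).choose (σ.nat 31) ∧ Frame [32] [d] σ σ' := by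
  refine Does.seq (Does.assignReal (Does.seq (Does.assign ?_)))
  refine Does.loop (fun m τ => τ.real d = (σ.nat 30).choose m ∧ τ.nat 32 = m ∧ Frame [32] [d] σ τ)
    (σ.nat 31) 40 ?_ ?_ ?_ ?_
  · exact ⟨by simp, by simp, ((Frame.refl _ _ σ).setReal _ (by simp)).setNat _⟩
  · rintro m hm τ ⟨h1, h2, h3⟩
    have e1 := h3.nat 30 (by decide)
    have e2 := h3.nat 31 (by decide)
    refine ⟨by simp; omega, Does.seq (Does.assignReal (Does.assign ?_))⟩
    refine ⟨by simp, ?_, by simp [h2], (h3.setReal _ (by simp)).setNat _⟩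
    simp only [RExp.eval, NExp.eval, Function.update_self, h1, h2, e1]
    -- Past `m = n` both sides are zero, so the product is correct for all arguments and no case
    -- distinction is programmed.
    have h4 : ((σ.nat 30).choose (m + 1) : ℝ) * (m + 1) =
        (σ.nat 30).choose m * ((σ.nat 30 : ℝ) - m) := by
      rcases le_or_gt m (σ.nat 30) with h | h
      · rw [← Nat.cast_sub h]
        exact_mod_cast Nat.choose_succ_right_eq (σ.nat 30) m
      · rw [Nat.choose_eq_zero_of_lt h, Nat.choose_eq_zero_of_lt (by omega)]
        simp
    have h5 : ((m : ℝ) + 1) ≠ 0 := by positivity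
    push_cast
    rw [← mul_div_assoc, eq_comm, eq_div_iff h5, h4]
  · rintro τ ⟨h1, h2, h3⟩
    have e2 := h3.nat 31 (by decide)
    simp; omega
  · rintro τ p ⟨h1, h2, h3⟩ hp
    refine ⟨?_, h1, h3⟩
    simp at hp ⊢; omega

/-- Compute the factors of the terms of the hypergeometric sum. -/
def termProg (L : Finset (ℝ × ℝ)) : Prog L :=
  .seq (.assign 30 (.var 5)) (.seq (.assign 31 (.var 9)) (.seq (chooseProg L 1)
  (.seq (.assign 30 (.sub (.var 0) (.var 5))) (.seq (.assign 31 (.sub (.var 8) (.var 9)))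
  (.seq (chooseProg L 2)
  (.seq (.assign 30 (.var 0)) (.seq (.assign 31 (.var 8)) (chooseProg L 3))))))))

theorem does_termProg {L : Finset (ℝ × ℝ)} {β : ℝ} (σ : State) (h1 : σ.nat 8 ≤ σ.nat 0)
    (h2 : σ.nat 9 ≤ σ.nat 8) :
    Does β (termProg L) σ fun σ' p => p ≤ 300 * (σ.nat 0 + 1) ∧
      σ'.real 1 = (σ.nat 5).choose (σ.nat 9) ∧
      σ'.real 2 = (σ.nat 0 - σ.nat 5).choose (σ.nat 8 - σ.nat 9) ∧
      σ'.real 3 = (σ.nat 0).choose (σ.nat 8) ∧ Frame [30, 31, 32] [1, 2, 3] σ σ' := by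
  refine Does.seq (Does.assign (Does.seq (Does.assign (Does.seq
    ((does_chooseProg 1 _).mono ?_)))))
  rintro τ₁ p₁ ⟨hp₁, hr₁, hf₁⟩
  simp at hp₁ hr₁ hf₁
  have F₁ : Frame [30, 31, 32] [1, 2, 3] σ τ₁ :=
    (((Frame.refl _ _ σ).setNat _).setNat _).trans hf₁
  refine Does.seq (Does.assign (Does.seq (Does.assign (Does.seq
    ((does_chooseProg 2 _).mono ?_)))))
  rintro τ₂ p₂ ⟨hp₂, hr₂, hf₂⟩
  simp at hp₂ hr₂ hf₂
  have F₂ : Frame [30, 31, 32] [1, 2, 3] σ τ₂ := ((F₁.setNat _).setNat _).trans hf₂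
  refine Does.seq (Does.assign (Does.seq (Does.assign
    ((does_chooseProg 3 _).mono ?_))))
  rintro τ₃ p₃ ⟨hp₃, hr₃, hf₃⟩
  simp at hp₃ hr₃ hf₃
  have a0 := F₁.nat 0 (by decide)
  have a5 := F₁.nat 5 (by decide)
  have a8 := F₁.nat 8 (by decide)
  have a9 := F₁.nat 9 (by decide)
  have b0 := F₂.nat 0 (by decide)
  have b8 := F₂.nat 8 (by decide)
  rw [a0, a5, a8, a9] at hr₂
  rw [a8, a9] at hp₂
  rw [b8] at hp₃
  rw [b0, b8] at hr₃
  refine ⟨by simp; omega, ?_, ?_, hr₃, ((F₂.setNat _).setNat _).trans hf₃⟩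
  · have e1 := hf₃.real 1 (by decide)
    have e2 := hf₂.real 1 (by decide)
    simp only at e1 e2
    rw [e1, e2, hr₁]
  · have e1 := hf₃.real 2 (by decide)
    simp only at e1
    rw [e1, hr₂]

/-- Test for `y ≤ min t k`. -/
def inRange (L : Finset (ℝ × ℝ)) : BExp L := .and (.natLe (.var 9) (.var 8)) (.natLe (.var 9) (.var 5))

/-- Compute the hypergeometric sum with the threshold in the real cell `4`. -/
def hyperProg (L : Finset (ℝ × ℝ)) : Prog L :=
  .seq (.assignReal 5 (.cast (.const 0)))
  (.seq (.assign 9 (.const 0))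
  (.loop (inRange L)
    (.seq (.ite (.realLe (.var 4) (.cast (.var 9)))
      (.seq (termProg L)
        (.assignReal 5 (.add (.var 5) (.div (.mul (.var 1) (.var 2)) (.var 3)))))
      .skip)
    (.assign 9 (.add (.var 9) (.const 1))))))

theorem does_hyperProg {L : Finset (ℝ × ℝ)} {β : ℝ} (σ : State) (h1 : σ.nat 8 ≤ σ.nat 0) :
    Does β (hyperProg L) σ fun σ' p => p ≤ 500 * (σ.nat 0 + 1) ^ 2 ∧
      σ'.real 5 = hyper (σ.nat 0) (σ.nat 5) (σ.nat 8) (σ.real 4) ∧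
      Frame [9, 30, 31, 32] [1, 2, 3, 5] σ σ' := by
  refine Does.seq (Does.assignReal (Does.seq (Does.assign ?_)))
  refine Does.loop (fun m τ => τ.real 5 =
      ∑ y ∈ (Finset.range m).filter (fun y : ℕ => σ.real 4 ≤ (y : ℝ)),
        (((σ.nat 5).choose y : ℝ) * ((σ.nat 0 - σ.nat 5).choose (σ.nat 8 - y) : ℝ)) /
          ((σ.nat 0).choose (σ.nat 8) : ℝ) ∧
      τ.nat 9 = m ∧ Frame [9, 30, 31, 32] [1, 2, 3, 5] σ τ)
    (min (σ.nat 8) (σ.nat 5) + 1) (300 * (σ.nat 0 + 1) + 50) ?_ ?_ ?_ ?_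
  · exact ⟨by simp, by simp, ((Frame.refl _ _ σ).setReal _).setNat _⟩
  · rintro m hm τ ⟨h2, h3, h4⟩
    have e0 := h4.nat 0 (by decide)
    have e5 := h4.nat 5 (by decide)
    have e8 := h4.nat 8 (by decide)
    have r4 := h4.real 4 (by decide)
    refine ⟨by simp [inRange]; omega, Does.seq (Does.ite ?_ ?_)⟩
    · intro hb
      simp only [BExp.Holds, RExp.eval, NExp.eval, r4, h3] at hb
      refine Does.seq ((does_termProg τ (by omega) (by omega)).mono ?_)
      rintro τ₁ p₁ ⟨hp, hr1, hr2, hr3, hf⟩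
      refine Does.assignReal (Does.assign ?_)
      have F := (((h4.trans hf).setReal (a := 5) (RExp.eval (L := L) β τ₁.nat τ₁.real
        (.add (.var 5) (.div (.mul (.var 1) (.var 2)) (.var 3)))))).setNat (a := 9)
          (NExp.eval τ₁.nat (.add (.var 9) (.const 1)))
      refine ⟨?_, ?_, ?_, F⟩
      · rw [e0] at hp; simp; omega
      · rw [Finset.range_add_one, Finset.filter_insert, if_pos hb,
          Finset.sum_insert (by simp)]
        simp [hr1, hr2, hr3, hf.real 5 (by decide), h2, h3, e0, e5, e8]
        ring
      · simp [hf.nat 9 (by decide), h3]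
    · intro hb
      simp only [BExp.Holds, RExp.eval, NExp.eval, r4, h3] at hb
      refine Does.skip (Does.assign ⟨?_, ?_, ?_, h4.setNat _⟩)
      · simp
      · rw [Finset.range_add_one, Finset.filter_insert, if_neg hb]
        simp [h2]
      · simp [h3]
  · rintro τ ⟨h2, h3, h4⟩
    have e5 := h4.nat 5 (by decide)
    have e8 := h4.nat 8 (by decide)
    simp [inRange]; omega
  · rintro τ p ⟨h2, h3, h4⟩ hp
    refine ⟨?_, h2, h4⟩
    simp [inRange] at hp ⊢
    have : (min (σ.nat 8) (σ.nat 5) + 1) * (3 + 2 + (2 + 2 + 1) + 1 + (300 * (σ.nat 0 + 1) + 50)) ≤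
      (σ.nat 0 + 1) * (400 * (σ.nat 0 + 1)) := Nat.mul_le_mul (by omega) (by omega)
    nlinarith

/-! ### The best sampling parameters -/

/-- The number of an element of the specification list. -/
def specIdx {L : Finset (ℝ × ℝ)} (j : L) : ℕ := L.equivFin j

theorem specIdx_injective {L : Finset (ℝ × ℝ)} : Function.Injective (specIdx (L := L)) :=
  fun _ _ h => L.equivFin.injective (Fin.ext h)

open Classical in
/-- The value of `Mstar`. -/
def mstarExp {L : Finset (ℝ × ℝ)} (β : ℝ) (j : L) : RExp L :=
  -- The parameters are constants of the program, so this case is decided when the program is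
  -- written and not at run time.
  if j.1.1 ≤ β then .cast (.const 0)
  else .div (.sub (.alpha j) .beta) (.sub (.alpha j) (.cast (.const 1)))

theorem eval_mstarExp {L : Finset (ℝ × ℝ)} (β : ℝ) (j : L) (M : ℕ → ℕ) (R : ℕ → ℝ) :
    (mstarExp β j).eval β M R = Mstar j.1.1 β := by
  rw [mstarExp, Mstar]; split_ifs <;> simp

theorem ops_mstarExp_le {L : Finset (ℝ × ℝ)} (β : ℝ) (j : L) : (mstarExp β j).ops ≤ 10 := by
  rw [mstarExp]; split_ifs <;> simp

def thresholdExp {L : Finset (ℝ × ℝ)} (j : L) : RExp L :=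
  .add (.mul (.sub (.cast (.const 1)) (.div .beta (.alpha j))) (.cast (.var 5)))
    (.div (.cast (.var 8)) (.alpha j))

/-- Natural cells `5` and `8` hold `k` and `t`; real cell `5` holds the hypergeometric sum. -/
def costExp {L : Finset (ℝ × ℝ)} (j : L) : RExp L :=
  .div (.pow (.price j) (.div (.sub (.mul .beta (.cast (.var 5))) (.cast (.var 8))) (.alpha j)))
    (.var 5)

/-- Record the current parameters. -/
def recordProg {L : Finset (ℝ × ℝ)} (j : L) : Prog L :=
  .seq (.assign 6 (.const (specIdx j)))
  (.seq (.assign 7 (.var 8))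
  (.seq (.assignReal 7 (.var 6))
  (.seq (.assignReal 8 (.var 4))
  (.assign 10 (.const 1)))))

/-- Try all parameters for one element of the specification list. -/
def candidateProg {L : Finset (ℝ × ℝ)} (β : ℝ) (j : L) : Prog L :=
  .seq (.assign 8 (.const 0))
  (.loop (.realLe (.cast (.var 8)) (.mul .beta (.cast (.var 5))))
    (.seq (.ite (.realLe (.mul (mstarExp β j) (.cast (.var 5))) (.cast (.var 8)))
      (.seq (.assignReal 4 (thresholdExp j))
      (.seq (hyperProg L)
      (.seq (.assignReal 6 (costExp j))
      (.ite (.not (.and (.pos 10) (.realLe (.var 7) (.var 6)))) (recordProg j) .skip))))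
      .skip)
    (.assign 8 (.add (.var 8) (.const 1)))))

/-- The recorded parameters are the best ones among the admissible parameters in `D`. -/
structure BestSoFar {L : Finset (ℝ × ℝ)} (n : ℕ) (β : ℝ) (k : ℕ) (D : L → ℕ → Prop)
    (τ : State) : Prop where
  none : τ.nat 10 = 0 → ∀ i s, D i s → ¬ Admissible i.1.1 β k s
  some : τ.nat 10 ≠ 0 → ∃ j : L, τ.nat 6 = specIdx j ∧ Admissible j.1.1 β k (τ.nat 7) ∧
    τ.real 7 = samplingCost n β k j.1 (τ.nat 7) ∧ τ.real 8 = threshold j.1.1 β k (τ.nat 7) ∧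
    ∀ i s, D i s → Admissible i.1.1 β k s →
      samplingCost n β k j.1 (τ.nat 7) ≤ samplingCost n β k i.1 s

/-- The predicate `D` collects the pairs examined so far. The loop adds those of `j` one by one, and
`t ≤ ⌊β k⌋` exhausts all that can be admissible. -/
theorem does_candidateProg {L : Finset (ℝ × ℝ)} (hL : IsSpecList L) {β : ℝ} {n k : ℕ}
    (hk : β * k ≤ n) (hβ : 1 ≤ β) (j : L) (D : L → ℕ → Prop) (σ : State) (h0 : σ.nat 0 = n)
    (h5 : σ.nat 5 = k) (hσ : BestSoFar n β k D σ) :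
    Does β (candidateProg β j) σ fun σ' p => p ≤ 1000 * (n + 1) ^ 3 ∧
      BestSoFar n β k (fun i s => D i s ∨ (i = j ∧ s < ⌊β * k⌋₊ + 1)) σ' ∧
      Frame [6, 7, 8, 9, 10, 30, 31, 32] [1, 2, 3, 4, 5, 6, 7, 8] σ σ' := by
  have hβk : 0 ≤ β * k := by positivity
  have hfl : ⌊β * k⌋₊ ≤ n := Nat.floor_le_of_le hk
  have hfl' := Nat.floor_le hβk
  refine Does.seq (Does.assign ?_)
  refine Does.loop (fun m τ => τ.nat 8 = m ∧
    BestSoFar n β k (fun i s => D i s ∨ (i = j ∧ s < m)) τ ∧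
    Frame [6, 7, 8, 9, 10, 30, 31, 32] [1, 2, 3, 4, 5, 6, 7, 8] σ τ) (⌊β * k⌋₊ + 1)
    (500 * (n + 1) ^ 2 + 150) ?_ ?_ ?_ ?_
  · refine ⟨by simp, ⟨fun h => ?_, fun h => ?_⟩, (Frame.refl _ _ σ).setNat _⟩
    · simpa using hσ.none (by simpa using h)
    · simpa using hσ.some (by simpa using h)
  · rintro m hm τ ⟨h8, hbest, hf⟩
    have e0 := hf.nat 0 (by decide)
    have e5 := hf.nat 5 (by decide)
    rw [h0] at e0
    rw [h5] at e5
    have hmβ : (m : ℝ) ≤ β * k := by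
      have : (m : ℝ) ≤ ⌊β * k⌋₊ := by exact_mod_cast Nat.lt_succ_iff.1 hm
      linarith
    refine ⟨by simpa [h8, e5] using hmβ, Does.seq (Does.ite ?_ ?_)⟩
    · intro hb
      simp only [BExp.Holds, RExp.eval, NExp.eval, eval_mstarExp, h8, e5] at hb
      have hadm : Admissible j.1.1 β k m := ⟨hb, hmβ⟩
      refine Does.seq (Does.assignReal (Does.seq ((does_hyperProg _ ?_).mono ?_)))
      · simp [h8, e0]; omega
      rintro τ₁ p₁ ⟨hp₁, hr₁, hf₁⟩
      have hthr : (thresholdExp j).eval β τ.nat τ.real = threshold j.1.1 β k m := by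
        simp [thresholdExp, threshold, h8, e5]
      simp [h8, e0, e5, hthr] at hp₁ hr₁ hf₁
      have F₁ := (hf.setReal (a := 4) (threshold j.1.1 β k m)).trans hf₁
      have g0 := hf₁.nat 5 (by decide)
      have g8 := hf₁.nat 8 (by decide)
      have g4 := hf₁.real 4 (by decide)
      have g7 := hf₁.real 7 (by decide)
      have g8r := hf₁.real 8 (by decide)
      have g10 := hf₁.nat 10 (by decide)
      have g6 := hf₁.nat 6 (by decide)
      have g7n := hf₁.nat 7 (by decide)
      simp [h8, e5] at g0 g8 g4 g7 g8r g10 g6 g7n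
      have hcost : (costExp j).eval β τ₁.nat τ₁.real = samplingCost n β k j.1 m := by
        have : 0 < j.1.2 := by linarith [(hL.2 _ j.2).2]
        simp [costExp, samplingCost, hr₁, g0, g8, this]
      refine Does.seq (Does.assignReal (Does.ite ?_ ?_))
      · intro hb'
        simp [hcost, g7, g10] at hb'
        refine Does.seq (Does.assign (Does.seq (Does.assign (Does.seq (Does.assignReal
          (Does.seq (Does.assignReal (Does.assign (Does.assign ?_)))))))))
        refine ⟨?_, by simp [g8], ⟨?_, ?_⟩, (((((((F₁.setReal _).setNat _).setNat _).setReal _).setReal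
          _).setNat _).setNat _)⟩
        · have := ops_mstarExp_le β j
          simp [thresholdExp, costExp]; omega
        · simp
        · intro _
          refine ⟨j, by simp, by simpa [g8] using hadm, by simp [g8, hcost], by simp [g8, g4], ?_⟩
          intro i s hD hadm'
          simp [g8]
          rcases hD with hD | ⟨rfl, hs⟩
          · by_cases hz : τ.nat 10 = 0
            · exact absurd hadm' (hbest.none hz i s (Or.inl hD))
            · obtain ⟨j', -, -, hj3, -, hj5⟩ := hbest.some hz
              have h1 := hj5 i s (Or.inl hD) hadm'
              have h2 := hb' (by omega)
              rw [hj3] at h2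
              linarith
          · rcases Nat.lt_succ_iff_lt_or_eq.1 hs with hs | rfl
            · by_cases hz : τ.nat 10 = 0
              · exact absurd hadm' (hbest.none hz i s (Or.inr ⟨rfl, hs⟩))
              · obtain ⟨j', -, -, hj3, -, hj5⟩ := hbest.some hz
                have h1 := hj5 i s (Or.inr ⟨rfl, hs⟩) hadm'
                have h2 := hb' (by omega)
                rw [hj3] at h2
                linarith
            · exact le_rfl
      · intro hb'
        simp [hcost, g7, g10] at hb'
        refine Does.skip (Does.assign ⟨?_, by simp [g8], ⟨?_, ?_⟩, (F₁.setReal _).setNat _⟩)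
        · have := ops_mstarExp_le β j
          simp [thresholdExp, costExp]; omega
        · simp [g10]; omega
        · intro _
          obtain ⟨j', hj1, hj2, hj3, hj4, hj5⟩ := hbest.some (by omega)
          refine ⟨j', by simpa [g6] using hj1, by simpa [g7n] using hj2, by simpa [g7n, g7] using hj3,
            by simpa [g7n, g8r] using hj4, ?_⟩
          intro i s hD hadm'
          simp [g7n]
          rcases hD with hD | ⟨rfl, hs⟩
          · exact hj5 i s (Or.inl hD) hadm'
          · rcases Nat.lt_succ_iff_lt_or_eq.1 hs with hs | rfl
            · exact hj5 i s (Or.inr ⟨rfl, hs⟩) hadm'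
            · rw [← hj3]; exact hb'.2
    · intro hb
      simp only [BExp.Holds, RExp.eval, NExp.eval, eval_mstarExp, h8, e5] at hb
      have hnadm : ¬ Admissible j.1.1 β k m := fun h => hb h.1
      refine Does.skip (Does.assign ⟨?_, by simp [h8], ⟨?_, ?_⟩, hf.setNat _⟩)
      · have := ops_mstarExp_le β j
        simp; omega
      · intro hz
        simp at hz
        rintro i s (hD | ⟨rfl, hs⟩)
        · exact hbest.none hz i s (Or.inl hD)
        · rcases Nat.lt_succ_iff_lt_or_eq.1 hs with hs | rfl
          · exact hbest.none hz i s (Or.inr ⟨rfl, hs⟩)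
          · exact hnadm
      · intro hz
        simp at hz
        obtain ⟨j', hj1, hj2, hj3, hj4, hj5⟩ := hbest.some hz
        refine ⟨j', by simpa using hj1, by simpa using hj2, by simpa using hj3,
          by simpa using hj4, ?_⟩
        intro i s hD hadm'
        simp
        rcases hD with hD | ⟨rfl, hs⟩
        · exact hj5 i s (Or.inl hD) hadm'
        · rcases Nat.lt_succ_iff_lt_or_eq.1 hs with hs | rfl
          · exact hj5 i s (Or.inr ⟨rfl, hs⟩) hadm'
          · exact absurd hadm' hnadm
  · rintro τ ⟨h8, hbest, hf⟩
    have e5 := hf.nat 5 (by decide)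
    simp [h8, e5, h5]
    exact Nat.lt_floor_add_one _
  · rintro τ p ⟨h8, hbest, hf⟩ hp
    refine ⟨?_, hbest, hf⟩
    simp at hp ⊢
    have hq : 1 ≤ (n + 1) ^ 2 := Nat.one_le_pow _ _ (by omega)
    rw [pow_succ _ 2, mul_comm _ (n + 1)]
    set q := (n + 1) ^ 2
    have : (⌊β * k⌋₊ + 1) * (9 + (500 * q + 150)) ≤
        (n + 1) * (700 * q) := Nat.mul_le_mul (by omega) (by omega)
    have h2 : (n + 1) * (700 * q) = 700 * ((n + 1) * q) := by ring
    have h3 : 1 ≤ (n + 1) * q := Nat.mul_pos (by omega) hq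
    omega

/-- Try all parameters. -/
def bestSamplingProg {L : Finset (ℝ × ℝ)} (β : ℝ) (js : List L) : Prog L :=
  js.foldr (fun j P => .seq (candidateProg β j) P) .skip

theorem does_bestSamplingProg {L : Finset (ℝ × ℝ)} (hL : IsSpecList L) {β : ℝ} {n k : ℕ}
    (hk : β * k ≤ n) (hβ : 1 ≤ β) (js : List L) (D : L → ℕ → Prop) (σ : State) (h0 : σ.nat 0 = n)
    (h5 : σ.nat 5 = k) (hσ : BestSoFar n β k D σ) :
    Does β (bestSamplingProg β js) σ fun σ' p => p ≤ js.length * (1000 * (n + 1) ^ 3) + 1 ∧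
      BestSoFar n β k (fun i s => D i s ∨ (i ∈ js ∧ s < ⌊β * k⌋₊ + 1)) σ' ∧
      Frame [6, 7, 8, 9, 10, 30, 31, 32] [1, 2, 3, 4, 5, 6, 7, 8] σ σ' := by
  induction js generalizing D σ with
  | nil => exact Does.skip ⟨by simp, by simpa using hσ, Frame.refl _ _ σ⟩
  | cons j js ih =>
    refine Does.seq ((does_candidateProg hL hk hβ j D σ h0 h5 hσ).mono ?_)
    rintro σ₁ p₁ ⟨hp₁, hb₁, hf₁⟩
    refine (ih _ σ₁ (by rw [hf₁.nat 0 (by decide), h0]) (by rw [hf₁.nat 5 (by decide), h5])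
      hb₁).mono ?_
    rintro σ₂ p₂ ⟨hp₂, hb₂, hf₂⟩
    refine ⟨?_, ?_, hf₁.trans hf₂⟩
    · rw [List.length_cons, add_one_mul]; omega
    · convert hb₂ using 3 with i s
      simp only [List.mem_cons]
      tauto

/-! ### The best intersection, and the number of codewords -/

/-- Only the minimum of `kappa` is kept, in real cell `9`. The minimizer enters the program solely
through the number of codewords to be decoded. -/
def bestIntersectionProg (L : Finset (ℝ × ℝ)) : Prog L :=
  .seq (.assign 8 (.var 7))
  (.seq (.assign 10 (.const 0))
  (.seq (.assign 9 (.const 0))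
  (.loop (inRange L)
    (.seq (.ite (.realLe (.var 8) (.cast (.var 9)))
      (.seq (termProg L)
      (.seq (.assignReal 11 (.div (.var 3) (.mul (.var 1) (.var 2))))
      (.ite (.not (.and (.pos 10) (.realLe (.var 9) (.var 11))))
        (.seq (.assignReal 9 (.var 11)) (.assign 10 (.const 1))) .skip)))
      .skip)
    (.assign 9 (.add (.var 9) (.const 1)))))))

theorem does_bestIntersectionProg {L : Finset (ℝ × ℝ)} {β : ℝ} (σ : State)
    (h7 : σ.nat 7 ≤ σ.nat 0) (hx : σ.real 8 ≤ (min (σ.nat 7) (σ.nat 5) : ℕ)) :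
    Does β (bestIntersectionProg L) σ fun σ' p => p ≤ 500 * (σ.nat 0 + 1) ^ 2 ∧
      (∃ y, IsBestIntersection (σ.nat 0) (σ.nat 5) (σ.nat 7) (σ.real 8) y ∧
        σ'.real 9 = kappa (σ.nat 0) (σ.nat 5) (σ.nat 7) y) ∧ σ'.nat 8 = σ.nat 7 ∧
      Frame [8, 9, 10, 30, 31, 32] [1, 2, 3, 9, 11] σ σ' := by
  set n := σ.nat 0
  set k := σ.nat 5 with hk
  set t := σ.nat 7
  set x := σ.real 8
  refine Does.seq (Does.assign (Does.seq (Does.assign (Does.seq (Does.assign ?_)))))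
  refine Does.loop (fun m τ => (τ.nat 10 = 0 → ∀ z < m, ¬ x ≤ (z : ℕ)) ∧
      (τ.nat 10 ≠ 0 → ∃ y < m, x ≤ (y : ℕ) ∧ τ.real 9 = kappa n k t y ∧
        ∀ z < m, x ≤ (z : ℕ) → kappa n k t y ≤ kappa n k t z) ∧
      τ.nat 9 = m ∧ τ.nat 8 = t ∧ Frame [8, 9, 10, 30, 31, 32] [1, 2, 3, 9, 11] σ τ)
    (min t k + 1) (300 * (n + 1) + 80) ?_ ?_ ?_ ?_
  · exact ⟨by simp, by simp, by simp, by simp [t],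
      (((Frame.refl _ _ σ).setNat _).setNat _).setNat _⟩
  · rintro m hm τ ⟨hz, hs, h9, h8, hf⟩
    have e0 : τ.nat 0 = n := hf.nat 0 (by decide)
    have e5 : τ.nat 5 = k := hf.nat 5 (by decide)
    have r8 : τ.real 8 = x := hf.real 8 (by decide)
    have h98 : τ.nat 9 ≤ τ.nat 8 ∧ τ.nat 9 ≤ τ.nat 5 := by
      rw [h9, h8, e5]; clear hz hs; omega
    refine ⟨by simpa [inRange] using h98, Does.seq (Does.ite ?_ ?_)⟩
    · intro hb
      simp only [BExp.Holds, RExp.eval, NExp.eval, r8, h9] at hb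
      refine Does.seq ((does_termProg τ (by rw [h8, e0]; exact h7) h98.1).mono ?_)
      rintro τ₁ p₁ ⟨hp, hr1, hr2, hr3, hf₁⟩
      have F₁ := hf.trans hf₁
      have g9 := hf₁.nat 9 (by decide)
      have g8 := hf₁.nat 8 (by decide)
      have g10 := hf₁.nat 10 (by decide)
      have g9r := hf₁.real 9 (by decide)
      have hkap : τ₁.real 3 / (τ₁.real 1 * τ₁.real 2) = kappa n k t m := by
        rw [hr1, hr2, hr3, h9, h8, e0, e5, kappa]
      rw [e0] at hp
      refine Does.seq (Does.assignReal (Does.ite ?_ ?_))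
      · intro hb'
        simp [hkap, g9r, g10] at hb'
        refine Does.seq (Does.assignReal (Does.assign (Does.assign ?_)))
        refine ⟨by simp; omega, by simp, fun _ => ⟨m, by omega, hb, by simp [hkap], ?_⟩,
          by simp [g9, h9], by simp [g8, h8], (((F₁.setReal _).setReal _).setNat _).setNat _⟩
        intro z hzm hxz
        rcases Nat.lt_succ_iff_lt_or_eq.1 hzm with hzm | rfl
        · by_cases h0 : τ.nat 10 = 0
          · exact absurd hxz (hz h0 z hzm)
          · obtain ⟨y, -, -, hy3, hy4⟩ := hs h0
            have h1 := hy4 z hzm hxz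
            have h2 := hb' (by omega)
            rw [hy3] at h2
            linarith
        · exact le_rfl
      · intro hb'
        simp [hkap, g9r, g10] at hb'
        refine Does.skip (Does.assign ⟨by simp; omega, ?_, ?_, by simp [g9, h9], by simp [g8, h8],
          (F₁.setReal _).setNat _⟩)
        · simp [g10]; omega
        · intro _
          obtain ⟨y, hy1, hy2, hy3, hy4⟩ := hs (by omega)
          refine ⟨y, by omega, hy2, by simp [g9r, hy3], ?_⟩
          intro z hzm hxz
          rcases Nat.lt_succ_iff_lt_or_eq.1 hzm with hzm | rfl
          · exact hy4 z hzm hxz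
          · rw [← hy3]; exact hb'.2
    · intro hb
      simp only [BExp.Holds, RExp.eval, NExp.eval, r8, h9] at hb
      refine Does.skip (Does.assign ⟨by simp, ?_, ?_, by simp [h9], by simp [h8], hf.setNat _⟩)
      · intro h0 z hzm
        rcases Nat.lt_succ_iff_lt_or_eq.1 hzm with hzm | rfl
        · exact hz (by simpa using h0) z hzm
        · exact hb
      · intro h0
        obtain ⟨y, hy1, hy2, hy3, hy4⟩ := hs (by simpa using h0)
        refine ⟨y, by omega, hy2, hy3, ?_⟩
        intro z hzm hxz
        rcases Nat.lt_succ_iff_lt_or_eq.1 hzm with hzm | rfl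
        · exact hy4 z hzm hxz
        · exact absurd hxz hb
  · rintro τ ⟨hz, hs, h9, h8, hf⟩
    have e5 : τ.nat 5 = k := hf.nat 5 (by decide)
    simp [inRange]; omega
  · rintro τ p ⟨hz, hs, h9, h8, hf⟩ hp
    refine ⟨?_, ?_, h8, hf⟩
    · simp [inRange] at hp ⊢
      have h1 : (min t k + 1) * (11 + (300 * (n + 1) + 80)) ≤ (n + 1) * (400 * (n + 1)) :=
        Nat.mul_le_mul (by omega) (by omega)
      have h2 : (n + 1) * (400 * (n + 1)) = 400 * (n + 1) ^ 2 := by ring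
      have h3 : 1 ≤ (n + 1) ^ 2 := Nat.one_le_pow _ _ (by omega)
      omega
    · have h0 : τ.nat 10 ≠ 0 := fun h0 => hz h0 (min t k) (by omega) hx
      obtain ⟨y, hy1, hy2, hy3, hy4⟩ := hs h0
      exact ⟨y, ⟨⟨hy2, by omega⟩, fun z h1 h2 => hy4 z (by omega) h1⟩, hy3⟩

/-- Compute the largest natural number `ℓ ≤ k - x`. -/
def extensionSizeProg (L : Finset (ℝ × ℝ)) : Prog L :=
  .seq (.assign 12 (.const 0))
  (.loop (.realLe (.add (.cast (.add (.var 12) (.const 1))) (.var 8)) (.cast (.var 5)))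
    (.assign 12 (.add (.var 12) (.const 1))))

/-- Real numbers cannot be rounded by the machine, so the floor is found by counting upwards. -/
theorem does_extensionSizeProg {L : Finset (ℝ × ℝ)} {β : ℝ} (σ : State) :
    Does β (extensionSizeProg L) σ fun σ' p =>
      p ≤ 30 * (⌊σ.nat 5 - σ.real 8⌋₊ + 1) ∧ σ'.nat 12 = ⌊σ.nat 5 - σ.real 8⌋₊ ∧
      Frame [12] [] σ σ' := by
  refine Does.seq (Does.assign ?_)
  refine Does.loop (fun m τ => τ.nat 12 = m ∧ Frame [12] [] σ τ) ⌊σ.nat 5 - σ.real 8⌋₊ 8 ?_ ?_ ?_ ?_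
  · exact ⟨by simp, (Frame.refl _ _ σ).setNat _⟩
  · rintro m hm τ ⟨h1, hf⟩
    have e5 := hf.nat 5 (by decide)
    have e8 := hf.real 8 (by decide)
    have h2 : ((m + 1 : ℕ) : ℝ) ≤ σ.nat 5 - σ.real 8 :=
      (Nat.le_floor_iff' (by omega)).1 (by omega)
    push_cast at h2
    refine ⟨?_, Does.assign ⟨by simp, by simp [h1], hf.setNat _⟩⟩
    simp [h1, e5, e8]
    linarith
  · rintro τ ⟨h1, hf⟩
    have e5 := hf.nat 5 (by decide)
    have e8 := hf.real 8 (by decide)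
    have := Nat.lt_floor_add_one (σ.nat 5 - σ.real 8)
    simp [h1, e5, e8]
    linarith
  · rintro τ p ⟨h1, hf⟩ hp
    refine ⟨?_, h1, hf⟩
    simp at hp ⊢; omega

/-- The overhead of the number of codewords. -/
def overhead (n s tb : ℕ) : ℝ := 2 ^ (tb + s) * (16 * ((s : ℝ) + 1) ^ 7) ^ ((n : ℝ) / s)

/-- Compute the bound for the codewords. -/
def codeBoundProg (L : Finset (ℝ × ℝ)) : Prog L :=
  .assignReal 10 (.mul (.var 9) (.mul (.pow (.cast (.const 2)) (.cast (.add (.var 4) (.var 3))))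
    (.pow (.mul (.cast (.const 16)) (.pow (.cast (.add (.var 3) (.const 1))) (.cast (.const 7))))
      (.div (.cast (.var 0)) (.cast (.var 3))))))

theorem does_codeBoundProg {L : Finset (ℝ × ℝ)} {β : ℝ} (σ : State) :
    Does β (codeBoundProg L) σ fun σ' p => p ≤ 50 ∧
      σ'.real 10 = σ.real 9 * overhead (σ.nat 0) (σ.nat 3) (σ.nat 4) ∧ Frame [] [10] σ σ' := by
  refine Does.assignReal ⟨by simp, ?_, (Frame.refl _ _ σ).setReal _⟩
  have h1 : (0 : ℝ) < (σ.nat 3 : ℝ) + 1 := by positivity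
  have h2 : (0 : ℝ) < ((σ.nat 3 : ℝ) + 1) ^ 7 := by positivity
  have h3 : (2 : ℝ) ^ ((σ.nat 4 : ℝ) + σ.nat 3) = 2 ^ (σ.nat 4 + σ.nat 3) := by
    rw [← Nat.cast_add, Real.rpow_natCast]
  have h4 : ((σ.nat 3 : ℝ) + 1) ^ (7 : ℝ) = ((σ.nat 3 : ℝ) + 1) ^ 7 := by
    rw [← Real.rpow_natCast]; norm_num
  simp [overhead, h1, h2, h3, h4]

/-! ### Listing the queries -/

/-- The address of entry `x` of the array number `c`. -/
def arr (c : ℕ) (x : NExp) : NExp := .add (.const (64 + c)) (.add (.add x x) (.add x x))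

/-- The list of queries stored in the memory: number of the oracle, bit mask, size. -/
def queryLog (σ : State) : List (ℕ × ℕ × ℕ) :=
  (List.range (σ.nat 14)).map fun i =>
    (σ.nat (66 + 4 * i), σ.nat (65 + 4 * i), σ.nat (67 + 4 * i))

/-- The states differ below address `64` at most in the cells `S`, and in the real cells `R`. -/
structure LowFrame (S R : List ℕ) (σ σ' : State) : Prop where
  nat : ∀ x < 64, x ∉ S → σ'.nat x = σ.nat x
  real : ∀ x, x ∉ R → σ'.real x = σ.real x

theorem LowFrame.trans {S R S' R' : List ℕ} {σ σ' σ'' : State} (h : LowFrame S R σ σ')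
    (h' : LowFrame S' R' σ' σ'') (hS : S' ⊆ S := by decide) (hR : R' ⊆ R := by decide) :
    LowFrame S R σ σ'' :=
  ⟨fun x hx hxS => (h'.nat x hx fun h => hxS (hS h)).trans (h.nat x hx hxS),
    fun x hx => (h'.real x fun h => hx (hR h)).trans (h.real x hx)⟩

theorem Frame.low {S R : List ℕ} {σ σ' : State} (h : Frame S R σ σ') : LowFrame S R σ σ' :=
  ⟨fun x _ hx => h.nat x hx, h.real⟩

theorem Frame.nat_of_le {S R : List ℕ} {σ σ' : State} (h : Frame S R σ σ')
    (hS : ∀ x ∈ S, x < 64) {x : ℕ} (hx : 64 ≤ x) : σ'.nat x = σ.nat x :=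
  h.nat x fun hxS => absurd (hS x hxS) (by omega)

theorem Frame.queryLog_eq {S R : List ℕ} {σ σ' : State} (h : Frame S R σ σ')
    (hS : ∀ x ∈ S, x < 64 ∧ x ≠ 14) : queryLog σ' = queryLog σ := by
  rw [queryLog, queryLog, h.nat 14 fun h14 => (hS 14 h14).2 rfl]
  refine List.map_congr_left fun i _ => ?_
  have hS' : ∀ x ∈ S, x < 64 := fun x hx => (hS x hx).1
  rw [h.nat_of_le hS' (by omega), h.nat_of_le hS' (by omega), h.nat_of_le hS' (by omega)]

/-- Append a query to the list, and mark it. -/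
def pushProg (L : Finset (ℝ × ℝ)) : Prog L :=
  .seq (.setNat (arr 0 (.var 17)) (.add (.var 5) (.const 1)))
  (.seq (.setNat (arr 1 (.var 14)) (.var 17))
  (.seq (.setNat (arr 2 (.var 14)) (.var 6))
  (.seq (.setNat (arr 3 (.var 14)) (.var 12))
  (.assign 14 (.add (.var 14) (.const 1))))))

theorem does_pushProg {L : Finset (ℝ × ℝ)} {β : ℝ} (σ : State) :
    Does β (pushProg L) σ fun σ' p => p ≤ 100 ∧
      queryLog σ' = queryLog σ ++ [(σ.nat 6, σ.nat 17, σ.nat 12)] ∧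
      (∀ X, σ'.nat (64 + 4 * X) = if X = σ.nat 17 then σ.nat 5 + 1 else σ.nat (64 + 4 * X)) ∧
      LowFrame [14] [] σ σ' := by
  refine Does.seq (Does.setNat (Does.seq (Does.setNat (Does.seq (Does.setNat
    (Does.seq (Does.setNat (Does.assign ?_))))))))
  have hne : ∀ a b c : ℕ, a < 64 → a ≠ 64 + c + (b + b + (b + b)) := by intros; omega
  have e1 : ∀ (f : ℕ → ℕ) (a b c v : ℕ), a < 64 →
      Function.update f (64 + c + (b + b + (b + b))) v a = f a := fun f a b c v ha =>
    Function.update_of_ne (hne a b c ha) _ _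
  simp only [arr, NExp.eval, NExp.ops, e1 _ 14 _ _ _ (by norm_num), e1 _ 17 _ _ _ (by norm_num),
    e1 _ 6 _ _ _ (by norm_num), e1 _ 12 _ _ _ (by norm_num)]
  refine ⟨by norm_num, ?_, ?_, ?_, fun x _ => rfl⟩
  · simp only [queryLog, Function.update_self, List.range_succ, List.map_append, List.map_cons,
      List.map_nil]
    congr 1
    · refine List.map_congr_left fun i hi => ?_
      rw [List.mem_range] at hi
      simp only [Function.update_apply]
      rw [Prod.mk.injEq, Prod.mk.injEq]
      refine ⟨?_, ?_, ?_⟩ <;> · repeat rw [if_neg (by omega)]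
    · simp only [Function.update_apply]
      rw [List.cons.injEq, Prod.mk.injEq, Prod.mk.injEq]
      refine ⟨⟨?_, ?_, ?_⟩, rfl⟩
      · rw [if_neg (by omega), if_neg (by omega), if_pos (by omega)]
      · rw [if_neg (by omega), if_neg (by omega), if_neg (by omega), if_pos (by omega)]
      · rw [if_neg (by omega), if_pos (by omega)]
  · intro X
    simp only [Function.update_apply]
    rw [if_neg (by omega), if_neg (by omega), if_neg (by omega), if_neg (by omega)]
    by_cases h : X = σ.nat 17
    · rw [if_pos (by omega), if_pos h]
    · rw [if_neg (by omega), if_neg h]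
  · intro x hx hxS
    have hx14 : x ≠ 14 := by simpa using hxS
    simp only [Function.update_apply]
    rw [if_neg hx14, if_neg (by omega), if_neg (by omega), if_neg (by omega), if_neg (by omega)]

theorem LowFrame.refl (S R : List ℕ) (σ : State) : LowFrame S R σ σ :=
  ⟨fun _ _ _ => rfl, fun _ _ => rfl⟩

theorem LowFrame.setNat {S R : List ℕ} {σ σ' : State} (h : LowFrame S R σ σ') {a : ℕ} (v : ℕ)
    (ha : a ∈ S := by decide) : LowFrame S R σ ⟨Function.update σ'.nat a v, σ'.real, σ'.pos⟩ :=
  ⟨fun x hx hxS => by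
    rw [← h.nat x hx hxS]; exact Function.update_of_ne (by rintro rfl; exact hxS ha) _ _, h.real⟩

theorem does_unionProg_of_eq {L : Finset (ℝ × ℝ)} {β : ℝ} {σ : State} {n a b : ℕ}
    (h0 : σ.nat 0 = n) (ha : σ.nat 28 = a) (hb : σ.nat 29 = b) :
    Does β (unionProg L) σ fun σ' p => p ≤ 100 * (n + 1) ∧
      decode n (σ'.nat 26) = decode n a ∪ decode n b ∧
      σ'.nat 25 = (decode n a ∪ decode n b).card ∧ Frame [25, 26, 27, 28, 29, 36] [] σ σ' := by
  subst h0 ha hb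
  exact does_unionProg σ

/-! ### Listing the set intersection family -/

/-- The set in cell `17` has the right size and is not marked. -/
def isNew (L : Finset (ℝ × ℝ)) : BExp L :=
  .and (.and (.natLe (.var 25) (.var 8)) (.natLe (.var 8) (.var 25)))
    (.not (.natLe (.add (.var 5) (.const 1)) (.load (arr 0 (.var 17)))))

/-- Treat the codeword in cell `13`. -/
def codewordProg (L : Finset (ℝ × ℝ)) : Prog L :=
  .seq (.assign 15 (.var 13))
  (.seq (decodeProg L)
  (.seq (.assign 28 (.var 17))
  (.seq (.assign 29 (.var 17))
  (.seq (unionProg L)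
  (.seq (.ite (isNew L) (pushProg L) .skip)
  (.assign 13 (.add (.var 13) (.const 1))))))))

/-- The operations needed for one codeword. -/
def codewordOps (n s tb : ℕ) : ℕ := 2000 * (tb + (n + 1) * 2 ^ (16 * s)) + 100 * (n + 1) + 200

/-- The cells used for the family. -/
abbrev familyCells : List ℕ := [13, 14, 15, 16, 17, 18, 19, 20, 21, 22, 23, 25, 26, 27, 28, 29, 36]

/-- A listed set is marked with `k + 1` in array `0`. Marks of earlier rounds are at most `k`, so
the array need not be cleared between rounds. -/
theorem does_codewordProg {L : Finset (ℝ × ℝ)} {β : ℝ} (σ : State) (hs : σ.nat 3 = 2 ^ σ.nat 2)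
    (C : List ℕ) (hC : ∀ X, σ.nat (64 + 4 * X) ≤ σ.nat 5 + 1 ∧
      (σ.nat (64 + 4 * X) = σ.nat 5 + 1 ↔ X ∈ C)) (X : ℕ)
    (hX : X = codeMask (σ.nat 2) (σ.nat 3) (σ.nat 4) (σ.nat 0) (σ.nat 13)) :
    Does β (codewordProg L) σ fun σ' p =>
      p ≤ codewordOps (σ.nat 0) (σ.nat 3) (σ.nat 4) ∧ σ'.nat 13 = σ.nat 13 + 1 ∧
      LowFrame familyCells [] σ σ' ∧
      ∃ D : List ℕ, D = (if (decode (σ.nat 0) X).card = σ.nat 8 ∧ X ∉ C then [X] else []) ∧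
      (∀ Z, σ'.nat (64 + 4 * Z) ≤ σ.nat 5 + 1 ∧
        (σ'.nat (64 + 4 * Z) = σ.nat 5 + 1 ↔ Z ∈ C ++ D)) ∧
      queryLog σ' = queryLog σ ++ D.map fun Z => (σ.nat 6, Z, σ.nat 12) := by
  refine Does.seq (Does.assign (Does.seq ((does_decodeProg _ (by simpa using hs)).mono ?_)))
  rintro τ₁ p₁ ⟨hp₁, h17, hf₁⟩
  simp only [NExp.eval, ne_eq, Nat.reduceEqDiff, not_false_eq_true, Function.update_of_ne,
    Function.update_self, OfNat.zero_ne_ofNat] at hp₁ h17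
  rw [← hX] at h17
  have F₁ : Frame [15, 16, 17, 18, 19, 20, 21, 22, 23] [] σ τ₁ :=
    ((Frame.refl _ _ σ).setNat _).trans hf₁
  -- The union of the set with itself is formed only to obtain its cardinality.
  refine Does.seq (Does.assign (Does.seq (Does.assign (Does.seq ((does_unionProg_of_eq (a := X)
    (b := X) (n := σ.nat 0)
    (by simpa using F₁.nat 0 (by decide)) (by simpa using h17) (by simpa using h17)).mono ?_)))))
  rintro τ₂ p₂ ⟨hp₂, -, h25, hf₂⟩
  rw [Finset.union_self] at h25
  have F₂' : Frame [25, 26, 27, 28, 29, 36] [] τ₁ τ₂ :=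
    (((Frame.refl _ _ τ₁).setNat _).setNat _).trans hf₂
  have F₂ : Frame [15, 16, 17, 18, 19, 20, 21, 22, 23, 25, 26, 27, 28, 29, 36] [] σ τ₂ :=
    F₁.mono.trans F₂'
  have k17 : τ₂.nat 17 = X := by rw [F₂'.nat 17 (by decide), h17]
  have k5 := F₂.nat 5 (by decide)
  have k8 := F₂.nat 8 (by decide)
  have k6 := F₂.nat 6 (by decide)
  have k12 := F₂.nat 12 (by decide)
  have k13 := F₂.nat 13 (by decide)
  have kv : ∀ Z, τ₂.nat (64 + 4 * Z) = σ.nat (64 + 4 * Z) := fun Z =>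
    F₂.nat_of_le (by decide) (by omega)
  have kl : queryLog τ₂ = queryLog σ := F₂.queryLog_eq (by decide)
  have hnew : (isNew L).Holds β τ₂.nat τ₂.real ↔
      (decode (σ.nat 0) X).card = σ.nat 8 ∧ X ∉ C := by
    have h1 : 64 + 0 + (X + X + (X + X)) = 64 + 4 * X := by ring
    have h2 := hC X
    simp only [isNew, BExp.Holds, NExp.eval, arr, k17, h25, k8, k5, h1, kv, ← h2.2]
    omega
  have FL : LowFrame familyCells [] σ τ₂ := (LowFrame.refl _ _ σ).trans F₂.low
  refine Does.seq (Does.ite ?_ ?_)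
  · intro hb
    rw [hnew] at hb
    refine (does_pushProg τ₂).mono ?_
    rintro τ₃ p₃ ⟨hp₃, hlog, hv, hf₃⟩
    refine Does.assign ⟨?_, ?_, ?_, _, rfl, ?_, ?_⟩
    · simp [codewordOps, isNew, arr]; omega
    · simp [hf₃.nat 13 (by decide) (by decide), k13]
    · exact (FL.trans hf₃).setNat _
    · intro Z
      rw [if_pos hb]
      have h1 := hC Z
      simp only [Function.update_of_ne (show 64 + 4 * Z ≠ 13 by omega), hv, k17, k5, kv]
      split_ifs with hZ
      · simp [hZ]
      · simpa [hZ] using h1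
    · rw [if_pos hb, ((Frame.refl [13] [] τ₃).setNat _).queryLog_eq (by decide), hlog, kl, k6, k17,
        k12]
      simp
  · intro hb
    rw [hnew] at hb
    refine Does.skip (Does.assign ⟨?_, ?_, ?_, _, rfl, ?_, ?_⟩)
    · simp [codewordOps, isNew, arr]; omega
    · simp [k13]
    · exact FL.setNat _
    · intro Z
      rw [if_neg hb]
      simp only [Function.update_of_ne (show 64 + 4 * Z ≠ 13 by omega), kv, List.append_nil]
      exact hC Z
    · rw [if_neg hb, ((Frame.refl [13] [] τ₂).setNat _).queryLog_eq (by decide), kl]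
      simp

/-- List the distinct codewords of the right size. -/
def familyProg (L : Finset (ℝ × ℝ)) : Prog L :=
  .seq (.assign 13 (.const 0))
  (.loop (.not (.realLe (.var 10) (.cast (.var 13)))) (codewordProg L))

/-- All numbers below the bound are decoded, and duplicates and sets of the wrong size are dropped.
That the result covers all `k`-sets is a property of the code and need not be tested. -/
theorem does_familyProg {L : Finset (ℝ × ℝ)} {β : ℝ} (σ : State) (hs : σ.nat 3 = 2 ^ σ.nat 2)
    (hv : ∀ X, σ.nat (64 + 4 * X) ≤ σ.nat 5) :
    Does β (familyProg L) σ fun σ' p =>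
      p ≤ (⌈σ.real 10⌉₊ + 1) * (codewordOps (σ.nat 0) (σ.nat 3) (σ.nat 4) + 20) ∧
      LowFrame familyCells [] σ σ' ∧ (∀ X, σ'.nat (64 + 4 * X) ≤ σ.nat 5 + 1) ∧
      ∃ C : List ℕ, C.Nodup ∧ C.length ≤ ⌈σ.real 10⌉₊ ∧
      (∀ X ∈ C, X < 2 ^ σ.nat 0 ∧ (decode (σ.nat 0) X).card = σ.nat 8) ∧
      (∀ z : ℕ, (z : ℝ) < σ.real 10 → ∀ X, X = codeMask (σ.nat 2) (σ.nat 3) (σ.nat 4) (σ.nat 0) z →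
        (decode (σ.nat 0) X).card = σ.nat 8 → X ∈ C) ∧
      queryLog σ' = queryLog σ ++ C.map fun X => (σ.nat 6, X, σ.nat 12) := by
  refine Does.seq (Does.assign ?_)
  refine Does.loop (fun m τ => τ.nat 13 = m ∧ LowFrame familyCells [] σ τ ∧
      ∃ C : List ℕ, C.Nodup ∧ C.length ≤ m ∧
      (∀ X ∈ C, X < 2 ^ σ.nat 0 ∧ (decode (σ.nat 0) X).card = σ.nat 8) ∧
      (∀ z < m, ∀ X, X = codeMask (σ.nat 2) (σ.nat 3) (σ.nat 4) (σ.nat 0) z →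
        (decode (σ.nat 0) X).card = σ.nat 8 → X ∈ C) ∧
      (∀ X, τ.nat (64 + 4 * X) ≤ σ.nat 5 + 1 ∧ (τ.nat (64 + 4 * X) = σ.nat 5 + 1 ↔ X ∈ C)) ∧
      queryLog τ = queryLog σ ++ C.map fun X => (σ.nat 6, X, σ.nat 12))
    ⌈σ.real 10⌉₊ (codewordOps (σ.nat 0) (σ.nat 3) (σ.nat 4)) ?_ ?_ ?_ ?_
  · refine ⟨by simp, (LowFrame.refl _ _ σ).setNat _, [], by simp, by simp, by simp, by simp, ?_, ?_⟩
    · intro X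
      have := hv X
      simp only [Function.update_of_ne (show 64 + 4 * X ≠ 13 by omega), List.not_mem_nil, iff_false]
      omega
    · rw [((Frame.refl [13] [] σ).setNat _).queryLog_eq (by decide)]
      simp
  · rintro m hm τ ⟨h13, hf, C, hC1, hC2, hC3, hC4, hC5, hC6⟩
    have r10 := hf.real 10 (by decide)
    have e0 := hf.nat 0 (by decide) (by decide)
    have e2 := hf.nat 2 (by decide) (by decide)
    have e3 := hf.nat 3 (by decide) (by decide)
    have e4 := hf.nat 4 (by decide) (by decide)
    have e5 := hf.nat 5 (by decide) (by decide)
    have e6 := hf.nat 6 (by decide) (by decide)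
    have e8 := hf.nat 8 (by decide) (by decide)
    have e12 := hf.nat 12 (by decide) (by decide)
    have hX := codeMask_lt (σ.nat 2) (σ.nat 3) (σ.nat 4) (σ.nat 0) m
    set X := codeMask (σ.nat 2) (σ.nat 3) (σ.nat 4) (σ.nat 0) m with hXe
    refine ⟨?_, ?_⟩
    · simpa [r10, h13] using Nat.lt_ceil.1 hm
    refine (does_codewordProg τ (by rw [e3, e2, hs]) C (by rw [e5]; exact hC5) X
      (by rw [e2, e3, e4, e0, h13])).mono ?_
    rintro τ₁ p ⟨hp, g13, hf₁, D, hD, hC5', hC6'⟩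
    rw [e5] at hC5'
    rw [e0, e8] at hD
    rw [e0, e3, e4] at hp
    refine ⟨hp, by rw [g13, h13], hf.trans hf₁, C ++ D, ?_, ?_, ?_, ?_, hC5', ?_⟩
    · rw [hD]; split_ifs with h
      · exact hC1.append (List.nodup_singleton _) (by simpa using h.2)
      · simpa using hC1
    · rw [hD]; split_ifs with h <;> simp <;> omega
    · intro Z hZ
      rcases List.mem_append.1 hZ with hZ | hZ
      · exact hC3 Z hZ
      · rw [hD] at hZ
        split_ifs at hZ with h
        · rw [List.mem_singleton.1 hZ]; exact ⟨hX, h.1⟩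
        · simp at hZ
    · intro z hz Z hZ hcard
      rcases Nat.lt_succ_iff_lt_or_eq.1 hz with hz | rfl
      · exact List.mem_append_left _ (hC4 z hz Z hZ hcard)
      · rw [← hXe] at hZ
        rw [hZ] at hcard ⊢
        by_cases h : X ∈ C
        · exact List.mem_append_left _ h
        · rw [hD, if_pos ⟨hcard, h⟩]; simp
    · rw [hC6', hC6, e6, e12, List.map_append, List.append_assoc]
  · rintro τ ⟨h13, hf, -⟩
    have r10 := hf.real 10 (by decide)
    simpa [r10, h13] using Nat.le_ceil (σ.real 10)
  · rintro τ p ⟨h13, hf, C, hC1, hC2, hC3, hC4, hC5, hC6⟩ hp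
    refine ⟨?_, hf, fun X => (hC5 X).1, C, hC1, hC2, hC3, fun z hz => hC4 z (Nat.lt_ceil.2 hz), hC6⟩
    simp at hp ⊢
    rw [add_one_mul]
    have h1 : ⌈σ.real 10⌉₊ * (7 + codewordOps (σ.nat 0) (σ.nat 3) (σ.nat 4)) ≤
      ⌈σ.real 10⌉₊ * (codewordOps (σ.nat 0) (σ.nat 3) (σ.nat 4) + 20) :=
      Nat.mul_le_mul_left _ (by omega)
    omega

/-! ### One round -/

/-- Make the list of the queries of one round. -/
def roundProg (L : Finset (ℝ × ℝ)) (β : ℝ) : Prog L :=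
  .seq (.assign 10 (.const 0))
  (.seq (bestSamplingProg β Finset.univ.toList)
  (.seq (bestIntersectionProg L)
  (.seq (extensionSizeProg L)
  (.seq (codeBoundProg L)
  (familyProg L)))))

/-- The operations needed for one round, apart from a factor for the number of codewords. -/
def roundOps (L : Finset (ℝ × ℝ)) (n s tb : ℕ) : ℕ :=
  2000 * (L.card + 1) * (n + 1) ^ 3 + codewordOps n s tb

/-- The list `l` consists of the queries of round `k`, encoded as numbers, and has at most `N`
entries, where `N` is `H` times the optimal number, rounded up. -/
def IsCodedRound (L : Finset (ℝ × ℝ)) (n : ℕ) (β : ℝ) (k : ℕ) (H : ℝ) (N : ℕ)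
    (l : List (ℕ × ℕ × ℕ)) : Prop :=
  ∃ (j : L) (t y : ℕ) (C : List ℕ), IsBestSampling n β k j t ∧
    IsBestIntersection n k t (threshold j.1.1 β k t) y ∧
    IsSetIntersectionFamily n k t y (C.map (decode n)) ∧
    l = C.map (fun X => (specIdx j, X, ((k : ℤ) - ⌈threshold j.1.1 β k t⌉).toNat)) ∧
    C.length ≤ N ∧ N = ⌈kappa n k t y * H⌉₊

abbrev searchCells : List ℕ := [6, 7, 8, 9, 10, 12, 30, 31, 32]

abbrev roundCells : List ℕ := [6, 7, 8, 9, 10, 12, 13, 14, 15, 16, 17, 18, 19, 20, 21, 22, 23, 25,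
  26, 27, 28, 29, 30, 31, 32, 36]

abbrev realCells : List ℕ := [1, 2, 3, 4, 5, 6, 7, 8, 9, 10, 11]

/-- The code needs the exponent `⌊n / s⌋`; the program computes the bound with a real quotient,
which is only larger. -/
theorem codeLength_le_overhead (n s tb : ℕ) :
    (2 : ℝ) ^ (tb + s) * (16 * ((s : ℝ) + 1) ^ 7) ^ (n / s) ≤ overhead n s tb := by
  have h1 : (1 : ℝ) ≤ 16 * ((s : ℝ) + 1) ^ 7 := by
    have : (1 : ℝ) ≤ ((s : ℝ) + 1) ^ 7 := one_le_pow₀ (by linarith [s.cast_nonneg (α := ℝ)])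
    linarith
  rw [overhead, ← Real.rpow_natCast _ (n / s)]
  exact mul_le_mul_of_nonneg_left (Real.rpow_le_rpow_of_exponent_le h1 Nat.cast_div_le)
    (by positivity)

theorem overhead_nonneg (n s tb : ℕ) : 0 ≤ overhead n s tb := by rw [overhead]; positivity

theorem does_roundProg {L : Finset (ℝ × ℝ)} (hL : IsSpecList L) {β : ℝ} (hβ : 1 ≤ β) {n k : ℕ}
    (hk : β * k ≤ n) (σ : State) (h0 : σ.nat 0 = n) (h5 : σ.nat 5 = k)
    (hs : σ.nat 3 = 2 ^ σ.nat 2) (htb : σ.nat 4 = 2 ^ (6 * σ.nat 3))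
    (hv : ∀ X, σ.nat (64 + 4 * X) ≤ k) :
    Does β (roundProg L β) σ fun σ' p =>
      LowFrame roundCells realCells σ σ' ∧ (∀ X, σ'.nat (64 + 4 * X) ≤ k + 1) ∧
      ∃ N l, IsCodedRound L n β k (overhead n (σ.nat 3) (σ.nat 4)) N l ∧
        p ≤ (N + 2) * roundOps L n (σ.nat 3) (σ.nat 4) ∧ queryLog σ' = queryLog σ ++ l := by
  refine Does.seq (Does.assign (Does.seq ((does_bestSamplingProg hL hk hβ _ (fun _ _ => False) _
    (by simpa using h0) (by simpa using h5) ⟨by simp, by simp⟩).mono ?_)))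
  rintro τ₁ p₁ ⟨hp₁, hbest, hf₁⟩
  have F₁ : Frame [6, 7, 8, 9, 10, 30, 31, 32] realCells σ τ₁ :=
    ((Frame.refl _ _ σ).setNat _).trans hf₁
  have e0 : τ₁.nat 0 = n := by rw [F₁.nat 0 (by decide), h0]
  have e5 : τ₁.nat 5 = k := by rw [F₁.nat 5 (by decide), h5]
  have h10 : τ₁.nat 10 ≠ 0 := by
    -- An empty record would mean that no admissible parameters exist, contrary to
    -- `admissible_floor`.
    intro h10
    obtain ⟨j, hj⟩ := hL.1
    exact hbest.none h10 ⟨j, hj⟩ ⌊β * k⌋₊ (Or.inr ⟨by simp, by omega⟩) (admissible_floor hβ k)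
  obtain ⟨j, h6, hadm, h7r, h8r, hmin⟩ := hbest.some h10
  set t := τ₁.nat 7 with ht
  set x := threshold j.1.1 β k t with hx
  have hα : 1 ≤ j.1.1 := (hL.2 _ j.2).1
  have hbs : IsBestSampling n β k j t := by
    refine ⟨hadm, fun i s his => hmin i s (Or.inr ⟨by simp, ?_⟩) his⟩
    exact Nat.lt_succ_of_le (Nat.le_floor his.2)
  have htn : t ≤ n := hadm.le_card hk
  refine Does.seq ((does_bestIntersectionProg τ₁ (by rw [e0]; exact htn) ?_).mono ?_)
  · rw [h8r, e5]; exact threshold_le_min hα hβ hadm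
  rw [e0, e5, h8r]
  rintro τ₂ p₂ ⟨hp₂, ⟨y, hy, hkap⟩, h8, hf₂⟩
  have F₂ := (F₁.mono (S := searchCells) (R := realCells)).trans hf₂
  have g8 : τ₂.real 8 = x := by rw [hf₂.real 8 (by decide), h8r]
  have g5 : τ₂.nat 5 = k := by rw [hf₂.nat 5 (by decide), e5]
  have hthr : k - x = (β * k - t) / j.1.1 := by rw [hx, threshold_eq hα]; ring
  refine Does.seq ((does_extensionSizeProg τ₂).mono ?_)
  rw [g8, g5, hthr, ← toNat_sub_ceil hα]
  rintro τ₃ p₃ ⟨hp₃, h12, hf₃⟩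
  have F₃ := F₂.trans hf₃
  refine Does.seq ((does_codeBoundProg τ₃).mono ?_)
  rw [hf₃.real 9 (by decide), F₃.nat 0 (by decide), F₃.nat 3 (by decide), F₃.nat 4 (by decide),
    hkap, h0]
  rintro τ₄ p₄ ⟨hp₄, h10r, hf₄⟩
  have F₄ := F₃.trans hf₄
  refine (does_familyProg τ₄ (by rw [F₄.nat 3 (by decide), F₄.nat 2 (by decide), hs]) ?_).mono ?_
  · intro X
    rw [F₄.nat 5 (by decide), h5, F₄.nat_of_le (by decide) (by omega)]
    exact hv X
  rw [h10r, F₄.nat 0 (by decide), F₄.nat 2 (by decide), F₄.nat 3 (by decide), F₄.nat 4 (by decide),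
    F₄.nat 5 (by decide), h0, h5]
  rintro τ₅ p₅ ⟨hp₅, hf₅, hv₅, C, hC1, hC2, hC3, hC4, hC5⟩
  have i6 : τ₄.nat 6 = specIdx j := by
    rw [hf₄.nat 6 (by decide), hf₃.nat 6 (by decide), hf₂.nat 6 (by decide), h6]
  have i8 : τ₄.nat 8 = t := by
    rw [hf₄.nat 8 (by decide), hf₃.nat 8 (by decide), h8]
  have i12 := hf₄.nat 12 (by decide)
  rw [i6, i12, h12] at hC5
  rw [i8] at hC3 hC4
  refine ⟨((LowFrame.refl _ _ σ).trans F₄.low).trans hf₅, hv₅, _, _, ⟨j, t, y, C, hbs, hy, ⟨?_, ?_, ?_⟩, rfl, hC2, rfl⟩, ?_, ?_⟩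
  · exact hC1.map_on fun a ha b hb h => decode_injOn (hC3 a ha).1 (hC3 b hb).1 h
  · intro X hX
    obtain ⟨a, ha, rfl⟩ := List.mem_map.1 hX
    exact (hC3 a ha).2
  -- The code provides a codeword below the bound whose set works for `T`, and this set has been
  -- listed.
  · intro T hT
    obtain ⟨z, hz, hzt, hzy⟩ := exists_codeMask (w := σ.nat 2) (k := k) (y := y) (t := t) hs htb
      (hy.1.2.trans (min_le_left _ _)) (hy.1.2.trans (min_le_right _ _))
      (add_le_add_of_threshold_le hα hadm hk hy.1.1) T hT
    refine ⟨_, List.mem_map_of_mem (hC4 z (hz.trans_le ?_) _ rfl hzt), hzy⟩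
    exact mul_le_mul_of_nonneg_left (codeLength_le_overhead _ _ _) (by rw [kappa]; positivity)
  · set N := ⌈kappa n k t y * overhead n (σ.nat 3) (σ.nat 4)⌉₊
    have hl : ((k : ℤ) - ⌈threshold j.1.1 β k t⌉).toNat ≤ n := by
      rw [toNat_sub_ceil hα]
      refine Nat.floor_le_of_le (le_trans ?_ hk)
      have h1 : (β * k - t) / j.1.1 ≤ β * k - t := div_le_self (by linarith [hadm.2]) hα
      linarith [t.cast_nonneg (α := ℝ)]
    have hA : n + 1 ≤ (n + 1) ^ 3 := Nat.le_self_pow (by norm_num) _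
    have hB : (n + 1) ^ 2 ≤ (n + 1) ^ 3 := Nat.pow_le_pow_right (by omega) (by norm_num)
    have hm : (Finset.univ : Finset L).toList.length = L.card := by simp
    rw [hm] at hp₁
    have h2 : roundOps L n (σ.nat 3) (σ.nat 4) = 2 * (L.card * (1000 * (n + 1) ^ 3)) +
        2000 * (n + 1) ^ 3 + codewordOps n (σ.nat 3) (σ.nat 4) := by rw [roundOps]; ring
    have h3 : (N + 1) * (codewordOps n (σ.nat 3) (σ.nat 4) + 20) ≤
        (N + 1) * roundOps L n (σ.nat 3) (σ.nat 4) := Nat.mul_le_mul_left _ (by omega)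
    have h4 : (N + 2) * roundOps L n (σ.nat 3) (σ.nat 4) =
        (N + 1) * roundOps L n (σ.nat 3) (σ.nat 4) + roundOps L n (σ.nat 3) (σ.nat 4) := by ring
    simp only [NExp.ops]
    omega
  · rw [hC5, F₄.queryLog_eq (by decide)]

/-! ### The list of all queries -/

/-- Powers of prices are at least `1`, so the sampling cost also controls the bare number of
queries, and with it the number of operations. -/
theorem kappa_le_of_isBestIntersection {L : Finset (ℝ × ℝ)} (hL : IsSpecList L) {β : ℝ}
    (hβ : 1 ≤ β) {n k t y : ℕ} {j : L} (hk : β * k ≤ n) (h : Admissible j.1.1 β k t)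
    (hy : IsBestIntersection n k t (threshold j.1.1 β k t) y) :
    kappa n k t y ≤ (n + 1) * samplingCost n β k j.1 t := by
  obtain ⟨hα, hc⟩ := hL.2 _ j.2
  have h1 := kappa_mul_hyper_le hα hβ h hk hy
  have h2 := hyper_pos_of_admissible hα hβ h hk
  have h3 : 1 ≤ j.1.2 ^ ((β * k - t) / j.1.1) :=
    Real.one_le_rpow hc (div_nonneg (by linarith [h.2]) (by linarith))
  rw [samplingCost, ← mul_div_assoc, le_div_iff₀ h2]
  nlinarith

/-- The bound `V` holds for all optimal sampling costs. -/
def BoundsSampling (L : Finset (ℝ × ℝ)) (n : ℕ) (β V : ℝ) : Prop :=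
  ∀ (k : ℕ) (j : L) (t : ℕ), β * k ≤ n → IsBestSampling n β k j t → samplingCost n β k j.1 t ≤ V

/-- A bound for the number of queries of a round. -/
def roundLength (n s tb : ℕ) (V : ℝ) : ℕ := ⌈(n + 1) * V * overhead n s tb⌉₊

theorem ceil_kappa_le_roundLength {L : Finset (ℝ × ℝ)} (hL : IsSpecList L) {β V : ℝ} (hβ : 1 ≤ β)
    {n k t y s tb : ℕ} {j : L} (hV : BoundsSampling L n β V) (hk : β * k ≤ n)
    (hbs : IsBestSampling n β k j t)
    (hy : IsBestIntersection n k t (threshold j.1.1 β k t) y) :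
    ⌈kappa n k t y * overhead n s tb⌉₊ ≤ roundLength n s tb V := by
  refine Nat.ceil_mono (mul_le_mul_of_nonneg_right ?_ (overhead_nonneg _ _ _))
  refine (kappa_le_of_isBestIntersection hL hβ hk hbs.1 hy).trans ?_
  gcongr
  exact hV k j t hk hbs

theorem IsCodedRound.le_roundLength {L : Finset (ℝ × ℝ)} (hL : IsSpecList L) {β V : ℝ} (hβ : 1 ≤ β)
    {n k s tb N : ℕ} {l : List (ℕ × ℕ × ℕ)} (hV : BoundsSampling L n β V) (hk : β * k ≤ n)
    (h : IsCodedRound L n β k (overhead n s tb) N l) : N ≤ roundLength n s tb V := by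
  obtain ⟨j, t, y, C, hbs, hy, -, -, -, rfl⟩ := h
  exact ceil_kappa_le_roundLength hL hβ hV hk hbs hy

/-- List the queries of all rounds. -/
def roundsProg (L : Finset (ℝ × ℝ)) (β : ℝ) : Prog L :=
  .loop (.realLe (.mul .beta (.cast (.var 5))) (.cast (.var 0)))
    (.seq (roundProg L β) (.assign 5 (.add (.var 5) (.const 1))))

/-- The program tests `β k ≤ n`, whereas the scheme counts the rounds by a floor. -/
theorem mul_le_iff_lt {β : ℝ} (hβ : 1 ≤ β) (n k : ℕ) :
    β * k ≤ n ↔ k < ⌊(n : ℝ) / β⌋₊ + 1 := by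
  rw [Nat.lt_succ_iff, Nat.le_floor_iff (by positivity), le_div_iff₀ (by linarith), mul_comm]

abbrev listCells : List ℕ := [5, 6, 7, 8, 9, 10, 12, 13, 14, 15, 16, 17, 18, 19, 20, 21, 22, 23,
  25, 26, 27, 28, 29, 30, 31, 32, 36]

theorem does_roundsProg {L : Finset (ℝ × ℝ)} (hL : IsSpecList L) {β V : ℝ} (hβ : 1 ≤ β) {n s tb : ℕ}
    (hV : BoundsSampling L n β V) (σ : State) (h0 : σ.nat 0 = n) (h3 : σ.nat 3 = s)
    (h4 : σ.nat 4 = tb) (hs : s = 2 ^ σ.nat 2) (htb : tb = 2 ^ (6 * s)) (h5 : σ.nat 5 = 0)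
    (h14 : σ.nat 14 = 0) (hv : ∀ X, σ.nat (64 + 4 * X) = 0) :
    Does β (roundsProg L β) σ fun σ' p =>
      p ≤ (n + 2) * ((roundLength n s tb V + 2) * roundOps L n s tb + 20) ∧ σ'.nat 0 = n ∧
      ∃ g : ℕ → List (ℕ × ℕ × ℕ),
        (∀ k : ℕ, β * k ≤ n → ∃ N, IsCodedRound L n β k (overhead n s tb) N (g k)) ∧
        queryLog σ' = (List.range (⌊(n : ℝ) / β⌋₊ + 1)).flatMap g := by
  set K := ⌊(n : ℝ) / β⌋₊ + 1 with hK
  refine Does.loop (fun m τ => τ.nat 5 = m ∧ LowFrame listCells realCells σ τ ∧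
      (∀ X, τ.nat (64 + 4 * X) ≤ m) ∧ ∃ g : ℕ → List (ℕ × ℕ × ℕ),
        (∀ k < m, ∃ N, IsCodedRound L n β k (overhead n s tb) N (g k)) ∧
        queryLog τ = (List.range m).flatMap g) K
    ((roundLength n s tb V + 2) * roundOps L n s tb + 6) ?_ ?_ ?_ ?_
  · refine ⟨h5, LowFrame.refl _ _ _, fun X => (hv X).le, fun _ => [], by simp, ?_⟩
    simp [queryLog, h14]
  · rintro m hm τ ⟨e5, hf, hv', g, hg, hlog⟩
    have e0 := hf.nat 0 (by decide) (by decide)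
    have e2 := hf.nat 2 (by decide) (by decide)
    have e3 := hf.nat 3 (by decide) (by decide)
    have e4 := hf.nat 4 (by decide) (by decide)
    have hk := (mul_le_iff_lt hβ n m).2 hm
    refine ⟨by simpa [e5, e0, h0] using hk, Does.seq ((does_roundProg hL hβ hk τ (by rw [e0, h0]) e5
      (by rw [e3, e2, h3, hs]) (by rw [e4, e3, h3, h4, htb]) hv').mono ?_)⟩
    rw [e3, e4, h3, h4]
    rintro τ₁ p ⟨hf₁, hv₁, N, l, hl, hp, hlog₁⟩
    refine Does.assign ⟨?_, ?_, ?_, ?_, fun k => if k = m then l else g k, ?_, ?_⟩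
    · have h1 : (N + 2) * roundOps L n s tb ≤ (roundLength n s tb V + 2) * roundOps L n s tb :=
        Nat.mul_le_mul_right _ (by have := hl.le_roundLength hL hβ hV hk; omega)
      simp
      omega
    · simp [hf₁.nat 5 (by decide) (by decide), e5]
    · exact (hf.trans hf₁).setNat _
    · intro X
      simpa only [Function.update_of_ne (show 64 + 4 * X ≠ 5 by omega)] using hv₁ X
    · intro k hk
      by_cases hkm : k = m
      · subst hkm; exact ⟨N, by simpa using hl⟩
      · simpa [hkm] using hg k (by omega)
    · rw [((Frame.refl [5] [] τ₁).setNat _).queryLog_eq (by decide), hlog₁, hlog, List.range_succ,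
        List.flatMap_append]
      congr 1
      · refine List.flatMap_congr fun k hk => ?_
        rw [if_neg (by rw [List.mem_range] at hk; omega)]
      · simp
  · rintro τ ⟨e5, hf, -⟩
    have e0 := hf.nat 0 (by decide) (by decide)
    have := (mul_le_iff_lt hβ n K).not.2 (by omega)
    simpa [e5, e0, h0] using this
  · rintro τ p ⟨e5, hf, -, g, hg, hlog⟩ hp
    refine ⟨?_, by rw [hf.nat 0 (by decide) (by decide), h0], g,
      fun k hk => hg k ((mul_le_iff_lt hβ n k).1 hk), hlog⟩
    have hKn : K ≤ n + 1 := by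
      have : β * (K - 1 : ℕ) ≤ n := (mul_le_iff_lt hβ n _).2 (by omega)
      have := le_of_mul_le hβ this
      omega
    simp at hp
    set R := (roundLength n s tb V + 2) * roundOps L n s tb
    have h1 : K * (9 + (R + 6)) ≤ (n + 1) * (R + 20) := Nat.mul_le_mul hKn (by omega)
    have h2 : (n + 2) * (R + 20) = (n + 1) * (R + 20) + (R + 20) := by ring
    omega

/-! ### The size of the tables -/

/-- Blocks of size `s` are suitable for a universe of size `n`. -/
def IsTableSize (n s : ℕ) : Prop :=
  (∃ w, s = 2 ^ w) ∧ n < 2 ^ (32 * s) ∧ (s = 1 ∨ 2 ^ (16 * s) ≤ n)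

theorem IsTableSize.le {n s : ℕ} (h : IsTableSize n s) : s ≤ n + 1 := by
  rcases h.2.2 with h | h
  · omega
  · have := Nat.lt_two_pow_self (n := 16 * s)
    omega

/-- Choose the size of the blocks. -/
def blockSizeProg (L : Finset (ℝ × ℝ)) : Prog L :=
  .seq (.assign 3 (.const 1))
  (.loop (.realLe (.pow (.cast (.const 2)) (.mul (.cast (.const 32)) (.cast (.var 3))))
      (.cast (.var 0)))
    (.seq (.assign 2 (.add (.var 2) (.const 1))) (.assign 3 (.add (.var 3) (.var 3)))))

/-- Doubling `s` until `n < 2 ^ (32 s)`: the last failed test shows `2 ^ (16 s) ≤ n`, unless `s = 1`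
succeeds at once. The lower bound on `n` pays for tables and decoding; the upper bound forces `s` to
grow with `n`. -/
theorem does_blockSizeProg {L : Finset (ℝ × ℝ)} {β : ℝ} (σ : State) (h2 : σ.nat 2 = 0) :
    Does β (blockSizeProg L) σ fun σ' p => p ≤ 50 * (σ.nat 0 + 2) ∧ IsTableSize (σ.nat 0) (σ'.nat 3) ∧
      σ'.nat 3 = 2 ^ σ'.nat 2 ∧ Frame [2, 3] [] σ σ' := by
  set n := σ.nat 0 with hn
  have hex : ∃ w, n < 2 ^ (32 * 2 ^ w) := ⟨n, Nat.lt_two_pow_self.trans_le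
    (Nat.pow_le_pow_right (by norm_num) (by have := Nat.lt_two_pow_self (n := n); omega))⟩
  have hpow : ∀ m : ℕ, (2 : ℝ) ^ ((32 : ℝ) * ((2 ^ m : ℕ) : ℝ)) = ((2 ^ (32 * 2 ^ m) : ℕ) : ℝ) := by
    intro m
    rw [show (32 : ℝ) * ((2 ^ m : ℕ) : ℝ) = ((32 * 2 ^ m : ℕ) : ℝ) by push_cast; ring,
      Real.rpow_natCast]
    push_cast; rfl
  refine Does.seq (Does.assign ?_)
  refine Does.loop (fun m τ => τ.nat 2 = m ∧ τ.nat 3 = 2 ^ m ∧ Frame [2, 3] [] σ τ)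
    (Nat.find hex) 20 ?_ ?_ ?_ ?_
  · exact ⟨by simp [h2], by simp, (Frame.refl _ _ σ).setNat _⟩
  · rintro m hm τ ⟨h1, h3, hf⟩
    have e0 := hf.nat 0 (by decide)
    refine ⟨?_, Does.seq (Does.assign (Does.assign ⟨by simp, by simp [h1], ?_,
      (hf.setNat _).setNat _⟩))⟩
    · have := Nat.find_min hex hm
      simp only [BExp.Holds, RExp.eval, NExp.eval, h3, Nat.cast_ofNat, zero_lt_two, if_true, hpow, e0]
      exact_mod_cast not_lt.1 this
    · simp [h3, pow_succ]; omega
  · rintro τ ⟨h1, h3, hf⟩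
    have e0 := hf.nat 0 (by decide)
    have := Nat.find_spec hex
    simp only [BExp.Holds, RExp.eval, NExp.eval, h3, Nat.cast_ofNat, zero_lt_two, if_true, hpow, e0,
      not_le]
    exact_mod_cast this
  · rintro τ p ⟨h1, h3, hf⟩ hp
    have hts : IsTableSize n (τ.nat 3) := by
      refine ⟨⟨_, h3⟩, by rw [h3]; exact Nat.find_spec hex, ?_⟩
      rw [h3]
      rcases Nat.eq_zero_or_pos (Nat.find hex) with h0 | h0
      · left; rw [h0, pow_zero]
      · right
        have h4 := not_lt.1 (Nat.find_min hex (Nat.sub_lt h0 one_pos))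
        obtain ⟨m, hm⟩ := Nat.exists_eq_succ_of_ne_zero h0.ne'
        rw [hm] at h4 ⊢
        rw [show 16 * 2 ^ (m + 1) = 32 * 2 ^ m by ring]
        simpa using h4
    refine ⟨?_, hts, by rw [h1, h3], hf⟩
    have h5 := hts.le
    have h6 := Nat.lt_two_pow_self (n := Nat.find hex)
    rw [← h3] at h6
    simp at hp ⊢
    omega

/-- Choose the sizes of the blocks and of the table. -/
def tableSizeProg (L : Finset (ℝ × ℝ)) : Prog L :=
  .seq (blockSizeProg L)
  (.seq (.assign 4 (.const 1))
  (.seq (.assign 13 (.add (.add (.var 3) (.var 3)) (.add (.add (.var 3) (.var 3))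
    (.add (.var 3) (.var 3)))))
  (.loop (.pos 13)
    (.seq (.assign 4 (.add (.var 4) (.var 4))) (.assign 13 (.sub (.var 13) (.const 1)))))))

theorem does_tableSizeProg {L : Finset (ℝ × ℝ)} {β : ℝ} (σ : State) (h2 : σ.nat 2 = 0) :
    Does β (tableSizeProg L) σ fun σ' p => p ≤ 500 * (σ.nat 0 + 2) ∧
      IsTableSize (σ.nat 0) (σ'.nat 3) ∧ σ'.nat 3 = 2 ^ σ'.nat 2 ∧ σ'.nat 4 = 2 ^ (6 * σ'.nat 3) ∧
      Frame [2, 3, 4, 13] [] σ σ' := by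
  refine Does.seq ((does_blockSizeProg σ h2).mono ?_)
  rintro τ₁ p₁ ⟨hp₁, hts, h3, hf₁⟩
  refine Does.seq (Does.assign (Does.seq (Does.assign ?_)))
  refine Does.loop (fun m τ => τ.nat 4 = 2 ^ m ∧ τ.nat 13 + m = 6 * τ₁.nat 3 ∧
    Frame [4, 13] [] τ₁ τ) (6 * τ₁.nat 3) 20 ?_ ?_ ?_ ?_
  · exact ⟨by simp, by simp; ring, ((Frame.refl _ _ τ₁).setNat _).setNat _⟩
  · rintro m hm τ ⟨h4, h13, hf⟩
    refine ⟨by simp; omega, Does.seq (Does.assign (Does.assign ⟨by simp, by simp [h4, pow_succ]; omega,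
      by simp; omega, (hf.setNat _).setNat _⟩))⟩
  · rintro τ ⟨h4, h13, hf⟩
    simp; omega
  · rintro τ p ⟨h4, h13, hf⟩ hp
    have e3 := hf.nat 3 (by decide)
    have h5 := hts.le
    refine ⟨?_, by rwa [e3], by rw [e3, hf.nat 2 (by decide), h3], by rw [h4, e3],
      (hf₁.mono).trans hf⟩
    simp at hp ⊢
    omega

/-- List all queries. -/
def listProg (L : Finset (ℝ × ℝ)) (β : ℝ) : Prog L := .seq (tableSizeProg L) (roundsProg L β)

/-- A bound for the operations needed for the list. -/
def listOps (L : Finset (ℝ × ℝ)) (n s : ℕ) (V : ℝ) : ℕ :=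
  (n + 2) * ((roundLength n s (2 ^ (6 * s)) V + 2) * roundOps L n s (2 ^ (6 * s)) + 520)

theorem does_listProg {L : Finset (ℝ × ℝ)} (hL : IsSpecList L) {β V : ℝ} (hβ : 1 ≤ β) {n : ℕ}
    (hV : BoundsSampling L n β V) :
    Does β (listProg L β) (initial n) fun σ' p => ∃ s, IsTableSize n s ∧ p ≤ listOps L n s V ∧
      σ'.nat 0 = n ∧ ∃ g : ℕ → List (ℕ × ℕ × ℕ),
        (∀ k : ℕ, β * k ≤ n → ∃ N, IsCodedRound L n β k (overhead n s (2 ^ (6 * s))) N (g k)) ∧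
        queryLog σ' = (List.range (⌊(n : ℝ) / β⌋₊ + 1)).flatMap g := by
  have i0 : (initial n).nat 0 = n := by simp [initial]
  have i1 : ∀ x, x ≠ 0 → (initial n).nat x = 0 := fun x hx => by simp [initial, hx]
  refine Does.seq ((does_tableSizeProg _ (i1 2 (by decide))).mono ?_)
  rw [i0]
  rintro τ₁ p₁ ⟨hp₁, hts, hs, htb, hf⟩
  refine (does_roundsProg hL hβ hV τ₁ (by rw [hf.nat 0 (by decide), i0]) rfl htb hs rfl
    (by rw [hf.nat 5 (by decide), i1 5 (by decide)])
    (by rw [hf.nat 14 (by decide), i1 14 (by decide)]) ?_).mono ?_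
  · intro X
    rw [hf.nat_of_le (by decide) (by omega), i1 _ (by omega)]
  · rintro τ₂ p₂ ⟨hp₂, h0, g, hg, hlog⟩
    refine ⟨_, hts, ?_, h0, g, hg, hlog⟩
    rw [listOps]
    have h1 : ∀ R : ℕ, (n + 2) * (R + 520) = (n + 2) * (R + 20) + 500 * (n + 2) := fun R => by ring
    rw [h1]
    omega

/-! ### Asking the queries of the list -/

/-- The counterpart of `Does.loop` for bodies with queries: the invariant also speaks of the queries
made so far. -/
theorem Exec.exists_loop {L : Finset (ℝ × ℝ)} {n : ℕ} {β : ℝ} {O : L → Oracle n} {ω : ℕ → Bool}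
    {b : BExp L} {P : Prog L} {σ : State} (I : ℕ → State → List (Query L n) → Prop) (N c : ℕ)
    (h0 : I 0 σ [])
    (hstep : ∀ i < N, ∀ τ tr, I i τ tr → b.Holds β τ.nat τ.real ∧
      ∃ τ' p us, Exec β O ω P τ τ' p us ∧ p ≤ c ∧ I (i + 1) τ' (tr ++ us))
    (hend : ∀ τ tr, I N τ tr → ¬ b.Holds β τ.nat τ.real) :
    ∃ τ p tr, Exec β O ω (.loop b P) σ τ p tr ∧ p ≤ N * (b.ops + c) + b.ops ∧ I N τ tr := by
  suffices h : ∀ m i τ tr, i + m = N → I i τ tr → ∃ τ' p us, Exec β O ω (.loop b P) τ τ' p us ∧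
      p ≤ m * (b.ops + c) + b.ops ∧ I N τ' (tr ++ us) by
    simpa using h N 0 σ [] (by omega) h0
  intro m
  induction m with
  | zero =>
    intro i τ tr hi hI
    obtain rfl : i = N := by omega
    exact ⟨τ, _, [], .loopDone (hend τ tr hI), by omega, by simpa using hI⟩
  | succ m ih =>
    intro i τ tr hi hI
    obtain ⟨hb, τ₁, p, us, he, hpc, hI'⟩ := hstep i (by omega) τ tr hI
    obtain ⟨τ₂, q, vs, he', hq, hI''⟩ := ih (i + 1) τ₁ _ (by omega) hI'
    refine ⟨τ₂, _, us ++ vs, .loopStep hb he he', ?_, by simpa using hI''⟩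
    rw [add_one_mul]
    omega

/-- Put query number `i` to the oracle whose number is in cell `37`, where `i` is in cell `33`. -/
def askProg {L : Finset (ℝ × ℝ)} (js : List L) : Prog L :=
  js.foldr (fun j P => .ite (.and (.natLe (.var 37) (.const (specIdx j)))
    (.natLe (.const (specIdx j)) (.var 37)))
    (.query j (.load (arr 1 (.var 33))) (.load (arr 3 (.var 33))) (.const 35)) P) .skip

theorem exec_askProg {L : Finset (ℝ × ℝ)} {n : ℕ} {β : ℝ} (O : L → Oracle n) (ω : ℕ → Bool)
    (σ : State) (j : L) (h : σ.nat 37 = specIdx j) (js : List L) (hj : j ∈ js) :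
    ∃ p Y, Exec β O ω (askProg js) σ
      ⟨Function.update σ.nat 35 (encode Y), σ.real, σ.pos + (O j).bits⟩ p
      [⟨j, decode n (σ.nat (65 + 4 * σ.nat 33)), σ.nat (67 + 4 * σ.nat 33), Y⟩] ∧
      p ≤ 20 * js.length + 100 := by
  induction js with
  | nil => simp at hj
  | cons i js ih =>
    by_cases hij : i = j
    · subst hij
      have h1 : 65 + 4 * σ.nat 33 = (arr 1 (.var 33)).eval σ.nat := by simp [arr]; ring
      have h3 : 67 + 4 * σ.nat 33 = (arr 3 (.var 33)).eval σ.nat := by simp [arr]; ring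
      rw [h1, h3]
      refine ⟨_, _, .iteTrue (by simp [h]) (.query i (.load (arr 1 (.var 33)))
        (.load (arr 3 (.var 33))) (.const 35) σ _ rfl), ?_⟩
      simp [arr]
    · obtain ⟨p, Y, he, hp⟩ := ih (by simpa [Ne.symm hij] using hj)
      refine ⟨_, Y, .iteFalse ?_ he, ?_⟩
      · have := specIdx_injective.ne hij
        simp [h]; omega
      · simp; omega

/-- Deal with query number `i`, where `i` is in cell `33`. -/
def answerStep (L : Finset (ℝ × ℝ)) : Prog L :=
  .seq (.assign 37 (.load (arr 2 (.var 33))))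
  (.seq (askProg Finset.univ.toList)
  (.seq (.assign 28 (.load (arr 1 (.var 33))))
  (.seq (.assign 29 (.var 35))
  (.seq (unionProg L)
  (.seq (.ite (.natLe (.add (.var 25) (.const 1)) (.var 34))
    (.seq (.assign 1 (.var 26)) (.assign 34 (.var 25))) .skip)
  (.assign 33 (.add (.var 33) (.const 1))))))))

/-- A bound for the operations for one query. -/
def answerOps (L : Finset (ℝ × ℝ)) (n : ℕ) : ℕ := 20 * L.card + 100 * (n + 1) + 300

abbrev answerCells : List ℕ := [1, 25, 26, 27, 28, 29, 33, 34, 35, 36, 37]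

theorem exec_answerStep {L : Finset (ℝ × ℝ)} {n : ℕ} {β : ℝ} (O : L → Oracle n) (ω : ℕ → Bool)
    (σ : State) (h0 : σ.nat 0 = n) (j : L) (i : ℕ) (hi : σ.nat 33 = i)
    (h : σ.nat (66 + 4 * i) = specIdx j) :
    ∃ σ' p Y, Exec β O ω (answerStep L) σ σ' p
        [⟨j, decode n (σ.nat (65 + 4 * i)), σ.nat (67 + 4 * i), Y⟩] ∧
      p ≤ answerOps L n ∧ σ'.nat 33 = i + 1 ∧ Frame answerCells [] σ σ' ∧
      ((decode n (σ'.nat 1) = decode n (σ.nat (65 + 4 * i)) ∪ Y ∧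
          σ'.nat 34 = (decode n (σ.nat (65 + 4 * i)) ∪ Y).card ∧ σ'.nat 34 < σ.nat 34) ∨
        (σ'.nat 1 = σ.nat 1 ∧ σ'.nat 34 = σ.nat 34 ∧
          σ.nat 34 ≤ (decode n (σ.nat (65 + 4 * i)) ∪ Y).card)) := by
  subst hi
  set i := σ.nat 33 with hi
  set X := σ.nat (65 + 4 * i) with hX
  have a1 : ∀ M : ℕ → ℕ, M 33 = i → (arr 1 (.var 33)).eval M = 65 + 4 * i := by
    intro M hM; simp [arr, hM]; ring
  have a2 : (arr 2 (.var 33)).eval σ.nat = 66 + 4 * i := by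
    simp [arr, ← hi]; ring
  set σ₁ : State := ⟨Function.update σ.nat 37 (specIdx j), σ.real, σ.pos⟩ with hσ₁
  have F₁ : Frame answerCells [] σ σ₁ := (Frame.refl _ _ σ).setNat _
  have e₁ : Exec β O ω (.assign 37 (.load (arr 2 (.var 33)))) σ σ₁
      (1 + (NExp.load (arr 2 (.var 33))).ops + 1) [] := by
    have := Exec.setNat (β := β) (O := O) (ω := ω) (.const 37) (.load (arr 2 (.var 33))) σ
    simp only [NExp.eval, a2, h] at this
    exact this
  obtain ⟨p₂, Y, e₂, hp₂⟩ := exec_askProg (β := β) O ω σ₁ j (by simp [hσ₁]) Finset.univ.toList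
    (by simp)
  set σ₂ : State := ⟨Function.update σ₁.nat 35 (encode Y), σ₁.real, σ₁.pos + (O j).bits⟩ with hσ₂
  have F₂ : Frame answerCells [] σ σ₂ := by
    have := F₁.setNat (a := 35) (encode Y)
    exact ⟨this.nat, this.real⟩
  have g33 : σ₁.nat 33 = i := by simp [hσ₁, hi]
  rw [g33, F₁.nat_of_le (by decide) (by omega), F₁.nat_of_le (by decide) (by omega), ← hX] at e₂
  have k33 : σ₂.nat 33 = i := by simp [hσ₂, g33]
  have k34 : σ₂.nat 34 = σ.nat 34 := by simp [hσ₂, hσ₁]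
  have k1 : σ₂.nat 1 = σ.nat 1 := by simp [hσ₂, hσ₁]
  have k0 : σ₂.nat 0 = n := by simp [hσ₂, hσ₁, h0]
  have k35 : σ₂.nat 35 = encode Y := by simp [hσ₂]
  have kX : σ₂.nat (65 + 4 * i) = X := by rw [F₂.nat_of_le (by decide) (by omega)]
  have hrest : Does β (.seq (.assign 28 (.load (arr 1 (.var 33))))
      (.seq (.assign 29 (.var 35))
      (.seq (unionProg L)
      (.seq (.ite (.natLe (.add (.var 25) (.const 1)) (.var 34))
        (.seq (.assign 1 (.var 26)) (.assign 34 (.var 25))) .skip)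
      (.assign 33 (.add (.var 33) (.const 1))))))) σ₂ fun σ' p => p ≤ 100 * (n + 1) + 100 ∧
      σ'.nat 33 = i + 1 ∧ Frame answerCells [] σ₂ σ' ∧
      ((decode n (σ'.nat 1) = decode n X ∪ Y ∧
          σ'.nat 34 = (decode n X ∪ Y).card ∧ σ'.nat 34 < σ.nat 34) ∨
        (σ'.nat 1 = σ.nat 1 ∧ σ'.nat 34 = σ.nat 34 ∧ σ.nat 34 ≤ (decode n X ∪ Y).card)) := by
    refine Does.seq (Does.assign (Does.seq (Does.assign (Does.seq ((does_unionProg_of_eq (n := n)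
      (a := X) (b := encode Y) (by simp [k0]) (by simp [a1 _ k33, kX]) (by simp [k35])).mono ?_)))))
    rintro τ p ⟨hp, h26, h25, hf⟩
    rw [decode_encode] at h26 h25
    have F : Frame answerCells [] σ₂ τ := (((Frame.refl _ _ σ₂).setNat _).setNat _).trans hf
    have m33 : τ.nat 33 = i := by rw [hf.nat 33 (by decide)]; simp [k33]
    have m34 : τ.nat 34 = σ.nat 34 := by rw [hf.nat 34 (by decide)]; simp [k34]
    have m1 : τ.nat 1 = σ.nat 1 := by rw [hf.nat 1 (by decide)]; simp [k1]
    refine Does.seq (Does.ite ?_ ?_)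
    · intro hb
      simp [h25, m34] at hb
      refine Does.seq (Does.assign (Does.assign (Does.assign ⟨?_, by simp [m33],
        ((F.setNat _).setNat _).setNat _, Or.inl ⟨by simp [h26], by simp [h25], ?_⟩⟩)))
      · simp [arr]; omega
      · simp [h25]; omega
    · intro hb
      simp [h25, m34] at hb
      refine Does.skip (Does.assign ⟨?_, by simp [m33], F.setNat _, Or.inr ⟨by simp [m1],
        by simp [m34], by omega⟩⟩)
      simp [arr]; omega
  obtain ⟨σ₃, p₃, e₃, hp₃, h33, F₃, hor⟩ := hrest
  refine ⟨σ₃, _, Y, .seq e₁ (.seq e₂ (e₃ n O ω)), ?_, h33, F₂.trans F₃, hor⟩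
  rw [answerOps]
  simp [arr] at hp₂ ⊢
  omega

/-- Put all queries of the list, and store the best result in cell `1`. -/
def answerProg (L : Finset (ℝ × ℝ)) : Prog L :=
  .seq (.assign 34 (.add (.var 0) (.const 1)))
  (.seq (.assign 33 (.const 0))
  (.loop (.natLe (.add (.var 33) (.const 1)) (.var 14)) (answerStep L)))

theorem queryLog_getElem {σ : State} {i : ℕ} (h : i < (queryLog σ).length) :
    (queryLog σ)[i] = (σ.nat (66 + 4 * i), σ.nat (65 + 4 * i), σ.nat (67 + 4 * i)) := by
  simp [queryLog]

theorem exec_answerProg {L : Finset (ℝ × ℝ)} {n : ℕ} {β : ℝ} (O : L → Oracle n) (ω : ℕ → Bool)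
    (σ : State) (h0 : σ.nat 0 = n) (hl : ∀ e ∈ queryLog σ, ∃ j : L, e.1 = specIdx j)
    (hne : queryLog σ ≠ []) :
    ∃ σ' p tr, Exec β O ω (answerProg L) σ σ' p tr ∧
      p ≤ ((queryLog σ).length + 1) * (answerOps L n + 20) ∧
      tr.map (fun q => (specIdx q.j, q.X, q.ℓ)) =
        (queryLog σ).map (fun e => (e.1, decode n e.2.1, e.2.2)) ∧
      (∃ q ∈ tr, decode n (σ'.nat 1) = q.X ∪ q.Y) ∧
      ∀ q ∈ tr, (decode n (σ'.nat 1)).card ≤ (q.X ∪ q.Y).card := by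
  set l := queryLog σ with hlog
  have h14 : l.length = σ.nat 14 := by simp [hlog, queryLog]
  set σ₁ : State := ⟨Function.update σ.nat 34 (n + 1), σ.real, σ.pos⟩
  set σ₂ : State := ⟨Function.update σ₁.nat 33 0, σ₁.real, σ₁.pos⟩
  have F : Frame answerCells [] σ σ₂ := ((Frame.refl _ _ σ).setNat _).setNat _
  have e₁ : Exec β O ω (.assign 34 (.add (.var 0) (.const 1))) σ σ₁ 6 [] := by
    have := Exec.setNat (β := β) (O := O) (ω := ω) (.const 34) (.add (.var 0) (.const 1)) σ
    simp only [NExp.eval, h0] at this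
    exact this
  have e₂ : Exec β O ω (.assign 33 (.const 0)) σ₁ σ₂ 3 [] :=
    Exec.setNat (β := β) (O := O) (ω := ω) (.const 33) (.const 0) σ₁
  -- Cell `34` starts with `n + 1`, more than any cardinality, so the first result is always
  -- recorded.
  obtain ⟨τ, p, tr, e₃, hp, -, -, htr, hsome, hmin⟩ := Exec.exists_loop (β := β) (O := O) (ω := ω)
    (b := .natLe (.add (.var 33) (.const 1)) (.var 14)) (P := answerStep L) (σ := σ₂)
    (fun m τ tr => τ.nat 33 = m ∧ Frame answerCells [] σ τ ∧
      tr.map (fun q => (specIdx q.j, q.X, q.ℓ)) =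
        (l.take m).map (fun e => (e.1, decode n e.2.1, e.2.2)) ∧
      ((τ.nat 34 = n + 1 ∧ tr = []) ∨ ∃ q ∈ tr, decode n (τ.nat 1) = q.X ∪ q.Y ∧
        τ.nat 34 = (q.X ∪ q.Y).card) ∧ ∀ q ∈ tr, τ.nat 34 ≤ (q.X ∪ q.Y).card)
    l.length (answerOps L n) ⟨by simp [σ₂], F, by simp, Or.inl ⟨by simp [σ₂, σ₁], rfl⟩, by simp⟩
    (by
      rintro m hm τ tr ⟨h33, hf, htr, hs, hmin⟩
      have hlm := queryLog_getElem hm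
      obtain ⟨j, hj⟩ := hl _ (List.getElem_mem hm)
      rw [hlm] at hj
      refine ⟨?_, ?_⟩
      · simp [h33, hf.nat 14 (by decide)]; omega
      obtain ⟨τ', p, Y, he, hp, h33', hf', hor⟩ := exec_answerStep (β := β) O ω τ
        (by rw [hf.nat 0 (by decide), h0]) j m h33
        (by rw [hf.nat_of_le (by decide) (by omega)]; exact hj)
      have hcard := (decode n (τ.nat (65 + 4 * m)) ∪ Y).card_le_univ
      rw [Fintype.card_fin] at hcard
      refine ⟨τ', p, _, he, hp, h33', hf.trans hf', ?_, ?_, ?_⟩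
      · rw [List.take_succ_eq_append_getElem hm, List.map_append, List.map_append, htr, hlm,
          hf.nat_of_le (by decide) (by omega), hf.nat_of_le (by decide) (by omega)]
        simpa using hj.symm
      · right
        rcases hor with ⟨h1, h2, h3⟩ | ⟨h1, h2, h3⟩
        · exact ⟨_, List.mem_append_right _ (List.mem_singleton_self _), h1, h2⟩
        · rcases hs with ⟨h4, h5⟩ | ⟨q, hq, h4, h5⟩
          · omega
          · exact ⟨q, List.mem_append_left _ hq, by rw [h1, h4], by rw [h2, h5]⟩
      · intro q hq
        rcases List.mem_append.1 hq with hq | hq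
        · have := hmin q hq
          rcases hor with ⟨h1, h2, h3⟩ | ⟨h1, h2, h3⟩ <;> omega
        · rw [List.mem_singleton.1 hq]
          rcases hor with ⟨h1, h2, h3⟩ | ⟨h1, h2, h3⟩
          · exact h2.le
          · rw [h2]; exact h3)
    (by
      rintro τ tr ⟨h33, hf, -⟩
      simp [h33, hf.nat 14 (by decide)]; omega)
  rw [List.take_length] at htr
  have hs : ∃ q ∈ tr, decode n (τ.nat 1) = q.X ∪ q.Y ∧ τ.nat 34 = (q.X ∪ q.Y).card := by
    rcases hsome with ⟨-, h⟩ | h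
    · rw [h] at htr
      simp at htr
      exact absurd htr.symm (by simpa using hne)
    · exact h
  obtain ⟨q, hq, hq1, hq2⟩ := hs
  refine ⟨τ, _, _, .seq e₁ (.seq e₂ e₃), ?_, htr, ⟨q, hq, hq1⟩, ?_⟩
  · have h1 : l.length * (7 + answerOps L n) ≤ l.length * (answerOps L n + 20) :=
      Nat.mul_le_mul_left _ (by omega)
    simp at hp
    rw [add_one_mul]
    omega
  · intro q' hq'
    have := hmin q' hq'
    rw [hq1, ← hq2]
    exact this

/-! ### The implementation -/

/-- An implementation of derandomized approximate monotone local search. -/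
def detAMLSProg (L : Finset (ℝ × ℝ)) (β : ℝ) : Prog L := .seq (listProg L β) (answerProg L)

theorem coinless_bestSamplingProg {L : Finset (ℝ × ℝ)} (β : ℝ) (js : List L) :
    (bestSamplingProg β js).Coinless := by
  induction js with
  | nil => trivial
  | cons j js ih =>
    refine ⟨?_, ih⟩
    simp [candidateProg, hyperProg, termProg, chooseProg, recordProg, Prog.Coinless]

theorem coinless_askProg {L : Finset (ℝ × ℝ)} (js : List L) : (askProg js).Coinless := by
  induction js with
  | nil => trivial
  | cons j js ih => exact ⟨trivial, ih⟩

theorem coinless_detAMLSProg (L : Finset (ℝ × ℝ)) (β : ℝ) : (detAMLSProg L β).Coinless := by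
  simp [detAMLSProg, listProg, tableSizeProg, blockSizeProg, roundsProg, roundProg,
    coinless_bestSamplingProg, bestIntersectionProg, termProg, chooseProg, extensionSizeProg,
    codeBoundProg, familyProg, codewordProg, decodeProg, decodeBlock, dropBits, moveBits, unionProg,
    pushProg, answerProg, answerStep, coinless_askProg, Prog.Coinless]

/-- The list `r` consists of the queries of round `k`; its length is at most `H` times the optimal
one. -/
def IsRoundList {L : Finset (ℝ × ℝ)} (n : ℕ) (β : ℝ) (k : ℕ) (H : ℝ)
    (r : List (L × Finset (Fin n) × ℕ)) : Prop :=
  ∃ (j : L) (t y : ℕ) (C : List (Finset (Fin n))), IsBestSampling n β k j t ∧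
    IsBestIntersection n k t (threshold j.1.1 β k t) y ∧ IsSetIntersectionFamily n k t y C ∧
    r = C.map (fun X => (j, X, ((k : ℤ) - ⌈threshold j.1.1 β k t⌉).toNat)) ∧
    C.length ≤ ⌈kappa n k t y * H⌉₊

theorem IsRoundList.length_le {L : Finset (ℝ × ℝ)} (hL : IsSpecList L) {β V : ℝ} (hβ : 1 ≤ β)
    {n k s tb : ℕ} {r : List (L × Finset (Fin n) × ℕ)} (hV : BoundsSampling L n β V)
    (hk : β * k ≤ n) (h : IsRoundList n β k (overhead n s tb) r) :
    r.length ≤ roundLength n s tb V := by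
  obtain ⟨j, t, y, C, hbs, hy, -, rfl, hC⟩ := h
  rw [List.length_map]
  exact hC.trans (ceil_kappa_le_roundLength hL hβ hV hk hbs hy)

/-- A bound for the operations of the program. -/
def totalOps (L : Finset (ℝ × ℝ)) (n s : ℕ) (V : ℝ) : ℕ :=
  listOps L n s V + ((n + 1) * roundLength n s (2 ^ (6 * s)) V + 1) * (answerOps L n + 20)

/-- The lists `r` are fixed before the oracles and the random bits: all queries are listed before
the first one is asked. This non-adaptivity also yields the analysis with random oracles. -/
theorem exists_run_detAMLSProg {L : Finset (ℝ × ℝ)} (hL : IsSpecList L) {β V : ℝ} (hβ : 1 ≤ β)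
    {n : ℕ} (hV : BoundsSampling L n β V) :
    ∃ (s : ℕ) (r : ℕ → List (L × Finset (Fin n) × ℕ)), IsTableSize n s ∧
      (∀ k : ℕ, β * k ≤ n → IsRoundList n β k (overhead n s (2 ^ (6 * s))) (r k)) ∧
      ∀ (O : L → Oracle n) (ω : ℕ → Bool), ∃ S p tr, Run β O ω (detAMLSProg L β) S p tr ∧
        p ≤ totalOps L n s V ∧
        tr.map (fun q => (q.j, q.X, q.ℓ)) = (List.range (⌊(n : ℝ) / β⌋₊ + 1)).flatMap r ∧
        (∃ q ∈ tr, S = q.X ∪ q.Y) ∧ ∀ q ∈ tr, S.card ≤ (q.X ∪ q.Y).card := by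
  obtain ⟨σ, p, hex, s, hs, hp, h0, g, hg, hlog⟩ := does_listProg hL hβ hV
  set K := ⌊(n : ℝ) / β⌋₊ + 1 with hK
  set N := roundLength n s (2 ^ (6 * s)) V with hN
  have hKn : K ≤ n + 1 := by
    have := le_of_mul_le hβ ((mul_le_iff_lt hβ n (K - 1)).2 (by omega))
    omega
  have hr : ∀ k : ℕ, ∃ r : List (L × Finset (Fin n) × ℕ), β * k ≤ n → IsRoundList n β k (overhead n s (2 ^ (6 * s))) r ∧
      (g k).map (fun e => (e.1, decode n e.2.1, e.2.2)) =
        r.map fun e => (specIdx e.1, e.2.1, e.2.2) := by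
    intro k
    by_cases hk : β * k ≤ n
    · obtain ⟨M, hM⟩ := hg k hk
      obtain ⟨j, t, y, C, h1, h2, h3, h4, h5, rfl⟩ := hM
      exact ⟨_, fun _ => ⟨⟨j, t, y, _, h1, h2, h3, rfl, by simpa using h5⟩, by simp [h4]⟩⟩
    · exact ⟨[], fun h => absurd h hk⟩
  choose r hr using hr
  have hmap : (queryLog σ).map (fun e => (e.1, decode n e.2.1, e.2.2)) =
      ((List.range K).flatMap r).map fun e => (specIdx e.1, e.2.1, e.2.2) := by
    rw [hlog, List.map_flatMap, List.map_flatMap]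
    refine List.flatMap_congr fun k hk => (hr k ((mul_le_iff_lt hβ n k).2 ?_)).2
    exact List.mem_range.1 hk
  refine ⟨s, r, hs, fun k hk => (hr k hk).1, fun O ω => ?_⟩
  obtain ⟨σ', p', tr, he, hp', htr, hsome, hmin⟩ := exec_answerProg (β := β) O ω σ h0 (by
      intro e he
      have := List.mem_map_of_mem (f := fun e => (e.1, decode n e.2.1, e.2.2)) he
      rw [hmap] at this
      obtain ⟨x, -, hx⟩ := List.mem_map.1 this
      exact ⟨x.1, (Prod.mk.inj hx).1.symm⟩) (by
      intro hnil
      rw [hnil, List.map_nil] at hmap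
      have h1 : r 0 = [] := by
        have h2 := List.map_eq_nil_iff.1 hmap.symm
        exact List.flatMap_eq_nil_iff.1 h2 0 (by simp [hK])
      -- Round `0` is never empty, since its family has to cover the empty set.
      obtain ⟨⟨j, t, y, C, -, -, hC, h3, -⟩, -⟩ := hr 0 (by simp)
      rw [h1] at h3
      obtain ⟨X, hX, -⟩ := hC.2.2 ∅ rfl
      rw [List.map_eq_nil_iff.1 h3.symm] at hX
      simp at hX)
  refine ⟨_, _, tr, ⟨σ', .seq (hex n O ω) he, rfl⟩, ?_, ?_, hsome, hmin⟩
  · rw [totalOps, ← hN]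
    refine add_le_add hp (hp'.trans (Nat.mul_le_mul_right _ (Nat.succ_le_succ ?_)))
    rw [← List.length_map (f := fun e => (e.1, decode n e.2.1, e.2.2)), hmap, List.length_map,
      List.length_flatMap]
    calc ((List.range K).map fun k => (r k).length).sum ≤
        ((List.range K).map fun k => (r k).length).length • N := by
          refine List.sum_le_card_nsmul _ _ ?_
          intro m hm
          obtain ⟨k, hk, rfl⟩ := List.mem_map.1 hm
          have hk' := (mul_le_iff_lt hβ n k).2 (List.mem_range.1 hk)
          exact (hr k hk').1.length_le hL hβ hV hk'
      _ ≤ (n + 1) * N := by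
          rw [List.length_map, List.length_range, smul_eq_mul]
          exact Nat.mul_le_mul_right _ hKn
  · have hinj : Function.Injective fun e : L × Finset (Fin n) × ℕ =>
        (specIdx e.1, e.2.1, e.2.2) := by
      rintro ⟨j, X, l⟩ ⟨j', X', l'⟩ h
      simp only [Prod.mk.injEq] at h
      rw [specIdx_injective h.1, h.2.1, h.2.2]
    refine hinj.list_map ?_
    rw [← hmap, ← htr, List.map_map]
    rfl

theorem exists_flatMap_of_map_eq {A B : Type*} (f : A → B) (r : ℕ → List B) (K : ℕ) (l : List A)
    (h : l.map f = (List.range K).flatMap r) :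
    ∃ q : ℕ → List A, l = (List.range K).flatMap q ∧ ∀ k < K, (q k).map f = r k := by
  induction K generalizing l with
  | zero => exact ⟨fun _ => [], by simpa using h, by simp⟩
  | succ K ih =>
    rw [List.range_succ, List.flatMap_append] at h
    obtain ⟨l₁, l₂, rfl, h₁, h₂⟩ := List.map_eq_append_iff.1 h
    obtain ⟨q, rfl, hq⟩ := ih l₁ h₁
    refine ⟨fun k => if k = K then l₂ else q k, ?_, fun k hk => ?_⟩
    · rw [List.range_succ, List.flatMap_append]
      congr 1
      · refine List.flatMap_congr fun k hk => ?_
        rw [if_neg (by rw [List.mem_range] at hk; omega)]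
      · simp
    · by_cases hkK : k = K
      · subst hkK; simpa using h₂
      · simpa [hkK] using hq k (by omega)

/-- The largest optimal sampling cost. -/
def maxSampling (L : Finset (ℝ × ℝ)) (n : ℕ) (β : ℝ) : ℝ :=
  sSup {v | ∃ (k : ℕ) (j : L) (t : ℕ), β * k ≤ n ∧ IsBestSampling n β k j t ∧
    v = samplingCost n β k j.1 t}

theorem boundsSampling_maxSampling {L : Finset (ℝ × ℝ)} {β : ℝ} (hβ : 1 ≤ β) (n : ℕ) :
    BoundsSampling L n β (maxSampling L n β) := by
  intro k j t hk hjt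
  refine le_csSup (Set.Finite.bddAbove ?_) ⟨k, j, t, hk, hjt, rfl⟩
  refine ((Finset.range (n + 1) ×ˢ (Finset.univ : Finset L) ×ˢ Finset.range (n + 1)).finite_toSet.image
    fun x => samplingCost n β x.1 x.2.1.1 x.2.2).subset ?_
  rintro v ⟨k, j, t, hk, hjt, rfl⟩
  refine ⟨(k, j, t), ?_, rfl⟩
  have h1 := le_of_mul_le hβ hk
  have h2 := hjt.1.le_card hk
  simp; omega

theorem isDetAMLS_detAMLSProg {L : Finset (ℝ × ℝ)} (hL : IsSpecList L) {β : ℝ} (hβ : 1 ≤ β) :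
    IsDetAMLS β (detAMLSProg L β) := by
  refine ⟨coinless_detAMLSProg L β, fun n F _ O _ _ ω => ?_⟩
  obtain ⟨s, r, -, hr, hrun⟩ := exists_run_detAMLSProg hL hβ (boundsSampling_maxSampling hβ n)
  obtain ⟨S, p, tr, hR, -, htr, ⟨q, hq, hS⟩, hmin⟩ := hrun O ω
  obtain ⟨round, rfl, hround⟩ := exists_flatMap_of_map_eq _ _ _ _ htr
  have hmem : ∀ q, q ∈ (List.range (⌊(n : ℝ) / β⌋₊ + 1)).flatMap round ↔
      ∃ k ≤ ⌊(n : ℝ) / β⌋₊, q ∈ round k := by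
    intro q; simp [List.mem_flatMap]
  refine ⟨S, p, round, hR, fun k hk => ?_, ?_, fun k hk q hq => hmin q ((hmem q).2 ⟨k, hk, hq⟩)⟩
  · obtain ⟨j, t, y, C, h1, h2, h3, h4, -⟩ := hr k ((mul_le_iff_lt hβ n k).2 (by omega))
    exact ⟨j, t, y, C, h1, h2, h3, by rw [hround k (by omega), h4]⟩
  · obtain ⟨k, hk, hqk⟩ := (hmem q).1 hq
    exact ⟨k, hk, q, hqk, hS⟩

/-! ### The implementation is a randomized approximation -/

theorem coinLaw_window_singleton (pos m : ℕ) (a : Fin m → Bool) :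
    coinLaw {ω | (fun i : Fin m => ω (pos + (i : ℕ))) = a} = (2⁻¹ : ENNReal) ^ m := by
  set e : Fin m ↪ ℕ := ⟨fun i => pos + (i : ℕ), fun i j h => Fin.ext (by simpa using h)⟩ with he
  set t : ℕ → Set Bool := fun x => {b | ∀ i : Fin m, e i = x → b = a i} with ht
  have h1 : {ω : ℕ → Bool | (fun i : Fin m => ω (pos + (i : ℕ))) = a} =
      Set.pi (Finset.univ.map e : Finset ℕ) t := by
    ext ω
    simp only [Set.mem_ofPred_eq, Set.mem_pi, Finset.coe_map, Finset.coe_univ, Set.image_univ,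
      Set.mem_range, forall_exists_index, forall_apply_eq_imp_iff, ht, funext_iff]
    exact ⟨fun h i j hij => by rw [e.injective hij]; exact h i, fun h i => h i i rfl⟩
  rw [h1, coinLaw, Measure.infinitePi_pi _ fun _ _ => MeasurableSet.of_discrete, Finset.prod_map]
  have h2 : ∀ i, t (e i) = {a i} := by
    intro i
    ext b
    simp only [ht, Set.mem_ofPred_eq, Set.mem_singleton_iff]
    exact ⟨fun h => h i rfl, fun h j hj => by rw [e.injective hj]; exact h⟩
  simp [h2]

theorem coinLaw_window (pos m : ℕ) (A : Set (Fin m → Bool)) :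
    coinLaw {ω | (fun i : Fin m => ω (pos + (i : ℕ))) ∈ A} = A.ncard * (2⁻¹ : ENNReal) ^ m := by
  classical
  have h1 : {ω : ℕ → Bool | (fun i : Fin m => ω (pos + (i : ℕ))) ∈ A} =
      ⋃ a ∈ A.toFinset, {ω | (fun i : Fin m => ω (pos + (i : ℕ))) = a} := by
    ext ω; simp
  rw [h1, measure_biUnion_finset]
  · simp only [coinLaw_window_singleton, Finset.sum_const, nsmul_eq_mul, Set.ncard_eq_toFinset_card']
  · intro a _ b _ hab
    exact Set.disjoint_left.2 fun ω h h' => hab (h.symm.trans h')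
  · intro a _
    have : Measurable fun (ω : ℕ → Bool) (i : Fin m) => ω (pos + (i : ℕ)) := by fun_prop
    exact this (measurableSet_singleton a)

/-- A window of consecutive coin flips is uniformly distributed wherever it starts, so the
proportion of good bit strings becomes a probability. -/
theorem Oracle.IsExtensionOracle.half_le_coinLaw {n : ℕ} {O : Oracle n} {α : ℝ}
    {F : Set (Finset (Fin n))} (h : O.IsExtensionOracle α F) {X : Finset (Fin n)} {ℓ : ℕ}
    (hX : ∃ S, IsExtension F X ℓ S) (pos : ℕ) :
    1 / 2 ≤ coinLaw {ω | IsExtension F X (α * ℓ) (O.answer X ℓ fun i => ω (pos + (i : ℕ)))} := by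
  have h1 := h.2 X ℓ hX
  set A : Set (Fin O.bits → Bool) := {r | IsExtension F X (α * ℓ) (O.answer X ℓ r)}
  have h2 : 2 ^ O.bits ≤ 2 * A.ncard := by
    have : (2 : ℝ) ^ O.bits ≤ 2 * A.ncard := by linarith
    exact_mod_cast this
  have h3 : (2 : ENNReal) ^ O.bits ≤ 2 * A.ncard := by exact_mod_cast h2
  have h4 := coinLaw_window pos O.bits A
  refine le_of_le_of_eq ?_ h4.symm
  rw [← ENNReal.inv_pow, ← div_eq_mul_inv, ENNReal.le_div_iff_mul_le (by simp) (by simp)]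
  calc 1 / 2 * (2 : ENNReal) ^ O.bits ≤ 1 / 2 * (2 * A.ncard) := by gcongr
    _ = A.ncard := by
      rw [← mul_assoc, one_div, ENNReal.inv_mul_cancel (by simp) (by simp), one_mul]

/-- For a minimum solution `T`, one good answer to the query `X` of round `|T|` that hits `T`
suffices. Its place in the list is known in advance, hence so is its window of random bits, and no
repetition or independence argument is needed. -/
theorem isRandomizedApprox_detAMLSProg {L : Finset (ℝ × ℝ)} (hL : IsSpecList L) {β : ℝ}
    (hβ : 1 ≤ β) : IsRandomizedApprox β (detAMLSProg L β) := by
  intro n F hF O hO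
  obtain ⟨s, r, -, hr, hrun⟩ := exists_run_detAMLSProg hL hβ (boundsSampling_maxSampling hβ n)
  have hmem : ∀ {ω S p} {tr : List (Query L n)}, Run β O ω (detAMLSProg L β) S p tr →
      (∃ q ∈ tr, S = q.X ∪ q.Y) → S ∈ F := by
    rintro ω S p tr ⟨σ, he, -⟩ ⟨q, hq, rfl⟩
    obtain ⟨r, hr⟩ := (he.answered (coinless_detAMLSProg L β)).2.exists_answer hq
    rw [hr, Finset.union_comm]
    exact (hO q.j).1 _ _ _
  refine ⟨fun ω => ?_, ?_⟩
  · obtain ⟨S, p, tr, hR, -, -, hS, -⟩ := hrun O ω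
    exact ⟨S, p, tr, hR, hmem hR hS⟩
  obtain ⟨T, hT, hTmin⟩ := Set.exists_min_image F Finset.card F.toFinite ⟨_, hF.1⟩
  have happ : ∀ S ∈ F, (S.card : ℝ) ≤ β * T.card → IsApproxSolution β F S := fun S hS h =>
    ⟨hS, fun T' hT' => h.trans (mul_le_mul_of_nonneg_left (by exact_mod_cast hTmin T' hT')
      (by linarith))⟩
  rcases lt_or_ge (n : ℝ) (β * T.card) with hk | hk
  · have huniv : {ω | ∃ S p tr, Run β O ω (detAMLSProg L β) S p tr ∧ IsApproxSolution β F S} =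
        Set.univ := by
      refine Set.eq_univ_of_forall fun ω => ?_
      obtain ⟨S, p, tr, hR, -, -, hS, -⟩ := hrun O ω
      refine ⟨S, p, tr, hR, happ S (hmem hR hS) (le_trans ?_ hk.le)⟩
      exact_mod_cast (by simpa using S.card_le_univ : S.card ≤ n)
    rw [huniv, measure_univ]
    simp
  obtain ⟨j, t, y, C, h1, h2, h3, h4, -⟩ := hr T.card hk
  obtain ⟨X, hX, hXy⟩ := h3.2.2 T rfl
  set ℓ := ((T.card : ℤ) - ⌈threshold j.1.1 β T.card t⌉).toNat with hℓ
  have hin : (j, X, ℓ) ∈ (List.range (⌊(n : ℝ) / β⌋₊ + 1)).flatMap r := by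
    refine List.mem_flatMap.2 ⟨T.card, List.mem_range.2 ((mul_le_iff_lt hβ n _).1 hk), ?_⟩
    rw [h4]
    exact List.mem_map_of_mem (f := fun X => (j, X, ℓ)) hX
  -- The queries in `l₁` determine how many bits are consumed before the decisive query.
  obtain ⟨l₁, l₂, hl⟩ := List.append_of_mem hin
  have hext : ∃ S, IsExtension F X (ℓ : ℝ) S := ⟨_, isExtension_sdiff hF hT rfl h2.1.1 hXy⟩
  refine ((hO j).half_le_coinLaw hext (l₁.map fun e => (O e.1).bits).sum).trans (measure_mono ?_)
  intro ω hω
  obtain ⟨S, p, tr, hR, -, htr, hS, hmin⟩ := hrun O ω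
  refine ⟨S, p, tr, hR, happ S (hmem hR hS) ?_⟩
  obtain ⟨σ, he, -⟩ := hR
  rw [hl] at htr
  obtain ⟨tr₁, tr₂, rfl, htr₁, htr₂⟩ := List.map_eq_append_iff.1 htr
  obtain ⟨q, tr₃, rfl, hq, -⟩ := List.map_eq_cons_iff.1 htr₂
  obtain ⟨hqY, -⟩ := (he.answered (coinless_detAMLSProg L β)).2.of_append
  obtain ⟨qj, qX, qℓ, qY⟩ := q
  simp only [Prod.mk.injEq] at hq
  obtain ⟨rfl, rfl, rfl⟩ := hq
  have hsum : (initial n).pos + (tr₁.map fun q => (O q.j).bits).sum =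
      (l₁.map fun e => (O e.1).bits).sum := by
    rw [← htr₁, List.map_map]; simp [initial, Function.comp_def]
  rw [hsum] at hqY
  have hcard := hmin _ (List.mem_append_right _ List.mem_cons_self)
  refine le_trans (Nat.cast_le.2 hcard) ?_
  refine card_union_le_of_isExtension (F := F) (hL.2 _ qj.2).1 h1.1 (h3.2.1 _ hX) ?_
  dsimp only at hqY ⊢
  rw [hqY]
  exact hω

/-! ### The cost of the implementation -/

theorem hyper_le_one {n k t : ℕ} (hk : k ≤ n) (ht : t ≤ n) (x : ℝ) : hyper n k t x ≤ 1 := by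
  obtain ⟨X, rfl⟩ := exists_card_eq ht
  have hc : (0 : ℝ) < n.choose k := by exact_mod_cast Nat.choose_pos hk
  refine le_of_mul_le_mul_right ?_ hc
  rw [hyper_mul_choose hk, one_mul]
  refine Nat.cast_le.2 ((Finset.card_filter_le _ _).trans ?_)
  simp

theorem rpow_le_samplingCost {L : Finset (ℝ × ℝ)} (hL : IsSpecList L) {β : ℝ} (hβ : 1 ≤ β)
    {n k t : ℕ} {j : L} (hk : β * k ≤ n) (h : Admissible j.1.1 β k t) :
    j.1.2 ^ ((β * k - t) / j.1.1) ≤ samplingCost n β k j.1 t := by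
  obtain ⟨hα, hc⟩ := hL.2 _ j.2
  rw [samplingCost, le_div_iff₀ (hyper_pos_of_admissible hα hβ h hk)]
  exact mul_le_of_le_one_right (by positivity) (hyper_le_one (le_of_mul_le hβ hk) (h.le_card hk) _)

theorem one_le_rpow_price {L : Finset (ℝ × ℝ)} (hL : IsSpecList L) {β : ℝ} {k t : ℕ} {j : L}
    (h : Admissible j.1.1 β k t) : 1 ≤ j.1.2 ^ ((β * k - t) / j.1.1) := by
  obtain ⟨hα, hc⟩ := hL.2 _ j.2
  exact Real.one_le_rpow hc (div_nonneg (by linarith [h.2]) (by linarith))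

/-- The cost of the queries of one round. -/
theorem IsRoundList.sum_le {L : Finset (ℝ × ℝ)} (hL : IsSpecList L) {β V H : ℝ} (hβ : 1 ≤ β)
    (hH : 0 ≤ H) {n k : ℕ} {r : List (L × Finset (Fin n) × ℕ)} (hV : BoundsSampling L n β V)
    (hk : β * k ≤ n) (h : IsRoundList n β k H r) :
    (r.map fun e => e.1.1.2 ^ e.2.2).sum ≤ (n + 1) * V * H + V := by
  obtain ⟨j, t, y, C, hbs, hy, -, rfl, hC⟩ := h
  obtain ⟨hα, hc⟩ := hL.2 _ j.2
  set e := (β * k - t) / j.1.1 with he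
  have he0 : 0 ≤ e := div_nonneg (by linarith [hbs.1.2]) (by linarith)
  have hcost := hV k j t hk hbs
  have h1 : j.1.2 ^ ⌊e⌋₊ ≤ j.1.2 ^ e := by
    rw [← Real.rpow_natCast]
    exact Real.rpow_le_rpow_of_exponent_le hc (Nat.floor_le he0)
  have h2 : j.1.2 ^ e ≤ V := (rpow_le_samplingCost hL hβ hk hbs.1).trans hcost
  have hh := hyper_pos_of_admissible hα hβ hbs.1 hk
  -- The number of sets times the price is the sampling cost, up to the factor lost in
  -- `kappa_mul_hyper_le`. Rounding up the number of sets adds the single `V` of the conclusion.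
  have h3 : kappa n k t y * j.1.2 ^ e ≤ (n + 1) * V := by
    have h4 := kappa_mul_hyper_le hα hβ hbs.1 hk hy
    have h5 : j.1.2 ^ e ≤ V * hyper n k t (threshold j.1.1 β k t) := by
      rw [samplingCost, div_le_iff₀ hh] at hcost
      exact hcost
    have hkap : 0 ≤ kappa n k t y := by rw [kappa]; positivity
    have hV0 : 0 ≤ V := le_trans (by positivity) h2
    calc kappa n k t y * j.1.2 ^ e
        ≤ kappa n k t y * (V * hyper n k t (threshold j.1.1 β k t)) := by gcongr
      _ = kappa n k t y * hyper n k t (threshold j.1.1 β k t) * V := by ring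
      _ ≤ (n + 1) * V := by gcongr
  rw [toNat_sub_ceil hα, List.map_map]
  have h4 : ((C.map ((fun e : L × Finset (Fin n) × ℕ => e.1.1.2 ^ e.2.2) ∘
      fun X => (j, X, ⌊(β * k - t) / j.1.1⌋₊))).sum : ℝ) = C.length * j.1.2 ^ ⌊e⌋₊ := by
    simp [Function.comp_def, he]
  have hkH : 0 ≤ kappa n k t y * H := mul_nonneg (by rw [kappa]; positivity) hH
  have h5 : (C.length : ℝ) ≤ kappa n k t y * H + 1 :=
    (Nat.cast_le.2 hC).trans (Nat.ceil_lt_add_one hkH).le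
  rw [h4]
  calc C.length * j.1.2 ^ ⌊e⌋₊ ≤ (kappa n k t y * H + 1) * j.1.2 ^ e := by
        gcongr
    _ = kappa n k t y * j.1.2 ^ e * H + j.1.2 ^ e := by ring
    _ ≤ (n + 1) * V * H + V := by gcongr

theorem one_le_overhead {n s tb : ℕ} : 1 ≤ overhead n s tb := by
  have h1 : (1 : ℝ) ≤ 16 * ((s : ℝ) + 1) ^ 7 := by
    have : (1 : ℝ) ≤ ((s : ℝ) + 1) ^ 7 := one_le_pow₀ (by linarith [s.cast_nonneg (α := ℝ)])
    linarith
  have h2 : (1 : ℝ) ≤ (16 * ((s : ℝ) + 1) ^ 7) ^ ((n : ℝ) / s) := Real.one_le_rpow h1 (by positivity)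
  have h3 : (1 : ℝ) ≤ 2 ^ (tb + s) := one_le_pow₀ (by norm_num)
  rw [overhead]
  nlinarith

theorem IsTableSize.two_pow_le {n s : ℕ} (h : IsTableSize n s) : 2 ^ (16 * s) ≤ 65536 * (n + 1) := by
  rcases h.2.2 with rfl | h
  · norm_num
  · omega

theorem roundOps_le (L : Finset (ℝ × ℝ)) {n s : ℕ} (hs : IsTableSize n s) :
    (roundOps L n s (2 ^ (6 * s)) : ℝ) ≤ 10 ^ 9 * ((L.card + 1) * ((n : ℝ) + 1) ^ 3) := by
  have h16 : ((2 ^ (16 * s) : ℕ) : ℝ) ≤ 65536 * (n + 1) := by exact_mod_cast hs.two_pow_le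
  have h6 : ((2 ^ (6 * s) : ℕ) : ℝ) ≤ ((2 ^ (16 * s) : ℕ) : ℝ) :=
    Nat.cast_le.2 (Nat.pow_le_pow_right (by norm_num) (by omega))
  rw [roundOps, codewordOps]
  generalize 2 ^ (16 * s) = a at *
  generalize 2 ^ (6 * s) = b at *
  push_cast
  have hm : (0 : ℝ) ≤ L.card := Nat.cast_nonneg _
  set m : ℝ := (L.card : ℝ)
  have hx : (1 : ℝ) ≤ n + 1 := by linarith [n.cast_nonneg (α := ℝ)]
  set x : ℝ := n + 1
  have h1 : x * a ≤ x * (65536 * x) := by gcongr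
  have h2 : x ≤ x ^ 3 := le_self_pow₀ hx (by norm_num)
  have h3 : x ^ 2 ≤ x ^ 3 := pow_le_pow_right₀ hx (by norm_num)
  have h4 : x ^ 3 ≤ (m + 1) * x ^ 3 := le_mul_of_one_le_left (by positivity) (by linarith)
  have h5 : x * (65536 * x) = 65536 * x ^ 2 := by ring
  linarith

theorem answerOps_le (L : Finset (ℝ × ℝ)) (n : ℕ) :
    (answerOps L n + 20 : ℝ) ≤ 1000 * ((L.card + 1) * ((n : ℝ) + 1) ^ 3) := by
  rw [answerOps]
  push_cast
  have hm : (0 : ℝ) ≤ L.card := Nat.cast_nonneg _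
  set m : ℝ := (L.card : ℝ)
  have hx : (1 : ℝ) ≤ n + 1 := by linarith [n.cast_nonneg (α := ℝ)]
  set x : ℝ := n + 1
  have h1 : x ≤ x ^ 3 := le_self_pow₀ hx (by norm_num)
  have h2 : m ≤ m * x ^ 3 := le_mul_of_one_le_right hm (by linarith)
  have h3 : 0 ≤ m * x ^ 3 := by positivity
  have h4 : (m + 1) * x ^ 3 = m * x ^ 3 + x ^ 3 := by ring
  linarith

/-- The number of operations is polynomial, up to the factors for the number of queries. -/
theorem totalOps_le (L : Finset (ℝ × ℝ)) {n s : ℕ} {V : ℝ} (hV : 1 ≤ V) (hs : IsTableSize n s) :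
    (totalOps L n s V : ℝ) ≤ (10 ^ 11 * (L.card + 1)) * (n + 1) ^ 5 *
      (V * overhead n s (2 ^ (6 * s))) := by
  have hro := roundOps_le L hs
  have hao := answerOps_le L n
  have hH1 : 1 ≤ overhead n s (2 ^ (6 * s)) := one_le_overhead
  have hrl := (Nat.ceil_lt_add_one
    (a := ((n : ℝ) + 1) * V * overhead n s (2 ^ (6 * s))) (by positivity)).le
  rw [totalOps, listOps]
  rw [← roundLength] at hrl
  generalize roundLength n s (2 ^ (6 * s)) V = N at *
  generalize roundOps L n s (2 ^ (6 * s)) = R at *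
  generalize answerOps L n = A at *
  generalize overhead n s (2 ^ (6 * s)) = H at *
  push_cast
  have hx : (1 : ℝ) ≤ n + 1 := by linarith [n.cast_nonneg (α := ℝ)]
  have hm1 : (1 : ℝ) ≤ L.card + 1 := by linarith [L.card.cast_nonneg (α := ℝ)]
  have hn2 : (n : ℝ) + 2 ≤ 2 * (n + 1) := by linarith
  set x : ℝ := n + 1 with hxe
  set W : ℝ := (L.card + 1) * x ^ 3 with hW
  set X := x * V * H with hX
  have hX1 : 1 ≤ X := one_le_mul_of_one_le_of_one_le (one_le_mul_of_one_le_of_one_le hx hV) hH1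
  have hW1 : 1 ≤ W := one_le_mul_of_one_le_of_one_le hm1 (one_le_pow₀ hx)
  have hXW : 1 ≤ X * W := one_le_mul_of_one_le_of_one_le hX1 hW1
  have h1 : ((N : ℝ) + 2) * R ≤ (4 * X) * (10 ^ 9 * W) :=
    mul_le_mul (by linarith) hro (by positivity) (by positivity)
  have h2 : ((n : ℝ) + 2) * (((N : ℝ) + 2) * R + 520) ≤ (2 * x) * (5 * 10 ^ 9 * (X * W)) :=
    mul_le_mul hn2 (by linarith) (by positivity) (by positivity)
  have h3 : x * N + 1 ≤ x * (3 * X) := by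
    have h4 : x * N ≤ x * (2 * X) := by gcongr; linarith
    have h5 : 1 ≤ x * X := one_le_mul_of_one_le_of_one_le hx hX1
    linarith
  have h4 : (x * N + 1) * (A + 20) ≤ (x * (3 * X)) * (1000 * W) :=
    mul_le_mul h3 hao (by positivity) (by positivity)
  have h5 : (10 ^ 11 * ((L.card : ℝ) + 1)) * x ^ 5 * (V * H) = 10 ^ 11 * (x * (X * W)) := by
    rw [hX, hW]; ring
  have h6 : 0 ≤ x * (X * W) := by positivity
  rw [h5]
  linarith

theorem sum_flatMap {A : Type*} (l : List A) (f : A → List ℝ) :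
    (l.flatMap f).sum = (l.map fun a => (f a).sum).sum := by
  induction l with
  | nil => simp
  | cons a l ih => simp [ih]

/-- The cost of the program for universes of size `n` is, up to a factor of subexponential growth,
at most the largest optimal sampling cost. -/
theorem exists_cost_detAMLSProg {L : Finset (ℝ × ℝ)} (hL : IsSpecList L) {β : ℝ} (hβ : 1 ≤ β)
    (n : ℕ) : ∃ s, IsTableSize n s ∧ 1 ≤ maxSampling L n β ∧ ∀ (O : L → Oracle n) (ω : ℕ → Bool),
      ∃ S p tr, Run β O ω (detAMLSProg L β) S p tr ∧ execCost p tr ≤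
        (10 ^ 12 * (L.card + 1)) * (n + 1) ^ 5 *
          (maxSampling L n β * overhead n s (2 ^ (6 * s))) := by
  have hV := boundsSampling_maxSampling (L := L) hβ n
  obtain ⟨s, r, hs, hr, hrun⟩ := exists_run_detAMLSProg hL hβ hV
  have hV1 : 1 ≤ maxSampling L n β := by
    have h0 : β * (0 : ℕ) ≤ n := by simp
    obtain ⟨j, t, y, C, hbs, -⟩ := hr 0 h0
    exact (one_le_rpow_price hL hbs.1).trans
      ((rpow_le_samplingCost hL hβ h0 hbs.1).trans (hV 0 j t h0 hbs))
  refine ⟨s, hs, hV1, fun O ω => ?_⟩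
  obtain ⟨S, p, tr, hR, hp, htr, -⟩ := hrun O ω
  refine ⟨S, p, tr, hR, ?_⟩
  set V := maxSampling L n β
  set H := overhead n s (2 ^ (6 * s)) with hH
  have hH1 : 1 ≤ H := one_le_overhead
  set K := ⌊(n : ℝ) / β⌋₊ + 1 with hK
  have hKn : K ≤ n + 1 := by
    have := le_of_mul_le hβ ((mul_le_iff_lt hβ n (K - 1)).2 (by omega))
    omega
  have h1 : (p : ℝ) ≤ (10 ^ 11 * (L.card + 1)) * (n + 1) ^ 5 * (V * H) :=
    (Nat.cast_le.2 hp).trans (totalOps_le L hV1 hs)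
  have h2 : (tr.map fun q => q.j.1.2 ^ q.ℓ).sum ≤ (n + 1) * ((n + 1) * V * H + V) := by
    have e1 : (tr.map fun q => q.j.1.2 ^ q.ℓ) =
        ((List.range K).flatMap r).map fun e => e.1.1.2 ^ e.2.2 := by
      rw [← htr, List.map_map]; rfl
    rw [e1, List.map_flatMap, sum_flatMap]
    calc _ ≤ ((List.range K).map fun k => ((r k).map fun e => e.1.1.2 ^ e.2.2).sum).length •
          ((n + 1) * V * H + V) := by
          refine List.sum_le_card_nsmul _ _ ?_
          intro x hx
          obtain ⟨k, hk, rfl⟩ := List.mem_map.1 hx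
          have hk' := (mul_le_iff_lt hβ n k).2 (List.mem_range.1 hk)
          exact (hr k hk').sum_le hL hβ (by linarith) hV hk'
      _ ≤ (n + 1) * ((n + 1) * V * H + V) := by
          rw [List.length_map, List.length_range, nsmul_eq_mul]
          have : (K : ℝ) ≤ n + 1 := by exact_mod_cast hKn
          gcongr
  rw [execCost]
  have hx : (1 : ℝ) ≤ n + 1 := by linarith [n.cast_nonneg (α := ℝ)]
  have hm1 : (1 : ℝ) ≤ L.card + 1 := by linarith [L.card.cast_nonneg (α := ℝ)]
  generalize H = H at *
  set x : ℝ := n + 1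
  have hVH : V ≤ x * V * H := by
    calc V = 1 * V * 1 := by ring
      _ ≤ x * V * H := by gcongr
  have h3 : x * (x * V * H + V) ≤ x * (2 * (x * V * H)) := by gcongr; linarith
  have h4 : x * (2 * (x * V * H)) = 2 * (x ^ 2 * (V * H)) := by ring
  have h5 : x ^ 2 * (V * H) ≤ x ^ 5 * (V * H) := by
    exact mul_le_mul_of_nonneg_right (pow_le_pow_right₀ hx (by norm_num)) (by positivity)
  have h6 : x ^ 5 * (V * H) ≤ (L.card + 1) * (x ^ 5 * (V * H)) :=
    le_mul_of_one_le_left (by positivity) hm1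
  linarith

/-! ### Growth -/

theorem exists_pow_le_mul_pow (k : ℕ) {r : ℝ} (hr : 1 < r) :
    ∃ A : ℝ, 0 < A ∧ ∀ n : ℕ, ((n : ℝ) + 1) ^ k ≤ A * r ^ n := by
  have h := ((tendsto_pow_const_div_const_pow_of_one_lt k hr).comp (tendsto_add_atTop_nat 1))
  obtain ⟨A, hA⟩ := h.bddAbove_range
  have h1 : ∀ n : ℕ, ((n : ℝ) + 1) ^ k ≤ A * r ^ (n + 1) := by
    intro n
    have := hA ⟨n, rfl⟩
    simp only [Function.comp_apply, Nat.cast_add, Nat.cast_one] at this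
    rwa [div_le_iff₀ (by positivity)] at this
  refine ⟨A * r, ?_, fun n => by rw [mul_assoc, ← pow_succ']; exact h1 n⟩
  have := h1 0
  simp at this
  linarith

/-- Put `ρ = √r`. For large `s`, `16 (s + 1) ^ 7 ≤ ρ ^ s` bounds the loss over all blocks by `ρ ^
n`. The factor for the table is also at most `ρ ^ n`, because `s * 2 ^ (6 s) ≤ 2 ^ (12 s) ≤ n`. -/
theorem exists_overhead_le {r : ℝ} (hr : 1 < r) :
    ∃ A : ℝ, 0 < A ∧ ∀ n s : ℕ, IsTableSize n s → overhead n s (2 ^ (6 * s)) ≤ A * r ^ n := by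
  set ρ := √r with hρ
  have hρ1 : 1 < ρ := by rw [hρ, Real.lt_sqrt (by norm_num)]; simpa using hr
  have hρr : ρ * ρ = r := Real.mul_self_sqrt (by linarith)
  obtain ⟨s₀, hs₀⟩ : ∃ s₀ : ℕ, ∀ s ≥ s₀, 16 * ((s : ℝ) + 1) ^ 7 ≤ ρ ^ s ∧ 4 ≤ ρ ^ s ∧ 2 ≤ s := by
    set τ := √ρ with hτ
    have hτ1 : 1 < τ := by rw [hτ, Real.lt_sqrt (by norm_num)]; simpa using hρ1
    have hτρ : τ * τ = ρ := Real.mul_self_sqrt (by linarith)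
    obtain ⟨A, hA, hA'⟩ := exists_pow_le_mul_pow 7 hτ1
    have e1 := (tendsto_pow_atTop_atTop_of_one_lt hτ1).eventually_ge_atTop (16 * A)
    have e2 := (tendsto_pow_atTop_atTop_of_one_lt hρ1).eventually_ge_atTop 4
    obtain ⟨s₀, h⟩ := eventually_atTop.1 ((e1.and e2).and (eventually_ge_atTop 2))
    refine ⟨s₀, fun s hs => ⟨?_, (h s hs).1.2, (h s hs).2⟩⟩
    calc 16 * ((s : ℝ) + 1) ^ 7 ≤ 16 * (A * τ ^ s) := by gcongr; exact hA' s
      _ = (16 * A) * τ ^ s := by ring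
      _ ≤ τ ^ s * τ ^ s := by gcongr; exact (h s hs).1.1
      _ = ρ ^ s := by rw [← mul_pow, hτρ]
  -- Small `s` occur only for `n < 2 ^ (32 s₀)`; these finitely many values are absorbed by a
  -- constant.
  set B : ℝ := ∑ n ∈ Finset.range (2 ^ (32 * s₀)), ∑ s ∈ Finset.range s₀,
    overhead n s (2 ^ (6 * s)) with hB
  have hB0 : 0 ≤ B := Finset.sum_nonneg fun _ _ => Finset.sum_nonneg fun _ _ => overhead_nonneg _ _ _
  refine ⟨1 + B, by linarith, fun n s hs => ?_⟩
  have hrn : 1 ≤ r ^ n := one_le_pow₀ hr.le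
  rcases lt_or_ge s s₀ with h | h
  · have hn : n < 2 ^ (32 * s₀) := hs.2.1.trans_le (Nat.pow_le_pow_right (by norm_num) (by omega))
    have h1 : overhead n s (2 ^ (6 * s)) ≤ B :=
      (Finset.single_le_sum (f := fun s => overhead n s (2 ^ (6 * s)))
        (fun _ _ => overhead_nonneg _ _ _) (Finset.mem_range.2 h)).trans
      (Finset.single_le_sum (f := fun n => ∑ s ∈ Finset.range s₀, overhead n s (2 ^ (6 * s)))
        (fun _ _ => Finset.sum_nonneg fun _ _ => overhead_nonneg _ _ _) (Finset.mem_range.2 hn))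
    nlinarith
  · obtain ⟨h1, h2, h3⟩ := hs₀ s h
    have hsn : 2 ^ (16 * s) ≤ n := hs.2.2.resolve_left (by omega)
    have h4 : (16 * ((s : ℝ) + 1) ^ 7) ^ ((n : ℝ) / s) ≤ ρ ^ n := by
      have hs0 : (s : ℝ) ≠ 0 := by positivity
      calc _ ≤ (ρ ^ s) ^ ((n : ℝ) / s) := Real.rpow_le_rpow (by positivity) h1 (by positivity)
        _ = ρ ^ n := by
          rw [← Real.rpow_natCast ρ s, ← Real.rpow_mul (by positivity), mul_div_cancel₀ _ hs0,
            Real.rpow_natCast]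
    have h5 : (2 : ℝ) ^ (2 ^ (6 * s) + s) ≤ ρ ^ n := by
      have e1 : s ≤ 2 ^ (6 * s) := by
        have := Nat.lt_two_pow_self (n := 6 * s)
        omega
      have e2 : s * 2 ^ (6 * s) ≤ n := by
        calc s * 2 ^ (6 * s) ≤ 2 ^ (6 * s) * 2 ^ (6 * s) := Nat.mul_le_mul_right _ e1
          _ = 2 ^ (12 * s) := by rw [← pow_add]; congr 1; ring
          _ ≤ 2 ^ (16 * s) := Nat.pow_le_pow_right (by norm_num) (by omega)
          _ ≤ n := hsn
      calc (2 : ℝ) ^ (2 ^ (6 * s) + s) ≤ 2 ^ (2 * 2 ^ (6 * s)) :=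
            pow_le_pow_right₀ (by norm_num) (by omega)
        _ = 4 ^ (2 ^ (6 * s)) := by rw [pow_mul]; norm_num
        _ ≤ (ρ ^ s) ^ (2 ^ (6 * s)) := by gcongr
        _ = ρ ^ (s * 2 ^ (6 * s)) := by rw [← pow_mul]
        _ ≤ ρ ^ n := pow_le_pow_right₀ hρ1.le e2
    calc overhead n s (2 ^ (6 * s)) ≤ ρ ^ n * ρ ^ n := by
          rw [overhead]
          exact mul_le_mul h5 h4 (by positivity) (by positivity)
      _ = r ^ n := by rw [← mul_pow, hρr]
      _ ≤ (1 + B) * r ^ n := by nlinarith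

/-- A sequence which grows at most like `(b * r) ^ n` for each `r > 1` is at most
`b ^ n * 2 ^ o(n)`. -/
theorem exists_isLittleO_of_le_mul_pow {c : ℕ → ℝ} {b : ℝ} (hb : 1 ≤ b) (hc : ∀ n, 1 ≤ c n)
    (h : ∀ r > 1, ∃ A : ℝ, ∀ n, c n ≤ A * (b * r) ^ n) :
    ∃ g : ℕ → ℝ, g =o[atTop] (fun n : ℕ => (n : ℝ)) ∧ ∀ N, ∀ n ≤ N, c n ≤ b ^ N * 2 ^ g N := by
  have hne : ∀ N : ℕ, (Finset.range (N + 1)).Nonempty := fun N => ⟨0, by simp⟩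
  -- The running maximum, since a cost bound at `N` concerns all universes with at most `N`
  -- elements.
  set M : ℕ → ℝ := fun N => (Finset.range (N + 1)).sup' (hne N) c with hM
  have hcM : ∀ N, ∀ n ≤ N, c n ≤ M N := fun N n hn =>
    Finset.le_sup' c (Finset.mem_range.2 (by omega))
  have hM1 : ∀ N, 1 ≤ M N := fun N => (hc 0).trans (hcM N 0 (by omega))
  have hb0 : 0 < b := by linarith
  -- Truncation at `0` makes the exponent nonnegative, so an upper bound is all that the little-o
  -- estimate requires.
  refine ⟨fun N => max 0 (Real.logb 2 (M N / b ^ N)), ?_, ?_⟩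
  · rw [isLittleO_iff]
    intro δ hδ
    have hr : (1 : ℝ) < 2 ^ (δ / 2) := Real.one_lt_rpow (by norm_num) (by linarith)
    obtain ⟨A, hA⟩ := h _ hr
    have hA1 : 1 ≤ A := by simpa using (hc 0).trans (hA 0)
    have hMA : ∀ N, M N ≤ A * (b * 2 ^ (δ / 2)) ^ N := by
      intro N
      refine Finset.sup'_le _ _ fun n hn => (hA n).trans ?_
      have hbr : 1 ≤ b * 2 ^ (δ / 2) := one_le_mul_of_one_le_of_one_le hb hr.le
      have := pow_le_pow_right₀ hbr (show n ≤ N by rw [Finset.mem_range] at hn; omega)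
      gcongr
    filter_upwards [eventually_ge_atTop ⌈Real.logb 2 A / (δ / 2)⌉₊] with N hN
    have hN' : Real.logb 2 A ≤ δ / 2 * N := by
      have := Nat.ceil_le.1 hN
      rwa [div_le_iff₀ (by linarith), mul_comm] at this
    rw [Real.norm_of_nonneg (le_max_left _ _), Real.norm_of_nonneg (by positivity)]
    refine max_le (by positivity) ?_
    have h1 : M N / b ^ N ≤ A * (2 ^ (δ / 2)) ^ N := by
      rw [div_le_iff₀ (by positivity)]
      refine (hMA N).trans (le_of_eq ?_)
      rw [mul_pow]; ring
    have h2 : Real.logb 2 (M N / b ^ N) ≤ Real.logb 2 (A * (2 ^ (δ / 2)) ^ N) :=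
      Real.logb_le_logb_of_le (by norm_num) (div_pos (by linarith [hM1 N]) (by positivity)) h1
    rw [Real.logb_mul (by positivity) (by positivity), Real.logb_pow,
      Real.logb_rpow (by norm_num) (by norm_num)] at h2
    linarith
  · intro N n hn
    refine (hcM N n hn).trans ?_
    have hMb : 0 < M N / b ^ N := div_pos (by linarith [hM1 N]) (by positivity)
    have h1 : M N / b ^ N ≤ 2 ^ max 0 (Real.logb 2 (M N / b ^ N)) := by
      calc M N / b ^ N = 2 ^ Real.logb 2 (M N / b ^ N) :=
            (Real.rpow_logb (by norm_num) (by norm_num) hMb).symm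
        _ ≤ _ := Real.rpow_le_rpow_of_exponent_le (by norm_num) (le_max_right _ _)
    rw [div_le_iff₀ (by positivity)] at h1
    linarith

/-! ### The theorem -/

theorem inv_choose_le_hyper {n k t : ℕ} {x : ℝ} (hk : k ≤ n) (ht : t ≤ n)
    (hx : x ≤ (min t k : ℕ)) : (n.choose t : ℝ)⁻¹ ≤ hyper n k t x := by
  have h1 := Nat.choose_pos ht
  have h2 := Nat.choose_pos (show min t k ≤ k by omega)
  have h3 := Nat.choose_pos (show t - min t k ≤ n - k by omega)
  refine le_trans ?_ (Finset.single_le_sum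
    (f := fun y => ((k.choose y : ℝ) * ((n - k).choose (t - y) : ℝ)) / (n.choose t : ℝ))
    (fun _ _ => by positivity)
    (Finset.mem_filter.2 ⟨Finset.mem_range.2 (Nat.lt_succ_self (min t k)), hx⟩))
  rw [inv_eq_one_div]
  gcongr
  exact_mod_cast Nat.mul_pos h2 h3

/-- The choice `t = ⌊β k⌋` leaves an exponent of at most `1`, and the success probability is at
least `1 / C(n, t)`. This crude bound is enough to see that some exponential cost is attained. -/
theorem boundsSampling_two_pow {L : Finset (ℝ × ℝ)} (hL : IsSpecList L) {β D : ℝ} (hβ : 1 ≤ β)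
    (hD : ∀ j : L, j.1.2 ≤ D) (n : ℕ) : BoundsSampling L n β (D * 2 ^ n) := by
  intro k j t hk hjt
  obtain ⟨hα, hc⟩ := hL.2 _ j.2
  have hadm : Admissible j.1.1 β k ⌊β * k⌋₊ := admissible_floor hβ k
  have htn := hadm.le_card hk
  refine (hjt.2 j _ hadm).trans ?_
  have h1 : (β * k - (⌊β * k⌋₊ : ℕ)) / j.1.1 ≤ 1 := by
    rw [div_le_one (by linarith)]
    linarith [Nat.lt_floor_add_one (β * k)]
  have h2 : j.1.2 ^ ((β * k - (⌊β * k⌋₊ : ℕ)) / j.1.1) ≤ D := by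
    refine le_trans ?_ (hD j)
    simpa using Real.rpow_le_rpow_of_exponent_le hc h1
  have h3 := inv_choose_le_hyper (le_of_mul_le hβ hk) htn (threshold_le_min hα hβ hadm)
  have hch : (0 : ℝ) < n.choose ⌊β * k⌋₊ := by exact_mod_cast Nat.choose_pos htn
  have h4 : (n.choose ⌊β * k⌋₊ : ℝ) ≤ 2 ^ n := by exact_mod_cast Nat.choose_le_two_pow _ _
  have h5 := hyper_pos_of_admissible hα hβ hadm hk
  have h6 : 1 ≤ 2 ^ n * hyper n k ⌊β * k⌋₊ (threshold j.1.1 β k ⌊β * k⌋₊) := by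
    calc (1 : ℝ) = n.choose ⌊β * k⌋₊ * (n.choose ⌊β * k⌋₊ : ℝ)⁻¹ := (mul_inv_cancel₀ hch.ne').symm
      _ ≤ _ := by gcongr
  rw [samplingCost, div_le_iff₀ h5, mul_assoc]
  have hD0 : 0 ≤ D := by linarith [hD j]
  nlinarith

theorem maxSampling_le {L : Finset (ℝ × ℝ)} {n : ℕ} {β V : ℝ} (hV0 : 0 ≤ V)
    (hV : BoundsSampling L n β V) : maxSampling L n β ≤ V := by
  refine Real.sSup_le ?_ hV0
  rintro v ⟨k, j, t, hk, hjt, rfl⟩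
  exact hV k j t hk hjt

/-- The cost of the implementation is at most `2 ^ o(n)` times the largest optimal sampling
cost. -/
theorem exists_costAtMost_detAMLSProg {L : Finset (ℝ × ℝ)} (hL : IsSpecList L) {β : ℝ}
    (hβ : 1 ≤ β) : ∃ c : ℕ → ℝ, (∀ n, 1 ≤ c n) ∧
      (∀ N B, (∀ n ≤ N, c n ≤ B) → CostAtMost β (detAMLSProg L β) N B) ∧
      ∀ r > 1, ∃ A > 0, ∀ n, c n ≤ A * r ^ n * maxSampling L n β := by
  choose s hs hV hrun using exists_cost_detAMLSProg hL hβ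
  have hm1 : (1 : ℝ) ≤ 10 ^ 12 * (L.card + 1) := by linarith [L.card.cast_nonneg (α := ℝ)]
  refine ⟨fun n => (10 ^ 12 * (L.card + 1)) * (n + 1) ^ 5 *
    (maxSampling L n β * overhead n (s n) (2 ^ (6 * s n))), fun n => ?_, fun N B hB => ?_, ?_⟩
  · have hx : (1 : ℝ) ≤ n + 1 := by linarith [n.cast_nonneg (α := ℝ)]
    exact one_le_mul_of_one_le_of_one_le (one_le_mul_of_one_le_of_one_le hm1 (one_le_pow₀ hx))
      (one_le_mul_of_one_le_of_one_le (hV n) one_le_overhead)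
  · intro n hn F _ O _ ω
    obtain ⟨S, p, tr, hR, hcost⟩ := hrun n O ω
    exact ⟨S, p, tr, hR, hcost.trans (hB n hn)⟩
  · intro r hr
    have hρ1 : 1 < √r := by rw [Real.lt_sqrt (by norm_num)]; simpa using hr
    obtain ⟨A₁, hA₁, h₁⟩ := exists_pow_le_mul_pow 5 hρ1
    obtain ⟨A₂, hA₂, h₂⟩ := exists_overhead_le hρ1
    refine ⟨(10 ^ 12 * (L.card + 1)) * A₁ * A₂, by positivity, fun n => ?_⟩
    have hV0 : 0 ≤ maxSampling L n β := by linarith [hV n]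
    calc (10 ^ 12 * (L.card + 1) : ℝ) * (n + 1) ^ 5 *
          (maxSampling L n β * overhead n (s n) (2 ^ (6 * s n)))
        ≤ (10 ^ 12 * (L.card + 1)) * (A₁ * √r ^ n) *
          (maxSampling L n β * (A₂ * √r ^ n)) := by
          have := h₁ n
          have := h₂ n (s n) (hs n)
          have := overhead_nonneg n (s n) (2 ^ (6 * s n))
          gcongr
      _ = (10 ^ 12 * (L.card + 1)) * A₁ * A₂ * (√r * √r) ^ n * maxSampling L n β := by
          rw [mul_pow]; ring
      _ = _ := by rw [Real.mul_self_sqrt (by linarith)]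

/-- Constant factors are absorbed by the polynomial factor, which is possible only for `n ≥ 2`. -/
theorem exists_le_pow {A : ℝ} : ∃ C : ℕ, ∀ n : ℕ, 2 ≤ n → A ≤ (n : ℝ) ^ C := by
  obtain ⟨C, hC⟩ := pow_unbounded_of_one_lt A (show (1 : ℝ) < 2 by norm_num)
  refine ⟨C, fun n hn => hC.le.trans ?_⟩
  have : (2 : ℝ) ≤ n := by exact_mod_cast hn
  gcongr

/-- The values over which the infimum is taken in `best`. -/
theorem nonempty_bases {L : Finset (ℝ × ℝ)} (hL : IsSpecList L) {β : ℝ} (hβ : 1 ≤ β) :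
    {d : ℝ | 1 ≤ d ∧ ∃ P : Prog L, IsRandomizedApprox β P ∧
      ∃ C : ℕ, ∀ n : ℕ, 2 ≤ n → CostAtMost β P n (d ^ n * (n : ℝ) ^ C)}.Nonempty := by
  obtain ⟨D, b, hD1, hD, -⟩ := hL.exists_bounds
  obtain ⟨c, -, hc, h⟩ := exists_costAtMost_detAMLSProg hL hβ
  obtain ⟨A, hA, hcA⟩ := h 2 (by norm_num)
  obtain ⟨C, hC⟩ := exists_le_pow (A := A * D)
  -- One factor `2 ^ n` comes from the crude bound on the sampling cost, the other from the overhead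
  -- with `r = 2`.
  refine ⟨4, by norm_num, _, isRandomizedApprox_detAMLSProg hL hβ, C, fun N hN => hc N _ ?_⟩
  intro n hn
  have hV := maxSampling_le (by positivity) (boundsSampling_two_pow hL hβ hD n)
  calc c n ≤ A * 2 ^ n * maxSampling L n β := hcA n
    _ ≤ A * 2 ^ n * (D * 2 ^ n) := by gcongr
    _ = 4 ^ n * (A * D) := by rw [show (4 : ℝ) = 2 * 2 by norm_num, mul_pow]; ring
    _ ≤ 4 ^ N * (N : ℝ) ^ C := by
      have := hC N hN
      gcongr
      norm_num

/-- The infimum need not be attained, so some `d < best * ρ` is used, with `ρ = r ^ (1 / 3)`. The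
three factors `ρ ^ n` pay for this gap, for the overhead of the program, and for the polynomial
factors of the lower bound. -/
theorem exists_costAtMost_best {L : Finset (ℝ × ℝ)} (hL : IsSpecList L) {β : ℝ} (hβ : 1 ≤ β) :
    ∃ g : ℕ → ℝ, g =o[atTop] (fun n : ℕ => (n : ℝ)) ∧
      ∀ n : ℕ, CostAtMost β (detAMLSProg L β) n (best L β ^ n * (2 : ℝ) ^ g n) := by
  obtain ⟨D, b, hD1, hD, hb⟩ := hL.exists_bounds
  obtain ⟨c, hc1, hc, h⟩ := exists_costAtMost_detAMLSProg hL hβ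
  have hne := nonempty_bases hL hβ
  have hbest : 1 ≤ best L β := le_csInf hne fun d hd => hd.1
  suffices key : ∀ r > 1, ∃ A : ℝ, ∀ n, c n ≤ A * (best L β * r) ^ n by
    obtain ⟨g, hg, hcg⟩ := exists_isLittleO_of_le_mul_pow hbest hc1 key
    exact ⟨g, hg, fun N => hc N _ (hcg N)⟩
  intro r hr
  set ρ := r ^ (1 / 3 : ℝ) with hρ
  have hρ1 : 1 < ρ := Real.one_lt_rpow hr (by norm_num)
  have hρr : ρ ^ 3 = r := by
    rw [hρ, ← Real.rpow_natCast, ← Real.rpow_mul (by linarith)]; norm_num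
  obtain ⟨d, ⟨hd1, P, hP, C, hC⟩, hd⟩ := exists_lt_of_csInf_lt hne
    (show best L β < best L β * ρ from lt_mul_of_one_lt_right (by linarith) hρ1)
  obtain ⟨A, hA, hcA⟩ := h ρ hρ1
  obtain ⟨A', hA', hpow⟩ := exists_pow_le_mul_pow (b + C) hρ1
  have hbr : 1 ≤ best L β * r := one_le_mul_of_one_le_of_one_le hbest hr.le
  -- The definition of `best` says nothing about `n < 2`, so these two costs are added to the
  -- constant.
  refine ⟨A * (2 * D * A') + c 0 + c 1, fun n => ?_⟩
  have hbrn : 1 ≤ (best L β * r) ^ n := one_le_pow₀ hbr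
  have h0 := hc1 0
  have h1 := hc1 1
  have hAD : 0 < A * (2 * D * A') := by positivity
  rcases lt_or_ge n 2 with hn | hn
  · have : c n ≤ c 0 + c 1 := by
      interval_cases n <;> linarith
    nlinarith
  · have hn1 : (1 : ℝ) ≤ n := by exact_mod_cast (by omega : 1 ≤ n)
    have hB1 : 1 ≤ d ^ n * (n : ℝ) ^ C :=
      one_le_mul_of_one_le_of_one_le (one_le_pow₀ hd1) (one_le_pow₀ hn1)
    have hV := maxSampling_le (V := 2 * D * (n + 1) ^ b * (d ^ n * (n : ℝ) ^ C)) (by positivity)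
      fun k j t hk hjt => samplingCost_le_of_isRandomizedApprox hL hβ hD1 hD hb hP hB1 (hC n hn)
        hk hjt
    calc c n ≤ A * ρ ^ n * maxSampling L n β := hcA n
      _ ≤ A * ρ ^ n * (2 * D * (n + 1) ^ b * (d ^ n * (n : ℝ) ^ C)) := by gcongr
      _ ≤ A * ρ ^ n * (2 * D * (n + 1) ^ b * ((best L β * ρ) ^ n * ((n : ℝ) + 1) ^ C)) := by
        gcongr
        linarith
      _ = A * (2 * D) * ρ ^ n * (best L β * ρ) ^ n * ((n : ℝ) + 1) ^ (b + C) := by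
        rw [pow_add]; ring
      _ ≤ A * (2 * D) * ρ ^ n * (best L β * ρ) ^ n * (A' * ρ ^ n) := by
        have := hpow n
        gcongr
      _ = A * (2 * D * A') * (best L β * ρ ^ 3) ^ n := by
        rw [mul_pow, mul_pow, ← pow_mul, show 3 * n = n + n + n by ring, pow_add, pow_add]; ring
      _ ≤ _ := by
        rw [hρr]
        gcongr
        linarith

end

end AMLS

theorem theorem2p3 (L : Finset (ℝ × ℝ)) (hL : AMLS.IsSpecList L) (β : ℝ) (hβ : 1 ≤ β) :
    (∀ P : AMLS.Prog L, AMLS.IsDetAMLS β P → AMLS.IsDeterministicApprox β P) ∧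
    ∃ P : AMLS.Prog L, AMLS.IsDetAMLS β P ∧
      ∃ g : ℕ → ℝ, g =o[Filter.atTop] (fun n : ℕ => (n : ℝ)) ∧
        ∀ n : ℕ, AMLS.CostAtMost β P n (AMLS.best L β ^ n * (2 : ℝ) ^ g n) :=
  ⟨fun _ hP => hP.isDeterministicApprox hL hβ,
    AMLS.detAMLSProg L β, AMLS.isDetAMLS_detAMLSProg hL hβ, AMLS.exists_costAtMost_best hL hβ⟩
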